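/- Let $L=4\ell$ with $\ell\ge 1$ an integer, let $t>0$ and $\beta>0$, and let $\Gamma_L=\mathbb Z^2/L\mathbb Z^2$ with edges $(x,\mu)=(x,x+e_\mu)$, $\mu=1,2$. For a gauge field $\sigma=(\sigma_{x,\mu})\in\{\pm1\}^{E(\Gamma_L)}$ let $$H_f(\sigma)=-t\sum_{x\in\Gamma_L}\sum_{\mu=1,2}\left(a^+_x\,\sigma_{x,\mu}\,a^-_{x+e_\mu}+\mathrm{h.c.}\right)$$ be the matter Hamiltonian on the fermionic Fock space $\mathcal F_L$ over $\ell^2(\Gamma_L)$, let $N$ be the number operator, and let $$Z^{+}(\sigma)=\mathrm{Tr}_{\mathcal F_L}\,e^{-\beta H_f(\sigma)},\qquad Z^{-}(\sigma)=\mathrm{Tr}_{\mathcal F_L}\,(-1)^N e^{-\beta H_f(\sigma)}$$ be the even and odd partition functions (at zero chemical potential). The flux of $\sigma$ through a plaquette is the product $\pm1$ of the four spins around it; the value $1$ is called flux $0$ and the value $-1$ flux $\pi$. The fluxes $a,b\in\{\pm1\}$ through the two non-contractible loops are the products of the spins along the circles $x_2=0$ and $x_1=0$. A flux configuration is $\Phi=(\Phi_\Lambda)_\Lambda\in\{\pm1\}^{P(\Gamma_L)}$,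 indexed by the plaquettes $\Lambda$, with $\prod_\Lambda\Phi_\Lambda=1$. For every such $\Phi$ and all $a,b\in\{\pm1\}$ there is a gauge field $\sigma$ with fluxes $(\Phi,a,b)$, and $Z^\pm(\sigma)$ depends only on these fluxes; write $Z^{\pm}_{\beta,L}(\Phi;a,b)$ for it. Let $Z^\pm_*=Z^\pm_{\beta,L}(\pi;-1,-1)$, where $\pi$ is the configuration with flux $\pi$ in every plaquette. Let $\Phi^*=(\phi^*_{i,j})$ be the chessboard configuration: labelling each plaquette by its upper-right vertex $(i,j)$, $1\le i,j\le L$, put $\phi^*_{i,j}=1$ if $i$ and $j$ are both odd, and $\phi^*_{i,j}=-1$ otherwise. Then $Z^\pm_*>0$, $Z^\pm_{\beta,L}(\Phi^*;a,b)>0$ for all $a,b$, and $Z^\pm_{\beta,L}(\Phi;a,b)\ge 0$ for all flux configurations $\Phi$ and all $a,b$. Set $$\Delta^{\pm}_{\beta,L}=-\frac{1}{\beta L^2}\Big(\max_{a,b\in\{\pm1\}}\log Z^\pm_{\beta,L}(\Phi^*;a,b)-\log Z^\pm_*\Big)\in\mathbb R .$$ For every flux configuration $\Phi$, all $a,b\in\{\pm1\}$,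 and $k$ the number of plaquettes $\Lambda$ with $\Phi_\Lambda=1$, $$-\frac1\beta\log Z^{\pm}_{\beta,L}(\Phi;a,b)\;\ge\;k\,\Delta^{\pm}_{\beta,L}-\frac1\beta\log Z^\pm_* ,$$ where the left-hand side is read as $+\infty$ if $Z^{\pm}_{\beta,L}(\Phi;a,b)=0$. Here the sign $\pm$ is the same throughout. -/

import Mathlib

namespace Z2Gauge

open scoped Matrix BigOperators

/-- The vertices of the square lattice of side `L` with periodic boundary conditions. -/
abbrev Site (L : ℕ) := ZMod L × ZMod L

/-- The two standard basis vectors; the index `0` is the horizontal direction, `1` the vertical. -/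
def e {L : ℕ} (μ : Fin 2) : Site L := if μ = 0 then (1, 0) else (0, 1)

/-- A gauge field: `σ x μ = ±1` is the spin on the edge from `x` to `x + e μ`. -/
abbrev GaugeField (L : ℕ) := Site L → Fin 2 → ℤˣ

/-- The product of the four spins around the plaquette whose upper-right corner is `x`
(`1` is flux `0`, `-1` is flux `π`). -/
def plaquetteFlux {L : ℕ} (σ : GaugeField L) (x : Site L) : ℤˣ :=
  σ (x - e 0 - e 1) 0 * σ (x - e 1) 1 * σ (x - e 0) 0 * σ (x - e 0 - e 1) 1

section Fluxes

variable {L : ℕ} [NeZero L]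

/-- The product of the spins along the horizontal circle `x₂ = 0`. -/
def horizontalFlux (σ : GaugeField L) : ℤˣ := ∏ i : ZMod L, σ (i, 0) 0

/-- The product of the spins along the vertical circle `x₁ = 0`. -/
def verticalFlux (σ : GaugeField L) : ℤˣ := ∏ j : ZMod L, σ (0, j) 1

/-- The gauge field `σ` has plaquette fluxes `Φ` (plaquettes labelled by their upper-right corner)
and fluxes `a`, `b` through the horizontal and the vertical non-contractible loop. -/
def HasFluxes (σ : GaugeField L) (Φ : Site L → ℤˣ) (a b : ℤˣ) : Prop :=
  (∀ x, plaquetteFlux σ x = Φ x) ∧ horizontalFlux σ = a ∧ verticalFlux σ = b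

end Fluxes

section Fock

variable {L : ℕ} [NeZero L]

/-- The enumeration of the sites used to order the fermionic modes. -/
def siteIndex (x : Site L) : ℕ := x.1.val + L * x.2.val

/-- The annihilation operator `a⁻_x` on the Fock space over `ℓ²(Γ_L)`, as a matrix in the
occupation number basis. The basis vector of `S = {x₁ < ⋯ < xₙ}` is `x₁ ∧ ⋯ ∧ xₙ`, so that
`a⁻_x |T⟩ = (-1)^{#{y ∈ T, y < x}} |T \ {x}⟩` if `x ∈ T`, and `a⁻_x |T⟩ = 0` otherwise. -/
def annihilate (x : Site L) : Matrix (Finset (Site L)) (Finset (Site L)) ℂ :=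
  Matrix.of fun S T =>
    if x ∈ T ∧ S = T.erase x then (-1) ^ (T.filter fun y => siteIndex y < siteIndex x).card else 0

/-- The creation operator `a⁺_x`, the adjoint of `a⁻_x`. -/
def create (x : Site L) : Matrix (Finset (Site L)) (Finset (Site L)) ℂ := (annihilate x)ᴴ

/-- The matter Hamiltonian in the gauge field `σ`, with hopping parameter `t`:
`-t ∑_x ∑_μ (a⁺_x σ_{x,μ} a⁻_{x + e_μ} + h.c.)`. -/
noncomputable def hamiltonian (t : ℝ) (σ : GaugeField L) :
    Matrix (Finset (Site L)) (Finset (Site L)) ℂ :=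
  -(t : ℂ) • ∑ x : Site L, ∑ μ : Fin 2,
    ((((σ x μ : ℤˣ) : ℤ) : ℂ) • (create x * annihilate (x + e μ)) +
      ((((σ x μ : ℤˣ) : ℤ) : ℂ) • (create x * annihilate (x + e μ)))ᴴ)

/-- The operator `s^N`, with `N` the number operator (diagonal in the occupation number basis):
the identity for `s = 1` and `(-1)^N` for `s = -1`. -/
def signPowNumber (s : ℤˣ) : Matrix (Finset (Site L)) (Finset (Site L)) ℂ :=
  Matrix.diagonal fun S => (((s : ℤˣ) : ℤ) : ℂ) ^ S.card

/-- The even (`s = 1`) and odd (`s = -1`) partition functions `Tr s^N exp(-β H_f(σ))` of the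
matter sector at half filling. The trace is real, see `trace_im`. -/
noncomputable def gaugeZ (s : ℤˣ) (β t : ℝ) (σ : GaugeField L) : ℝ :=
  (Matrix.trace (signPowNumber s * NormedSpace.exp (-(β : ℂ) • hamiltonian t σ))).re

open Classical in
/-- The partition function `Z^s_{β,L}(Φ; a, b)`: the partition function of a gauge field compatible
with the fluxes `(Φ, a, b)`. Such a field exists iff `∏ Φ = 1` (see `exists_hasFluxes`), and the
value does not depend on it (see `fluxZ_eq`); incompatible fluxes are assigned the value `0`. -/
noncomputable def fluxZ (s : ℤˣ) (β t : ℝ) (Φ : Site L → ℤˣ) (a b : ℤˣ) : ℝ :=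
  if h : ∃ σ : GaugeField L, HasFluxes σ Φ a b then gaugeZ s β t h.choose else 0

/-- The partition function `Z^s_*` of the `π`-flux phase with `(a, b) = (-1, -1)`. -/
noncomputable def piZ (L : ℕ) [NeZero L] (s : ℤˣ) (β t : ℝ) : ℝ :=
  fluxZ (L := L) s β t (fun _ => -1) (-1) (-1)

/-- The chessboard flux configuration: flux `0` in the plaquette `(i, j)`, `1 ≤ i, j ≤ L`, if both
`i` and `j` are odd, flux `π` otherwise (for even `L`, the residue `0` stands for `L`). -/
def chessboard (L : ℕ) : Site L → ℤˣ := fun x => if Odd x.1.val ∧ Odd x.2.val then 1 else -1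

/-- The number of plaquettes with flux `0`. -/
def zeroFluxCount (Φ : Site L → ℤˣ) : ℕ := (Finset.univ.filter fun x => Φ x = 1).card

/-- The constant `Δ^s_{β,L} = -(1/(β L²)) (max_{a,b} log Z^s(Φ*; a, b) - log Z^s_*)`, with `Φ*`
the chessboard configuration. -/
noncomputable def monopoleGap (L : ℕ) [NeZero L] (s : ℤˣ) (β t : ℝ) : ℝ :=
  -(1 / (β * (L : ℝ) ^ 2)) *
    ((Finset.univ : Finset (ℤˣ × ℤˣ)).sup' Finset.univ_nonempty
        (fun p => Real.log (fluxZ s β t (chessboard L) p.1 p.2)) -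
      Real.log (piZ L s β t))

end Fock

/-- The logarithm on `[0, ∞)` with the convention `log 0 = -∞`. -/
noncomputable def logE (z : ℝ) : EReal := ENNReal.log (ENNReal.ofReal z)

section WellDefined

set_option linter.unusedSectionVars false

variable {L : ℕ} [NeZero L]

theorem hamiltonian_isHermitian (t : ℝ) (σ : GaugeField L) :
    (hamiltonian t σ).IsHermitian := by
  unfold hamiltonian
  rw [Matrix.IsHermitian, Matrix.conjTranspose_smul, Matrix.conjTranspose_sum]
  congr 1
  · simp
  · refine Finset.sum_congr rfl fun x _ => ?_
    rw [Matrix.conjTranspose_sum]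
    refine Finset.sum_congr rfl fun μ _ => ?_
    rw [Matrix.conjTranspose_add, Matrix.conjTranspose_conjTranspose, add_comm]

theorem trace_im (s : ℤˣ) (β t : ℝ) (σ : GaugeField L) :
    (Matrix.trace (signPowNumber s * NormedSpace.exp (-(β : ℂ) • hamiltonian t σ))).im = 0 := by
  have hH : (NormedSpace.exp (-(β : ℂ) • hamiltonian t σ)).IsHermitian := by
    apply Matrix.IsHermitian.exp
    have := hamiltonian_isHermitian t σ
    rw [Matrix.IsHermitian, Matrix.conjTranspose_smul, this.eq]
    simp
  have hP : (signPowNumber (L := L) s)ᴴ = signPowNumber s := by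
    rw [signPowNumber, Matrix.diagonal_conjTranspose]
    congr 1
    ext S
    simp
  have h := Matrix.trace_conjTranspose
    (signPowNumber s * NormedSpace.exp (-(β : ℂ) • hamiltonian t σ))
  rw [Matrix.conjTranspose_mul, hH.eq, hP, Matrix.trace_mul_comm] at h
  exact Complex.conj_eq_iff_im.mp h.symm

/-- Product of `f` over `0, …, x - 1`. -/
def prodBelow (f : ZMod L → ℤˣ) (x : ZMod L) : ℤˣ := ∏ k ∈ Finset.range x.val, f (k : ZMod L)

theorem prod_univ_eq (f : ZMod L → ℤˣ) : ∏ x, f x = ∏ k ∈ Finset.range L, f (k : ZMod L) := by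
  symm
  refine Finset.prod_bij' (fun k _ => (k : ZMod L)) (fun x _ => x.val) ?_ ?_ ?_ ?_ ?_
  · simp
  · intro x _; simpa using ZMod.val_lt x
  · intro k hk; exact ZMod.val_cast_of_lt (by simpa using hk)
  · intro x _; simp
  · simp

theorem prodBelow_zero (f : ZMod L → ℤˣ) : prodBelow f 0 = 1 := by simp [prodBelow]

theorem val_succ (x : ZMod L) : (x + 1 = 0 ∧ x.val + 1 = L) ∨ (x + 1 ≠ 0 ∧ (x + 1).val = x.val + 1) := by
  have hx : x + 1 = ((x.val + 1 : ℕ) : ZMod L) := by simp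
  have hlt := ZMod.val_lt x
  rcases Nat.lt_or_ge (x.val + 1) L with h | h
  · right
    have hv : (x + 1).val = x.val + 1 := by rw [hx]; exact ZMod.val_cast_of_lt h
    refine ⟨fun h0 => ?_, hv⟩
    rw [h0] at hv
    simp at hv
  · left
    have : x.val + 1 = L := by omega
    exact ⟨by rw [hx, this]; simp, this⟩

theorem prodBelow_succ (f : ZMod L → ℤˣ) (hf : ∏ x, f x = 1) (x : ZMod L) :
    prodBelow f (x + 1) = prodBelow f x * f x := by
  have hr : prodBelow f x * f x = ∏ k ∈ Finset.range (x.val + 1), f (k : ZMod L) := by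
    rw [Finset.prod_range_succ, prodBelow]; simp
  rw [hr]
  rcases val_succ x with ⟨h0, h⟩ | ⟨-, h⟩
  · rw [h0, prodBelow_zero, h, ← prod_univ_eq, hf]
  · rw [prodBelow, h]

theorem sq_unit (u : ℤˣ) : u * u = 1 := Int.units_mul_self u

theorem plaquetteFlux_shift (σ : GaugeField L) (i j : ZMod L) :
    plaquetteFlux σ (i + 1, j + 1) = σ (i, j) 0 * σ (i + 1, j) 1 * σ (i, j + 1) 0 * σ (i, j) 1 := by
  simp [plaquetteFlux, e]

theorem forall_of_succ {p : ZMod L → Prop} (h0 : p 0) (hs : ∀ x, p x → p (x + 1)) (x : ZMod L) :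
    p x := by
  have : ∀ n : ℕ, p (n : ZMod L) := by
    intro n
    induction n with
    | zero => simpa using h0
    | succ n ih => simpa using hs _ ih
  simpa using this x.val

/-- Gauge fields with the same fluxes are gauge equivalent. -/
theorem exists_gauge {σ σ' : GaugeField L} {Φ : Site L → ℤˣ} {a b : ℤˣ}
    (h : HasFluxes σ Φ a b) (h' : HasFluxes σ' Φ a b) :
    ∃ g : Site L → ℤˣ, ∀ x μ, σ' x μ = g x * σ x μ * g (x + e μ) := by
  obtain ⟨hΦ, ha, hb⟩ := h
  obtain ⟨hΦ', ha', hb'⟩ := h'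
  set w : Site L → Fin 2 → ℤˣ := fun x μ => σ x μ * σ' x μ with hw
  have hflux : ∀ i j : ZMod L,
      w (i, j) 0 * w (i + 1, j) 1 * w (i, j + 1) 0 * w (i, j) 1 = 1 := by
    intro i j
    have h1 := plaquetteFlux_shift σ i j
    have h2 := plaquetteFlux_shift σ' i j
    rw [hΦ] at h1
    rw [hΦ', h1] at h2
    revert h2
    simp only [hw]
    generalize σ (i, j) 0 = a1
    generalize σ (i + 1, j) 1 = a2
    generalize σ (i, j + 1) 0 = a3
    generalize σ (i, j) 1 = a4
    generalize σ' (i, j) 0 = b1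
    generalize σ' (i + 1, j) 1 = b2
    generalize σ' (i, j + 1) 0 = b3
    generalize σ' (i, j) 1 = b4
    intro h2
    calc a1 * b1 * (a2 * b2) * (a3 * b3) * (a4 * b4)
        = (a1 * a2 * a3 * a4) * (b1 * b2 * b3 * b4) := by ac_rfl
      _ = 1 := by rw [h2, sq_unit]
  have hrow : ∏ i, w (i, 0) 0 = 1 := by
    simp only [hw, Finset.prod_mul_distrib]
    unfold horizontalFlux at ha ha'
    rw [ha, ha', sq_unit]
  have hcol : ∀ i, ∏ j, w (i, j) 1 = 1 := by
    refine forall_of_succ ?_ ?_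
    · simp only [hw, Finset.prod_mul_distrib]
      unfold verticalFlux at hb hb'
      rw [hb, hb', sq_unit]
    · intro i hi
      have hp : ∏ j, (w (i, j) 0 * w (i + 1, j) 1 * w (i, j + 1) 0 * w (i, j) 1) = 1 :=
        Finset.prod_eq_one fun j _ => hflux i j
      have hsh : ∏ j, w (i, j + 1) 0 = ∏ j, w (i, j) 0 :=
        Equiv.prod_comp (Equiv.addRight (1 : ZMod L)) fun j => w (i, j) 0
      simp only [Finset.prod_mul_distrib, hsh, hi, mul_one] at hp
      rwa [mul_right_comm, sq_unit, one_mul] at hp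
  refine ⟨fun x => prodBelow (fun i => w (i, 0) 0) x.1 * prodBelow (fun j => w (x.1, j) 1) x.2, ?_⟩
  have key : ∀ (g1 g2 u v : ℤˣ), g1 * g2 = u * v → v = g1 * u * g2 := by decide
  have hv : ∀ i j, prodBelow (fun j => w (i, j) 1) (j + 1) =
      prodBelow (fun j => w (i, j) 1) j * w (i, j) 1 := fun i j => prodBelow_succ _ (hcol i) j
  have hh : ∀ i j, (prodBelow (fun i => w (i, 0) 0) i * prodBelow (fun j => w (i, j) 1) j) *
      (prodBelow (fun i => w (i, 0) 0) (i + 1) * prodBelow (fun j => w (i + 1, j) 1) j) =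
      w (i, j) 0 := by
    intro i
    refine forall_of_succ ?_ ?_
    · rw [prodBelow_succ _ hrow, prodBelow_zero, prodBelow_zero, mul_one, mul_one, ← mul_assoc,
        sq_unit, one_mul]
    · intro j hj
      rw [hv, hv]
      have hf := hflux i j
      rw [← hj] at hf
      revert hf
      generalize prodBelow (fun i => w (i, 0) 0) i = p1
      generalize prodBelow (fun i => w (i, 0) 0) (i + 1) = p2
      generalize prodBelow (fun j => w (i, j) 1) j = p3
      generalize prodBelow (fun j => w (i + 1, j) 1) j = p4
      generalize w (i + 1, j) 1 = p5
      generalize w (i, j + 1) 0 = p6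
      generalize w (i, j) 1 = p7
      intro hf
      have h6 : ∀ x y : ℤˣ, x * y = 1 → x = y := by decide
      apply h6
      calc p1 * (p3 * p7) * (p2 * (p4 * p5)) * p6
          = p1 * p3 * (p2 * p4) * p5 * p6 * p7 := by ac_rfl
        _ = 1 := hf
  rintro ⟨i, j⟩ μ
  apply key
  fin_cases μ
  · simpa [e] using hh i j
  · have := hv i j
    simp only [e] at this ⊢
    simp only [Fin.mk_one, Fin.isValue, one_ne_zero, if_false, Prod.mk_add_mk, add_zero]
    rw [this]
    generalize prodBelow (fun i => w (i, 0) 0) i = p1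
    generalize prodBelow (fun j => w (i, j) 1) j = p3
    change p1 * p3 * (p1 * (p3 * w (i, j) 1)) = w (i, j) 1
    calc p1 * p3 * (p1 * (p3 * w (i, j) 1)) = (p1 * p1) * (p3 * p3) * w (i, j) 1 := by ac_rfl
      _ = _ := by rw [sq_unit, sq_unit, one_mul, one_mul]

/-- The gauge transformation `∏_x (g x)^{n_x}` on the Fock space. -/
def gaugeUnitary (g : Site L → ℤˣ) : Matrix (Finset (Site L)) (Finset (Site L)) ℂ :=
  Matrix.diagonal fun S => ∏ x ∈ S, (((g x : ℤˣ) : ℤ) : ℂ)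

theorem cast_sq (u : ℤˣ) : (((u : ℤˣ) : ℤ) : ℂ) * (((u : ℤˣ) : ℤ) : ℂ) = 1 := by
  rcases Int.units_eq_one_or u with h | h <;> simp [h]

theorem gaugeUnitary_sq (g : Site L → ℤˣ) : gaugeUnitary g * gaugeUnitary g = 1 := by
  rw [gaugeUnitary, Matrix.diagonal_mul_diagonal, ← Matrix.diagonal_one]
  congr 1
  ext S
  rw [← Finset.prod_mul_distrib]
  exact Finset.prod_eq_one fun x _ => cast_sq (g x)

theorem gaugeUnitary_annihilate (g : Site L → ℤˣ) (x : Site L) :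
    gaugeUnitary g * annihilate x * gaugeUnitary g = (((g x : ℤˣ) : ℤ) : ℂ) • annihilate x := by
  ext S T
  rw [gaugeUnitary, Matrix.mul_diagonal, Matrix.diagonal_mul, Matrix.smul_apply, smul_eq_mul]
  by_cases h : x ∈ T ∧ S = T.erase x
  · obtain ⟨hx, rfl⟩ := h
    rw [← Finset.mul_prod_erase T _ hx]
    have hp : (∏ y ∈ T.erase x, (((g y : ℤˣ) : ℤ) : ℂ)) * (∏ y ∈ T.erase x, (((g y : ℤˣ) : ℤ) : ℂ))
        = 1 := by
      rw [← Finset.prod_mul_distrib]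
      exact Finset.prod_eq_one fun x _ => cast_sq (g x)
    linear_combination (annihilate x (T.erase x) T * (((g x : ℤˣ) : ℤ) : ℂ)) * hp
  · have : annihilate x S T = 0 := by simp only [annihilate, Matrix.of_apply, if_neg h]
    rw [this]; simp

theorem gaugeUnitary_conjTranspose (g : Site L → ℤˣ) : (gaugeUnitary g)ᴴ = gaugeUnitary g := by
  rw [gaugeUnitary, Matrix.diagonal_conjTranspose]
  congr 1
  ext S
  simp

theorem gaugeUnitary_create (g : Site L → ℤˣ) (x : Site L) :
    gaugeUnitary g * create x * gaugeUnitary g = (((g x : ℤˣ) : ℤ) : ℂ) • create x := by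
  have h := congrArg Matrix.conjTranspose (gaugeUnitary_annihilate g x)
  simpa [Matrix.conjTranspose_mul, gaugeUnitary_conjTranspose, create, Matrix.mul_assoc] using h

theorem gaugeUnitary_hop (g : Site L → ℤˣ) (x y : Site L) :
    gaugeUnitary g * (create x * annihilate y) * gaugeUnitary g =
      ((((g x : ℤˣ) : ℤ) : ℂ) * (((g y : ℤˣ) : ℤ) : ℂ)) • (create x * annihilate y) := by
  calc gaugeUnitary g * (create x * annihilate y) * gaugeUnitary g
      = gaugeUnitary g * create x * (gaugeUnitary g * gaugeUnitary g) * annihilate y *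
          gaugeUnitary g := by rw [gaugeUnitary_sq]; simp only [Matrix.mul_assoc, Matrix.one_mul]
    _ = (gaugeUnitary g * create x * gaugeUnitary g) *
          (gaugeUnitary g * annihilate y * gaugeUnitary g) := by simp only [Matrix.mul_assoc]
    _ = _ := by
      rw [gaugeUnitary_create, gaugeUnitary_annihilate, Matrix.smul_mul, Matrix.mul_smul, smul_smul]

/-- Gauge equivalent configurations have unitarily equivalent Hamiltonians. -/
theorem gaugeUnitary_hamiltonian (t : ℝ) {σ σ' : GaugeField L} (g : Site L → ℤˣ)
    (hg : ∀ x μ, σ' x μ = g x * σ x μ * g (x + e μ)) :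
    gaugeUnitary g * hamiltonian t σ * gaugeUnitary g = hamiltonian t σ' := by
  unfold hamiltonian
  rw [Matrix.mul_smul, Matrix.smul_mul, Finset.mul_sum, Finset.sum_mul]
  congr 1
  refine Finset.sum_congr rfl fun x _ => ?_
  rw [Finset.mul_sum, Finset.sum_mul]
  refine Finset.sum_congr rfl fun μ _ => ?_
  have h1 : gaugeUnitary g * ((((σ x μ : ℤˣ) : ℤ) : ℂ) • (create x * annihilate (x + e μ))) *
      gaugeUnitary g = (((σ' x μ : ℤˣ) : ℤ) : ℂ) • (create x * annihilate (x + e μ)) := by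
    rw [Matrix.mul_smul, Matrix.smul_mul, gaugeUnitary_hop, smul_smul, hg]
    congr 1
    push_cast
    ring
  have h2 := congrArg Matrix.conjTranspose h1
  rw [Matrix.conjTranspose_mul, Matrix.conjTranspose_mul, gaugeUnitary_conjTranspose,
    ← Matrix.mul_assoc] at h2
  rw [Matrix.mul_add, Matrix.add_mul, h1, h2]

theorem gaugeZ_eq_of_hasFluxes (s : ℤˣ) (β t : ℝ) {σ σ' : GaugeField L} {Φ : Site L → ℤˣ}
    {a b : ℤˣ} (h : HasFluxes σ Φ a b) (h' : HasFluxes σ' Φ a b) :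
    gaugeZ s β t σ = gaugeZ s β t σ' := by
  obtain ⟨g, hg⟩ := exists_gauge h h'
  have hinv : (gaugeUnitary g)⁻¹ = gaugeUnitary g := Matrix.inv_eq_right_inv (gaugeUnitary_sq g)
  have hu : IsUnit (gaugeUnitary g) := ⟨⟨_, _, gaugeUnitary_sq g, gaugeUnitary_sq g⟩, rfl⟩
  have hexp := Matrix.exp_conj (gaugeUnitary g) (-(β : ℂ) • hamiltonian t σ) hu
  rw [hinv, Matrix.mul_smul, Matrix.smul_mul, gaugeUnitary_hamiltonian t g hg] at hexp
  have hcomm : gaugeUnitary g * signPowNumber s = signPowNumber s * gaugeUnitary g := by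
    rw [gaugeUnitary, signPowNumber, Matrix.diagonal_mul_diagonal, Matrix.diagonal_mul_diagonal]
    congr 1
    ext S
    ring
  unfold gaugeZ
  rw [hexp]
  congr 1
  symm
  rw [← Matrix.mul_assoc, Matrix.trace_mul_comm, ← Matrix.mul_assoc, ← Matrix.mul_assoc, hcomm,
    Matrix.mul_assoc (signPowNumber s), gaugeUnitary_sq, Matrix.mul_one]

/-- `fluxZ` is the partition function of any gauge field with the given fluxes. -/
theorem fluxZ_eq (s : ℤˣ) (β t : ℝ) {σ : GaugeField L} {Φ : Site L → ℤˣ} {a b : ℤˣ}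
    (h : HasFluxes σ Φ a b) : fluxZ s β t Φ a b = gaugeZ s β t σ := by
  have hex : ∃ σ : GaugeField L, HasFluxes σ Φ a b := ⟨σ, h⟩
  rw [fluxZ, dif_pos hex]
  exact gaugeZ_eq_of_hasFluxes s β t hex.choose_spec h

/-- A configuration of fluxes comes from a gauge field if and only if their product is `1`. -/
theorem exists_hasFluxes (Φ : Site L → ℤˣ) (a b : ℤˣ) :
    (∃ σ : GaugeField L, HasFluxes σ Φ a b) ↔ ∏ x, Φ x = 1 := by
  constructor
  · rintro ⟨σ, hΦ, -, -⟩
    have hs : ∀ (v : Site L) (μ : Fin 2), ∏ x, σ (x - v) μ = ∏ x, σ x μ := fun v μ =>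
      Equiv.prod_comp (Equiv.subRight v) fun x => σ x μ
    calc ∏ x, Φ x = ∏ x, plaquetteFlux σ x := Finset.prod_congr rfl fun x _ => (hΦ x).symm
      _ = 1 := by
        simp only [plaquetteFlux, Finset.prod_mul_distrib, sub_sub, hs]
        generalize (∏ x, σ x 0) = p
        generalize (∏ x, σ x 1) = q
        revert p q
        decide
  · intro hprod
    set C : ZMod L → ℤˣ := fun i => ∏ j, Φ (i + 1, j + 1) with hC
    have hCprod : ∏ i, C i = 1 := by
      rw [← hprod, Fintype.prod_prod_type]
      rw [← Equiv.prod_comp (Equiv.addRight (1 : ZMod L)) fun i => ∏ j, Φ (i, j)]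
      refine Finset.prod_congr rfl fun i _ => ?_
      exact Equiv.prod_comp (Equiv.addRight (1 : ZMod L)) fun j => Φ (i + 1, j)
    -- spins `1` on all vertical edges except those in the last row
    refine ⟨fun x μ => if μ = 0 then (if x.1 = 0 then a else 1) *
        prodBelow (fun j => Φ (x.1 + 1, j + 1)) x.2
      else if x.2 + 1 = 0 then b * prodBelow C x.1 else 1, ?_, ?_, ?_⟩
    · intro x
      obtain ⟨i, hi⟩ : ∃ i, x.1 = i + 1 := ⟨x.1 - 1, by simp⟩
      obtain ⟨j, hj⟩ : ∃ j, x.2 = j + 1 := ⟨x.2 - 1, by simp⟩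
      have hx : x = (i + 1, j + 1) := Prod.ext hi hj
      rw [hx, plaquetteFlux_shift]
      simp only [if_true, one_ne_zero, if_false]
      generalize (if i = 0 then a else 1) = u
      rcases val_succ j with ⟨h0, hv⟩ | ⟨h0, hv⟩
      · have h1 : prodBelow (fun j => Φ (i + 1, j + 1)) j * Φ (i + 1, j + 1) = C i := by
          have := Finset.prod_range_succ (fun k : ℕ => Φ (i + 1, (k : ZMod L) + 1)) j.val
          rw [hv] at this
          simp only [hC, prod_univ_eq, prodBelow, this]
          simp
        rw [if_pos h0, if_pos h0, h0, prodBelow_zero, prodBelow_succ C hCprod, ← h1, h0]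
        generalize prodBelow (fun j => Φ (i + 1, j + 1)) j = p
        generalize prodBelow C i = q
        generalize Φ (i + 1, 0) = r
        calc u * p * (b * (q * (p * r))) * (u * 1) * (b * q)
            = (u * u) * (p * p) * (b * b) * (q * q) * r := by rw [mul_one]; ac_rfl
          _ = r := by simp only [sq_unit, one_mul]
      · have h1 : prodBelow (fun j => Φ (i + 1, j + 1)) (j + 1) =
            prodBelow (fun j => Φ (i + 1, j + 1)) j * Φ (i + 1, j + 1) := by
          rw [prodBelow, hv, Finset.prod_range_succ, prodBelow]
          simp
        rw [if_neg h0, if_neg h0, h1]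
        generalize prodBelow (fun j => Φ (i + 1, j + 1)) j = p
        generalize Φ (i + 1, j + 1) = r
        calc u * p * 1 * (u * (p * r)) * 1 = (u * u) * (p * p) * r := by
              simp only [mul_one]; ac_rfl
          _ = r := by simp only [sq_unit, one_mul]
    · simp [horizontalFlux, prodBelow_zero]
    · have : ∀ j : ZMod L, j + 1 = 0 ↔ j = -1 := fun j => eq_neg_iff_add_eq_zero.symm
      simp [verticalFlux, prodBelow_zero, this]

end WellDefined

end Z2Gauge

open Z2Gauge

/-! The matter is quasi-free, so everything is read off the one-particle hopping matrix h.
Diagonalising h gives Z^± = ∏ (1 ± e^{-βλ}), and since tr h = 0 this equals ∏ (e^{βλ/2} ± e^{-βλ/2})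
(`trace_exp_secondQuant`, `gaugeZ_eq_prod_modeWeight`). Euler's products turn the square of each
factor into a limit of products of λ² + ω² over Matsubara frequencies, with ω = 0 present only for
the odd sign. Hence an inequality between the |det(h + iω)| valid for all real ω passes to both
partition functions (`sq_prod_modeWeight_le`).

Reflection positivity follows an idea of Lieb. Two lines through bond midpoints cut the torus into
halves, in a gauge where the cut bonds have spin -1. Then h + iω has diagonal blocks X, Y and a
nonnegative diagonal coupling. A Cauchy–Schwarz inequality for determinants bounds the squared
modulus by the product of the two determinants in which one half is kept and the other becomes -Xᴴ
or -Yᴴ. Since -(h + iω)ᴴ = -h + iω, the mirrored half carries the opposite hopping: bisected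
plaquettes acquire flux π, and the others are copied (`resolventDet_fold`, `plaquetteFlux_fold`).

For the chessboard estimate, the lines meet only plaquettes in even columns, so the number of flux-0
plaquettes with both coordinates odd is preserved on average by the two foldings. Among the
maximizers of Z / r^(that number), one with the most plaquettes that look bisected must look
bisected in every even row and column, so it is the π configuration or the chessboard
(`eq_of_isGood`). This gives the bound for one sublattice; the product over its four translates
counts every flux-0 plaquette once (`pow_four_le`). Folding also forces one boundary flux to -1, and
exchanging the directions handles the other (`le_of_pi`).

Nonnegativity of Z^- comes from det h ≥ 0 on a bipartite lattice with an even number of sites on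
each sublattice. Strict positivity needs ker h = 0. With covariant shifts U, V, in the π phase U and
V anticommute and h² is a sum of two squares; for the chessboard, in units of the hopping, (h² - 4)²
= 8 + U⁴ + U⁻⁴ + V⁴ + V⁻⁴ (`sum_pow_four`). -/

namespace Z2Gauge

open scoped Matrix BigOperators

/-! ### Canonical anticommutation relations from Jordan–Wigner signs -/

section CAR
set_option linter.unusedSectionVars false
variable {L : ℕ} [NeZero L]

/-- The Jordan–Wigner sign of the mode `x` in the configuration `T`. -/
noncomputable def jwSign (x : Site L) (T : Finset (Site L)) : ℂ :=
  (-1) ^ (T.filter fun y => siteIndex y < siteIndex x).card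

theorem siteIndex_injective : Function.Injective (siteIndex (L := L)) := by
  rintro ⟨i, j⟩ ⟨i', j'⟩ h
  simp only [siteIndex] at h
  have hi := ZMod.val_lt i
  have hi' := ZMod.val_lt i'
  have h1 : i.val = i'.val := by
    have := congrArg (· % L) h
    simpa [Nat.add_mul_mod_self_left, Nat.mod_eq_of_lt hi, Nat.mod_eq_of_lt hi'] using this
  have h2 : j.val = j'.val := by
    rw [h1] at h
    exact Nat.eq_of_mul_eq_mul_left (NeZero.pos L) (by omega)
  exact Prod.ext (ZMod.val_injective L h1) (ZMod.val_injective L h2)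

theorem jwSign_mul_self (x : Site L) (T : Finset (Site L)) : jwSign x T * jwSign x T = 1 := by
  rw [jwSign, ← pow_add, ← two_mul, pow_mul]; simp

theorem star_jwSign (x : Site L) (T : Finset (Site L)) : star (jwSign x T) = jwSign x T := by
  simp [jwSign]

theorem jwSign_insert_self (x : Site L) (T : Finset (Site L)) :
    jwSign x (insert x T) = jwSign x T := by
  simp [jwSign, Finset.filter_insert]

theorem jwSign_erase_self (x : Site L) (T : Finset (Site L)) :
    jwSign x (T.erase x) = jwSign x T := by
  by_cases hx : x ∈ T
  · rw [← jwSign_insert_self, Finset.insert_erase hx]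
  · rw [Finset.erase_eq_of_notMem hx]

theorem jwSign_insert {x y : Site L} {T : Finset (Site L)} (hy : y ∉ T) :
    jwSign x (insert y T) = (if siteIndex y < siteIndex x then -1 else 1) * jwSign x T := by
  unfold jwSign
  rw [Finset.filter_insert]
  split_ifs with h
  · rw [Finset.card_insert_of_notMem (by simp [hy]), pow_succ]; ring
  · simp

theorem jwSign_erase {x y : Site L} {T : Finset (Site L)} (hy : y ∈ T) :
    jwSign x (T.erase y) = (if siteIndex y < siteIndex x then -1 else 1) * jwSign x T := by
  conv_rhs => rw [← Finset.insert_erase hy, jwSign_insert (Finset.notMem_erase y T)]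
  split_ifs <;> simp

theorem annihilate_apply (x : Site L) (S T : Finset (Site L)) :
    annihilate x S T = if x ∈ T ∧ S = T.erase x then jwSign x T else 0 := by
  simp [annihilate, jwSign]

theorem create_apply (x : Site L) (S T : Finset (Site L)) :
    create x S T = if x ∉ T ∧ S = insert x T then jwSign x T else 0 := by
  rw [create, Matrix.conjTranspose_apply, annihilate_apply]
  by_cases h : x ∉ T ∧ S = insert x T
  · rw [if_pos h, if_pos, star_jwSign, h.2, jwSign_insert_self]
    rw [h.2]; exact ⟨Finset.mem_insert_self x T, (Finset.erase_insert h.1).symm⟩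
  · rw [if_neg h, if_neg, star_zero]
    rintro ⟨h1, h2⟩
    exact h ⟨by rw [h2]; exact Finset.notMem_erase x S, by rw [h2, Finset.insert_erase h1]⟩

theorem mul_annihilate_apply (M : Matrix (Finset (Site L)) (Finset (Site L)) ℂ) (x : Site L)
    (S T : Finset (Site L)) :
    (M * annihilate x) S T = if x ∈ T then M S (T.erase x) * jwSign x T else 0 := by
  simp only [Matrix.mul_apply, annihilate_apply]
  by_cases h : x ∈ T <;> simp [h]

theorem mul_create_apply (M : Matrix (Finset (Site L)) (Finset (Site L)) ℂ) (x : Site L)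
    (S T : Finset (Site L)) :
    (M * create x) S T = if x ∉ T then M S (insert x T) * jwSign x T else 0 := by
  simp only [Matrix.mul_apply, create_apply]
  by_cases h : x ∈ T <;> simp [h]

/-- For distinct occupied sites, removing one changes the sign of the other only if the removed site
comes first in the ordering. So exactly one of the two orders of removal picks up a minus sign. -/
theorem annihilate_anticomm (x y : Site L) :
    annihilate x * annihilate y + annihilate y * annihilate x = 0 := by
  ext S T
  rw [Matrix.add_apply, mul_annihilate_apply, mul_annihilate_apply, annihilate_apply,
    annihilate_apply, Matrix.zero_apply]
  by_cases hxy : x = y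
  · subst hxy; simp
  have hne : siteIndex x ≠ siteIndex y := fun h => hxy (siteIndex_injective h)
  by_cases hx : x ∈ T
  · by_cases hy : y ∈ T
    · have h1 : (T.erase x).erase y = (T.erase y).erase x := Finset.erase_right_comm
      simp only [hx, hy, if_true, Finset.mem_erase, ne_eq, hxy, Ne.symm hxy, not_false_eq_true,
        true_and, h1, jwSign_erase]
      by_cases hS : S = (T.erase y).erase x
      · simp only [hS, if_true]
        rcases lt_or_gt_of_ne hne with h | h
        · rw [if_neg (not_lt.mpr h.le), if_pos h]; ring
        · rw [if_neg (not_lt.mpr h.le), if_pos h]; ring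
      · simp [hS]
    · simp [hy]
  · simp [hx]

theorem annihilate_create_anticomm (x y : Site L) :
    annihilate x * create y + create y * annihilate x = if x = y then 1 else 0 := by
  ext S T
  rw [Matrix.add_apply, mul_annihilate_apply, mul_create_apply, annihilate_apply, create_apply]
  by_cases hxy : x = y
  · subst hxy
    simp only [if_true, Matrix.one_apply]
    by_cases hx : x ∈ T
    · simp [hx, Finset.insert_erase, jwSign_erase_self, jwSign_mul_self]
    · simp [hx, jwSign_insert_self, jwSign_mul_self]
  rw [if_neg hxy, Matrix.zero_apply]
  have hne : siteIndex x ≠ siteIndex y := fun h => hxy (siteIndex_injective h)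
  have hyx : ¬ y = x := fun h => hxy h.symm
  by_cases hx : x ∈ T
  · by_cases hy : y ∈ T
    · simp [hy, hyx]
    · have h1 : (insert y T).erase x = insert y (T.erase x) := Finset.erase_insert_of_ne hyx
      by_cases hS : S = insert y (T.erase x)
      · simp only [hy, hx, not_false_eq_true, if_true, Finset.mem_insert, or_true, true_and, h1, hS,
          Finset.mem_erase, ne_eq, hyx, and_false, jwSign_insert hy, jwSign_erase hx]
        rcases lt_or_gt_of_ne hne with h | h
        · rw [if_neg (not_lt.mpr h.le), if_pos h]; ring
        · rw [if_neg (not_lt.mpr h.le), if_pos h]; ring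
      · simp [h1, hS]
  · simp [hx, hxy]

theorem signPowNumber_mul_annihilate (s : ℤˣ) (x : Site L) :
    signPowNumber s * annihilate x = (((s : ℤˣ) : ℤ) : ℂ) • (annihilate x * signPowNumber s) := by
  ext S T
  rw [signPowNumber, Matrix.smul_apply, Matrix.mul_diagonal, Matrix.diagonal_mul, annihilate_apply]
  split_ifs with h
  · rw [h.2, ← Finset.insert_erase h.1, Finset.card_insert_of_notMem (Finset.notMem_erase x T),
      Finset.erase_insert (Finset.notMem_erase x T), pow_succ, smul_eq_mul]
    linear_combination (-(((s : ℤ) : ℂ) ^ (T.erase x).card) * jwSign x (insert x (T.erase x)) ) * cast_sq s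
  · simp

end CAR

/-! ### Traces of exponentials of number operators -/

section Idempotent

open scoped Matrix.Norms.Operator in
theorem exp_smul_of_idempotent {m : Type*} [Fintype m] [DecidableEq m] {n : Matrix m m ℂ}
    (hn : n * n = n) (c : ℂ) :
    NormedSpace.exp (c • n) = 1 + (Complex.exp c - 1) • n := by
  have h1 := NormedSpace.exp_series_hasSum_exp' (𝕂 := ℂ) (c • n)
  have h2 := (NormedSpace.exp_series_hasSum_exp' (𝕂 := ℂ) c).smul_const n
  -- The series `h2` has zeroth term `n` where the exponential series has `1`; all later terms agree
  -- because powers of `n` collapse. The defect `1 - n` is added at index `0`.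
  have h3 := hasSum_ite_eq (0 : ℕ) (1 - n)
  have h4 := h2.add h3
  have h5 : 1 + (Complex.exp c - 1) • n = NormedSpace.exp c • n + (1 - n) := by
    rw [Complex.exp_eq_exp_ℂ, sub_smul, one_smul]; abel
  rw [h5]
  refine h1.unique (h4.congr_fun fun k => ?_)
  rcases k with _ | k
  · simp
  · have hk : n ^ (k + 1) = n := by
      induction k with
      | zero => simp
      | succ k ih => rw [pow_succ, ih, hn]
    simp [smul_pow, hk, smul_smul]

end Idempotent

section Modes
set_option linter.unusedSectionVars false
variable {F κ : Type*} [Fintype F] [DecidableEq F] [Fintype κ] [DecidableEq κ]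

/-- A family of fermionic modes satisfying the canonical anticommutation relations, on which the
Hermitian matrix `P` acts by the sign `s`. -/
structure IsModes (s : ℂ) (P : Matrix F F ℂ) (b : κ → Matrix F F ℂ) : Prop where
  anticomm : ∀ i j, b i * b j + b j * b i = 0
  anticomm' : ∀ i j, b i * (b j)ᴴ + (b j)ᴴ * b i = if i = j then 1 else 0
  sign : ∀ i, (b i)ᴴ * P = s • (P * (b i)ᴴ)

namespace IsModes
variable {s : ℂ} {P : Matrix F F ℂ} {b : κ → Matrix F F ℂ}

/-- The number operator of the mode `j`. -/
def num (b : κ → Matrix F F ℂ) (j : κ) : Matrix F F ℂ := (b j)ᴴ * b j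

theorem sq_zero (h : IsModes s P b) (i : κ) : b i * b i = 0 := by
  have := h.anticomm i i
  rw [← two_smul ℂ] at this
  exact (smul_eq_zero.mp this).resolve_left two_ne_zero

theorem mul_conj (h : IsModes s P b) (i : κ) : b i * (b i)ᴴ = 1 - num b i := by
  have := h.anticomm' i i
  rw [if_pos rfl] at this
  exact eq_sub_of_add_eq this

theorem num_idem (h : IsModes s P b) (i : κ) : num b i * num b i = num b i := by
  have : (b i)ᴴ * (b i * (b i)ᴴ) * b i = (b i)ᴴ * b i := by
    rw [h.mul_conj, num, mul_sub, sub_mul, mul_one]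
    simp only [mul_assoc, h.sq_zero, mul_zero, sub_zero]
  simpa [num, mul_assoc] using this

theorem commute_num_conj (h : IsModes s P b) {i j : κ} (hij : i ≠ j) :
    Commute (num b i) (b j)ᴴ := by
  have h1 : b i * (b j)ᴴ = -((b j)ᴴ * b i) := by
    have := h.anticomm' i j
    rw [if_neg hij] at this
    exact eq_neg_of_add_eq_zero_left this
  have h2 : (b i)ᴴ * (b j)ᴴ = -((b j)ᴴ * (b i)ᴴ) := by
    have := congrArg Matrix.conjTranspose (h.anticomm i j)
    simp only [Matrix.conjTranspose_add, Matrix.conjTranspose_mul, Matrix.conjTranspose_zero]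
      at this
    exact eq_neg_of_add_eq_zero_right this
  rw [Commute, SemiconjBy, num, mul_assoc, h1, mul_neg, ← mul_assoc, h2, neg_mul, neg_neg,
    mul_assoc]

theorem num_conjTranspose (i : κ) : (num b i)ᴴ = num b i := by
  simp [num, Matrix.conjTranspose_mul]

theorem commute_num (h : IsModes s P b) (i j : κ) : Commute (num b i) (num b j) := by
  by_cases hij : i = j
  · rw [hij]
  have h1 := h.commute_num_conj hij
  have h2 : Commute (num b i) (b j) := by
    have := congrArg Matrix.conjTranspose h1.eq
    simp only [Matrix.conjTranspose_mul, Matrix.conjTranspose_conjTranspose, num_conjTranspose]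
      at this
    exact this.symm
  exact h1.mul_right h2

/-- Since `1 - num b j = b j * (b j)ᴴ`, cyclicity brings `(b j)ᴴ` to the front; it then passes `P`
at the cost of `s` and `Q` for free. -/
theorem trace_one_sub_num (h : IsModes s P b) {Q : Matrix F F ℂ} {j : κ}
    (hQ : Commute Q (b j)ᴴ) :
    (P * Q * (1 - num b j)).trace = s * (P * Q * num b j).trace := by
  rw [← h.mul_conj, ← mul_assoc, Matrix.trace_mul_comm, ← mul_assoc, ← mul_assoc, h.sign, num,
    Matrix.smul_mul, Matrix.smul_mul, Matrix.trace_smul, smul_eq_mul]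
  congr 2
  rw [mul_assoc P, ← hQ.eq]
  simp only [mul_assoc]

theorem commute_exp {Q A : Matrix F F ℂ} (h : Commute Q A) : Commute (NormedSpace.exp Q) A := by
  open scoped Matrix.Norms.Operator in
  exact h.exp_left

/-- The exponential of the mode `j` is `(1 - n) + e^{c j} n`, and the occupied and empty parts of
the trace differ by the factor `s`. All dependence on `c j` is thus in the scalar prefactor. -/
theorem trace_exp_split (h : IsModes s P b) (hs : s * s = 1) (c : κ → ℂ) (j : κ) :
    (P * NormedSpace.exp (∑ i, c i • num b i)).trace = (1 + s * Complex.exp (c j)) *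
      (P * NormedSpace.exp (∑ i ∈ Finset.univ.erase j, c i • num b i) * (1 - num b j)).trace := by
  set R := ∑ i ∈ Finset.univ.erase j, c i • num b i with hR
  have hRb : Commute R (b j)ᴴ := by
    refine Commute.sum_left _ _ _ fun i hi => ?_
    exact (h.commute_num_conj (Finset.ne_of_mem_erase hi)).smul_left _
  have hRn : Commute R (c j • num b j) := by
    refine Commute.sum_left _ _ _ fun i hi => ?_
    exact ((h.commute_num i j).smul_left _).smul_right _
  rw [← Finset.sum_erase_add _ _ (Finset.mem_univ j), ← hR, Matrix.exp_add_of_commute _ _ hRn,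
    exp_smul_of_idempotent (h.num_idem j), ← mul_assoc]
  have h1 := h.trace_one_sub_num (commute_exp hRb)
  set Q := P * NormedSpace.exp R
  rw [mul_add, Matrix.mul_smul, Matrix.trace_add, Matrix.trace_smul, smul_eq_mul]
  have h2 : Q = Q * (1 - num b j) + Q * num b j := by
    rw [← mul_add]; simp
  rw [mul_one]
  have h3 : Q.trace = (Q * (1 - num b j)).trace + (Q * num b j).trace := by
    rw [← Matrix.trace_add, ← h2]
  rw [h3, h1]
  linear_combination (-(Complex.exp (c j)) * (Q * num b j).trace) * hs

/-- The trace is proportional to `∏ (1 + s e^{c i})`, with a constant independent of the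
coefficients, so a single reference trace determines it and no occupation basis of the rotated modes
is needed. Denominators are cleared because a factor may vanish. -/
theorem trace_exp_exchange (h : IsModes s P b) (hs : s * s = 1) (c d : κ → ℂ) (I : Finset κ) :
    (P * NormedSpace.exp (∑ i, c i • num b i)).trace * ∏ i ∈ I, (1 + s * Complex.exp (d i)) =
    (P * NormedSpace.exp (∑ i, (if i ∈ I then d i else c i) • num b i)).trace *
      ∏ i ∈ I, (1 + s * Complex.exp (c i)) := by
  induction I using Finset.induction_on with
  | empty => simp
  | insert j I hj ih =>
    rw [Finset.prod_insert hj, Finset.prod_insert hj, mul_left_comm, ih,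
      h.trace_exp_split hs (fun i => if i ∈ I then d i else c i) j,
      h.trace_exp_split hs (fun i => if i ∈ insert j I then d i else c i) j]
    simp only [hj, if_false, Finset.mem_insert_self, if_true]
    have : ∑ i ∈ Finset.univ.erase j, (if i ∈ I then d i else c i) • num b i =
        ∑ i ∈ Finset.univ.erase j, (if i ∈ insert j I then d i else c i) • num b i := by
      refine Finset.sum_congr rfl fun i hi => ?_
      simp [Finset.mem_insert, Finset.ne_of_mem_erase hi]
    rw [this]
    ring

end IsModes
end Modes

/-! ### Second quantization and the quasi-free trace formula -/

section SecondQuantization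
set_option linter.unusedSectionVars false
variable {L : ℕ} [NeZero L]

/-- The one-particle Hamiltonian on `ℓ²(Γ_L)` in the gauge field `σ`. -/
noncomputable def hopping (t : ℝ) (σ : GaugeField L) : Matrix (Site L) (Site L) ℝ :=
  -t • ∑ x : Site L, ∑ μ : Fin 2, (((σ x μ : ℤˣ) : ℤ) : ℝ) •
    (Matrix.single x (x + e μ) 1 + Matrix.single (x + e μ) x 1)

/-- The second quantization of a one-particle operator. -/
noncomputable def secondQuant :
    Matrix (Site L) (Site L) ℝ →ₗ[ℝ] Matrix (Finset (Site L)) (Finset (Site L)) ℂ where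
  toFun A := ∑ x, ∑ y, A x y • (create x * annihilate y)
  map_add' A B := by simp [add_smul, Finset.sum_add_distrib]
  map_smul' c A := by simp [smul_smul, Finset.smul_sum]

theorem secondQuant_apply (A : Matrix (Site L) (Site L) ℝ) :
    secondQuant A = ∑ x, ∑ y, A x y • (create x * annihilate y) := rfl

theorem secondQuant_single (x y : Site L) :
    secondQuant (Matrix.single x y 1) = create x * annihilate y := by
  rw [secondQuant_apply]
  simp only [Matrix.single_apply, ite_smul, one_smul, zero_smul]
  rw [Finset.sum_eq_single x (by intro b _ hb; simp [Ne.symm hb]) (by simp)]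
  simp

theorem hamiltonian_eq_secondQuant (t : ℝ) (σ : GaugeField L) :
    hamiltonian t σ = secondQuant (hopping t σ) := by
  rw [hopping, map_smul, map_sum, hamiltonian]
  rw [show (-(t : ℂ)) = ((-t : ℝ) : ℂ) by simp, Complex.coe_smul]
  congr 1
  refine Finset.sum_congr rfl fun x _ => ?_
  rw [map_sum]
  refine Finset.sum_congr rfl fun μ _ => ?_
  rw [map_smul, map_add, secondQuant_single, secondQuant_single, smul_add,
    Matrix.conjTranspose_smul, Matrix.conjTranspose_mul]
  have h1 : ((((σ x μ : ℤˣ) : ℤ) : ℂ)) = ((((σ x μ : ℤˣ) : ℤ) : ℝ) : ℂ) := by simp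
  rw [h1, Complex.coe_smul, Complex.star_def, Complex.conj_ofReal, Complex.coe_smul]
  simp [create]

theorem secondQuant_one :
    secondQuant (1 : Matrix (Site L) (Site L) ℝ) =
      Matrix.diagonal fun S : Finset (Site L) => (S.card : ℂ) := by
  have : secondQuant (1 : Matrix (Site L) (Site L) ℝ) = ∑ x, create x * annihilate x := by
    rw [secondQuant_apply]
    simp [Matrix.one_apply]
  rw [this]
  ext S T
  rw [Matrix.sum_apply, Matrix.diagonal_apply]
  have h : ∀ x, (create x * annihilate x) S T = if x ∈ T then (if S = T then 1 else 0) else 0 := by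
    intro x
    rw [mul_annihilate_apply, create_apply]
    by_cases hx : x ∈ T
    · simp only [hx, Finset.notMem_erase, not_false_eq_true, true_and, Finset.insert_erase, if_true,
        jwSign_erase_self]
      split_ifs
      · exact jwSign_mul_self x T
      · simp
    · simp [hx]
  simp only [h]
  by_cases hST : S = T <;> simp [hST]

/-- The fermionic modes associated with the columns of `U`. -/
noncomputable def mode (U : Matrix (Site L) (Site L) ℝ) (j : Site L) :
    Matrix (Finset (Site L)) (Finset (Site L)) ℂ := ∑ x, U x j • annihilate x

theorem mode_conjTranspose (U : Matrix (Site L) (Site L) ℝ) (j : Site L) :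
    (mode U j)ᴴ = ∑ x, U x j • create x := by
  rw [mode, Matrix.conjTranspose_sum]
  refine Finset.sum_congr rfl fun x _ => ?_
  rw [Matrix.conjTranspose_smul, create]
  simp

/-- The anticommutators are bilinear, so under a rotation the contact terms add up to the entries of
`Uᵀ * U`. -/
theorem isModes_mode {U : Matrix (Site L) (Site L) ℝ} (hU : Uᵀ * U = 1) (s : ℤˣ) :
    IsModes (((s : ℤˣ) : ℤ) : ℂ) (signPowNumber s) (mode U) where
  anticomm i j := by
    rw [mode, mode, Finset.sum_mul_sum, Finset.sum_mul_sum, Finset.sum_comm,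
      ← Finset.sum_add_distrib]
    refine Finset.sum_eq_zero fun x _ => ?_
    rw [← Finset.sum_add_distrib]
    refine Finset.sum_eq_zero fun y _ => ?_
    rw [smul_mul_smul_comm, smul_mul_smul_comm, mul_comm (U x j), ← smul_add, annihilate_anticomm,
      smul_zero]
  anticomm' i j := by
    rw [mode_conjTranspose, mode, Finset.sum_mul_sum, Finset.sum_mul_sum, Finset.sum_comm,
      ← Finset.sum_add_distrib]
    have : ∀ y : Site L, ∑ x, U x i • annihilate x * U y j • create y +
        ∑ x, U y j • create y * U x i • annihilate x =
        (U y i * U y j) • (1 : Matrix (Finset (Site L)) (Finset (Site L)) ℂ) := by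
      intro y
      rw [← Finset.sum_add_distrib, Finset.sum_eq_single y]
      · rw [smul_mul_smul_comm, smul_mul_smul_comm, mul_comm (U y j), ← smul_add,
          annihilate_create_anticomm, if_pos rfl]
      · intro x _ hx
        rw [smul_mul_smul_comm, smul_mul_smul_comm, mul_comm (U y j), ← smul_add,
          annihilate_create_anticomm, if_neg hx, smul_zero]
      · simp
    rw [Finset.sum_congr rfl fun y _ => this y, ← Finset.sum_smul]
    have h := congrFun (congrFun hU i) j
    simp only [Matrix.mul_apply, Matrix.transpose_apply] at h
    rw [h, Matrix.one_apply]
    split_ifs <;> simp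
  sign i := by
    rw [mode_conjTranspose, Finset.sum_mul, Finset.mul_sum, Finset.smul_sum]
    refine Finset.sum_congr rfl fun x _ => ?_
    have h := congrArg Matrix.conjTranspose (signPowNumber_mul_annihilate s x)
    have hP : (signPowNumber (L := L) s)ᴴ = signPowNumber s := by
      rw [signPowNumber, Matrix.diagonal_conjTranspose]
      congr 1
      ext S
      simp
    rw [Matrix.conjTranspose_mul, Matrix.conjTranspose_smul, Matrix.conjTranspose_mul, hP] at h
    rw [Matrix.smul_mul, Matrix.mul_smul, smul_comm (((s : ℤˣ) : ℤ) : ℂ)]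
    congr 1
    simpa [create] using h

theorem sum_num_mode (U : Matrix (Site L) (Site L) ℝ) (c : Site L → ℝ) :
    ∑ j, (c j : ℂ) • IsModes.num (mode U) j = secondQuant (U * Matrix.diagonal c * Uᵀ) := by
  rw [secondQuant_apply]
  simp only [Matrix.mul_apply (M := U * _), Matrix.mul_diagonal, Matrix.transpose_apply,
    Finset.sum_smul]
  have : ∀ j, (c j : ℂ) • IsModes.num (mode U) j =
      ∑ x, ∑ y, (U x j * c j * U y j) • (create x * annihilate y) := by
    intro j
    rw [IsModes.num, mode_conjTranspose, mode, Finset.sum_mul_sum, Complex.coe_smul,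
      Finset.smul_sum]
    refine Finset.sum_congr rfl fun x _ => ?_
    rw [Finset.smul_sum]
    refine Finset.sum_congr rfl fun y _ => ?_
    rw [smul_mul_smul_comm, smul_smul]
    congr 1
    ring
  rw [Finset.sum_congr rfl fun j _ => this j, Finset.sum_comm]
  refine Finset.sum_congr rfl fun x _ => ?_
  rw [Finset.sum_comm]

theorem trace_exp_number (s : ℤˣ) :
    (signPowNumber s * NormedSpace.exp (secondQuant (1 : Matrix (Site L) (Site L) ℝ))).trace =
      (1 + (((s : ℤˣ) : ℤ) : ℂ) * Complex.exp 1) ^ Fintype.card (Site L) := by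
  rw [secondQuant_one, Matrix.exp_diagonal, signPowNumber, Matrix.diagonal_mul_diagonal,
    Matrix.trace_diagonal, ← Finset.card_univ, add_comm, ← Finset.sum_pow_mul_eq_add_pow,
    Finset.powerset_univ]
  refine Finset.sum_congr rfl fun S _ => ?_
  rw [one_pow, mul_one, mul_pow, Pi.coe_exp, ← Complex.exp_nat_mul, mul_one,
    Complex.exp_eq_exp_ℂ]

theorem one_add_sign_mul_exp_ne_zero (s : ℤˣ) :
    (1 + (((s : ℤˣ) : ℤ) : ℂ) * Complex.exp 1) ≠ 0 := by
  have h : (1 + (((s : ℤˣ) : ℤ) : ℂ) * Complex.exp 1) =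
      ((1 + (((s : ℤˣ) : ℤ) : ℝ) * Real.exp 1 : ℝ) : ℂ) := by push_cast; rfl
  rw [h, Complex.ofReal_ne_zero]
  have := Real.one_lt_exp_iff.mpr one_pos
  rcases Int.units_eq_one_or s with h | h
  · simp only [h, Units.val_one, Int.cast_one, one_mul]; linarith
  · simp only [h, Units.val_neg, Units.val_one, Int.reduceNeg, Int.cast_neg, Int.cast_one]; linarith

/-- The trace formula for quasi-free fermions. -/
theorem trace_exp_secondQuant {U : Matrix (Site L) (Site L) ℝ} (hU : Uᵀ * U = 1) (s : ℤˣ)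
    (c : Site L → ℝ) :
    (signPowNumber s * NormedSpace.exp (secondQuant (U * Matrix.diagonal c * Uᵀ))).trace =
      ∏ j, (1 + (((s : ℤˣ) : ℤ) : ℂ) * Complex.exp (c j)) := by
  -- With all reference coefficients equal to `1` the exponent is the number operator, whatever `U`
  -- is. Reference `0` would fail for `s = -1`, since the factor `1 + s e^0` to be cancelled is then
  -- zero.
  have h := (isModes_mode hU s).trace_exp_exchange (cast_sq s) (fun j => (c j : ℂ))
    (fun _ => ((1 : ℝ) : ℂ)) Finset.univ
  simp only [Finset.mem_univ, if_true] at h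
  rw [sum_num_mode U c, sum_num_mode U fun _ => 1] at h
  have h1 : U * Matrix.diagonal (fun _ => (1 : ℝ)) * Uᵀ = 1 := by
    rw [Matrix.diagonal_one, mul_one]
    exact mul_eq_one_comm.mp hU
  rw [h1, trace_exp_number, Finset.prod_const, Finset.card_univ, mul_comm, Complex.ofReal_one] at h
  exact mul_left_cancel₀ (pow_ne_zero _ (one_add_sign_mul_exp_ne_zero s)) h

theorem hopping_isHermitian (t : ℝ) (σ : GaugeField L) : (hopping t σ).IsHermitian := by
  rw [Matrix.IsHermitian, hopping, Matrix.conjTranspose_smul, Matrix.conjTranspose_sum]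
  congr 1
  · refine Finset.sum_congr rfl fun x _ => ?_
    rw [Matrix.conjTranspose_sum]
    refine Finset.sum_congr rfl fun μ _ => ?_
    rw [Matrix.conjTranspose_smul, Matrix.conjTranspose_add, Matrix.conjTranspose_single,
      Matrix.conjTranspose_single, add_comm]
    simp

/-- The partition functions in terms of the spectrum of the one-particle Hamiltonian. -/
theorem gaugeZ_eq_prod (s : ℤˣ) (β t : ℝ) (σ : GaugeField L) :
    gaugeZ s β t σ = ∏ j, (1 + (((s : ℤˣ) : ℤ) : ℝ) *
      Real.exp (-β * (hopping_isHermitian t σ).eigenvalues j)) := by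
  set hA := hopping_isHermitian t σ
  set U : Matrix (Site L) (Site L) ℝ := (hA.eigenvectorUnitary : Matrix (Site L) (Site L) ℝ) with hUdef
  have hU : Uᵀ * U = 1 := by
    have := Matrix.UnitaryGroup.star_mul_self hA.eigenvectorUnitary
    rwa [Matrix.star_eq_conjTranspose, Matrix.conjTranspose_eq_transpose_of_trivial] at this
  have hspec : hopping t σ = U * Matrix.diagonal hA.eigenvalues * Uᵀ := by
    have := hA.spectral_theorem
    rw [Unitary.conjStarAlgAut_apply] at this
    rw [Matrix.star_eq_conjTranspose, Matrix.conjTranspose_eq_transpose_of_trivial] at this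
    exact this
  have h1 : -(β : ℂ) • hamiltonian t σ =
      secondQuant (U * Matrix.diagonal (fun j => -β * hA.eigenvalues j) * Uᵀ) := by
    have h2 : U * Matrix.diagonal (fun j => -β * hA.eigenvalues j) * Uᵀ = (-β) • hopping t σ := by
      refine Eq.trans ?_ (congrArg (fun A => (-β) • A) hspec).symm
      rw [← Matrix.smul_mul, ← Matrix.mul_smul]
      congr 2
      ext i j
      simp [Matrix.diagonal_apply]
    rw [h2, map_smul, hamiltonian_eq_secondQuant, ← Complex.ofReal_neg, Complex.coe_smul]
  rw [gaugeZ, h1, trace_exp_secondQuant hU, ← Complex.ofReal_re (∏ j, _)]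
  push_cast
  rfl

end SecondQuantization

/-! ### Cauchy–Schwarz and reflection inequalities for determinants -/

section DetInequality
open scoped ComplexOrder
variable {n : Type*} [Fintype n] [DecidableEq n]

theorem det_add_smul_one {𝕜 : Type*} [RCLike 𝕜] {A : Matrix n n 𝕜} (hA : A.IsHermitian) (z : 𝕜) :
    (A + z • (1 : Matrix n n 𝕜)).det = ∏ i, ((hA.eigenvalues i : 𝕜) + z) := by
  have h := congrArg (Polynomial.eval (-z)) hA.charpoly_eq
  rw [Matrix.eval_charpoly, Polynomial.eval_prod] at h
  have h1 : Matrix.scalar n (-z) - A = -(A + z • (1 : Matrix n n 𝕜)) := by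
    rw [neg_add, Matrix.scalar_apply, ← Matrix.smul_one_eq_diagonal, neg_smul]; abel
  rw [h1, Matrix.det_neg] at h
  have h2 : ∏ i, Polynomial.eval (-z) (Polynomial.X - Polynomial.C (hA.eigenvalues i : 𝕜)) =
      (-1) ^ Fintype.card n * ∏ i, ((hA.eigenvalues i : 𝕜) + z) := by
    rw [← Finset.card_univ, ← Finset.prod_const, ← Finset.prod_mul_distrib]
    refine Finset.prod_congr rfl fun i _ => ?_
    simp; ring
  rw [h2] at h
  exact mul_left_cancel₀ (pow_ne_zero _ (neg_ne_zero.mpr one_ne_zero)) h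

theorem one_le_norm_det_one_add {Q : Matrix n n ℂ} (hQ : Q.PosSemidef) :
    1 ≤ ‖(1 + Q).det‖ := by
  have h := det_add_smul_one hQ.1 1
  rw [one_smul, add_comm] at h
  rw [h, norm_prod]
  refine Finset.one_le_prod fun i _ => ?_
  have := hQ.eigenvalues_nonneg i
  rw [RCLike.ofReal_eq_complex_ofReal, ← Complex.ofReal_one, ← Complex.ofReal_add, Complex.norm_real]
  exact le_trans (le_add_of_nonneg_left this) (le_abs_self _)

/-- For invertible `M`, pull `Mᴴ` and `M` out of the sum; what remains is `1` plus a positive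
semidefinite matrix, whose determinant is at least `1`. -/
theorem sq_norm_det_le {Q : Matrix n n ℂ} (hQ : Q.PosSemidef) (M : Matrix n n ℂ) :
    ‖M.det‖ ^ 2 ≤ ‖(Mᴴ * M + Q).det‖ := by
  by_cases hM : M.det = 0
  · simp [hM]
  have hu : IsUnit M.det := isUnit_iff_ne_zero.mpr hM
  have h1 : Mᴴ * M + Q = Mᴴ * (1 + (M⁻¹)ᴴ * Q * M⁻¹) * M := by
    have h2 : Mᴴ * (M⁻¹)ᴴ = 1 := by
      rw [← Matrix.conjTranspose_mul, Matrix.nonsing_inv_mul _ hu, Matrix.conjTranspose_one]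
    have h3 : M⁻¹ * M = 1 := Matrix.nonsing_inv_mul _ hu
    calc Mᴴ * M + Q = Mᴴ * M + (Mᴴ * (M⁻¹)ᴴ) * Q * (M⁻¹ * M) := by rw [h2, h3]; simp
      _ = _ := by noncomm_ring
  rw [h1, Matrix.det_mul, Matrix.det_mul, Matrix.det_conjTranspose, norm_mul, norm_mul, norm_star]
  have h2 := one_le_norm_det_one_add (hQ.conjTranspose_mul_mul_same M⁻¹)
  nlinarith [sq_nonneg ‖M.det‖]

/-- The Cauchy–Schwarz inequality for determinants. -/
theorem sq_norm_det_one_add_le (A B : Matrix n n ℂ) :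
    ‖(1 + Aᴴ * B).det‖ ^ 2 ≤ ‖(1 + Aᴴ * A).det‖ * ‖(1 + Bᴴ * B).det‖ := by
  set G := 1 + Aᴴ * A with hG
  set K := 1 + Aᴴ * B with hK
  have hGpos : G.PosDef :=
    Matrix.PosDef.one.add_posSemidef (Matrix.posSemidef_conjTranspose_mul_self A)
  have hdet : G.det ≠ 0 := hGpos.det_pos.ne'
  have hu : IsUnit G.det := isUnit_iff_ne_zero.mpr hdet
  obtain ⟨R, hR⟩ : ∃ R, G⁻¹ = Rᴴ * R := by
    have := hGpos.inv.posSemidef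
    open scoped MatrixOrder Matrix.Norms.L2Operator in
    exact CStarAlgebra.nonneg_iff_eq_star_mul_self.mp this.nonneg
  -- Least squares: the block column `(1, A) X` is the orthogonal projection of `(1, B)` onto the
  -- range of `(1, A)`. The identity `hkey` is Pythagoras, with residual `(1 - X, B - A X)`.
  set X := G⁻¹ * K with hX
  have hGX : G * X = K := by rw [hX, ← mul_assoc, Matrix.mul_nonsing_inv _ hu, one_mul]
  have hkey : 1 + Bᴴ * B = (R * K)ᴴ * (R * K) +
      ((1 - X)ᴴ * (1 - X) + (B - A * X)ᴴ * (B - A * X)) := by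
    have h1 : (R * K)ᴴ * (R * K) = Kᴴ * X := by
      rw [Matrix.conjTranspose_mul, hX, hR]; noncomm_ring
    have h2 : Kᴴ = 1 + Bᴴ * A := by simp [hK, Matrix.conjTranspose_mul]
    have h3 : (1 - X)ᴴ * (1 - X) + (B - A * X)ᴴ * (B - A * X) =
        1 + Bᴴ * B - (1 + Bᴴ * A) * X - Xᴴ * K + Xᴴ * (G * X) := by
      rw [hK, hG]
      simp only [Matrix.conjTranspose_sub, Matrix.conjTranspose_mul, Matrix.conjTranspose_one]
      noncomm_ring
    rw [h1, h3, hGX, h2]; noncomm_ring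
  have hQ := (Matrix.posSemidef_conjTranspose_mul_self (1 - X)).add
    (Matrix.posSemidef_conjTranspose_mul_self (B - A * X))
  have h := sq_norm_det_le hQ (R * K)
  rw [← hkey, Matrix.det_mul, norm_mul, mul_pow] at h
  have hRd : ‖R.det‖ ^ 2 * ‖G.det‖ = 1 := by
    have h1 := congrArg Matrix.det hR
    rw [Matrix.det_mul, Matrix.det_conjTranspose] at h1
    have h2 : G⁻¹.det * G.det = 1 := by rw [← Matrix.det_mul, Matrix.nonsing_inv_mul _ hu, Matrix.det_one]
    have h3 := congrArg norm h2
    rw [h1, norm_mul, norm_mul, norm_star, norm_one] at h3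
    rw [sq, h3]
  calc ‖K.det‖ ^ 2 = ‖G.det‖ * (‖R.det‖ ^ 2 * ‖K.det‖ ^ 2) := by
        rw [← mul_assoc, mul_comm ‖G.det‖, hRd, one_mul]
    _ ≤ _ := mul_le_mul_of_nonneg_left h (norm_nonneg _)

theorem norm_det_fromBlocks_one (X Y : Matrix n n ℂ) :
    ‖(Matrix.fromBlocks X 1 1 Y).det‖ = ‖(1 - Y * X).det‖ := by
  have h1 : Matrix.fromBlocks X 1 1 Y * Matrix.fromBlocks 0 1 1 0 =
      Matrix.fromBlocks 1 X Y 1 := by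
    rw [Matrix.fromBlocks_multiply]; simp
  have h2 : (Matrix.fromBlocks 0 1 1 0 : Matrix (n ⊕ n) (n ⊕ n) ℂ) *
      Matrix.fromBlocks 0 1 1 0 = 1 := by
    rw [Matrix.fromBlocks_multiply]; simp [Matrix.fromBlocks_one]
  have h3 : ‖(Matrix.fromBlocks 0 1 1 0 : Matrix (n ⊕ n) (n ⊕ n) ℂ).det‖ = 1 := by
    have := congrArg (fun M => ‖Matrix.det M‖) h2
    simp only [Matrix.det_mul, norm_mul, Matrix.det_one, norm_one] at this
    nlinarith [norm_nonneg (Matrix.fromBlocks 0 1 1 0 : Matrix (n ⊕ n) (n ⊕ n) ℂ).det]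
  have h4 := congrArg (fun M => ‖Matrix.det M‖) h1
  simp only [Matrix.det_mul, norm_mul, h3, mul_one, Matrix.det_fromBlocks_one₁₁] at h4
  exact h4

/-- Up to a factor of modulus one the block determinant is `det (1 - Y X)`, so this is
Cauchy–Schwarz for the pair `-Yᴴ`, `X`. -/
theorem reflection_det_one (X Y : Matrix n n ℂ) :
    ‖(Matrix.fromBlocks X 1 1 Y).det‖ ^ 2 ≤
      ‖(Matrix.fromBlocks X 1 1 (-Xᴴ)).det‖ * ‖(Matrix.fromBlocks Y 1 1 (-Yᴴ)).det‖ := by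
  simp only [norm_det_fromBlocks_one]
  have h := sq_norm_det_one_add_le (-Yᴴ) X
  have h1 : (1 + Yᴴ * Y).det = (1 + Y * Yᴴ).det := Matrix.det_one_add_mul_comm _ _
  simp only [Matrix.conjTranspose_neg, Matrix.conjTranspose_conjTranspose, neg_mul, mul_neg,
    neg_neg, ← sub_eq_add_neg, sub_neg_eq_add] at h ⊢
  rw [h1, mul_comm]
  exact h

/-- Multiplying both sides of each block by `D^{-1/2}` normalises the coupling to `1`, and this is
compatible with `X ↦ -Xᴴ` because `D^{-1/2}` is Hermitian. -/
theorem reflection_det_pos (X Y : Matrix n n ℂ) {d : n → ℝ} (hd : ∀ i, 0 < d i) :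
    ‖(Matrix.fromBlocks X (Matrix.diagonal fun i => (d i : ℂ)) (Matrix.diagonal fun i => (d i : ℂ))
      Y).det‖ ^ 2 ≤
    ‖(Matrix.fromBlocks X (Matrix.diagonal fun i => (d i : ℂ)) (Matrix.diagonal fun i => (d i : ℂ))
      (-Xᴴ)).det‖ *
    ‖(Matrix.fromBlocks Y (Matrix.diagonal fun i => (d i : ℂ)) (Matrix.diagonal fun i => (d i : ℂ))
      (-Yᴴ)).det‖ := by
  set S : Matrix n n ℂ := Matrix.diagonal fun i => ((Real.sqrt (d i))⁻¹ : ℂ) with hS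
  set D : Matrix n n ℂ := Matrix.diagonal fun i => (d i : ℂ) with hD
  have hSS : Sᴴ = S := by
    rw [hS, Matrix.diagonal_conjTranspose]; congr 1; ext i; simp
  have hSDS : S * D * S = 1 := by
    rw [hS, hD, Matrix.diagonal_mul_diagonal, Matrix.diagonal_mul_diagonal, ← Matrix.diagonal_one]
    congr 1
    ext i
    have h1 : ((Real.sqrt (d i) : ℝ) : ℂ) ≠ 0 :=
      Complex.ofReal_ne_zero.mpr (Real.sqrt_pos.mpr (hd i)).ne'
    have h2 : (d i : ℂ) = (Real.sqrt (d i) : ℂ) * (Real.sqrt (d i) : ℂ) := by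
      rw [← Complex.ofReal_mul, Real.mul_self_sqrt (hd i).le]
    rw [h2]; field_simp
  have hSd : 0 < ‖S.det‖ := by
    rw [norm_pos_iff]
    intro h0
    have := congrArg Matrix.det hSDS
    rw [Matrix.det_mul, h0] at this
    simp at this
  have key : ∀ X Y : Matrix n n ℂ, ‖(Matrix.fromBlocks (S * X * S) 1 1 (S * Y * S)).det‖ =
      ‖S.det‖ ^ 4 * ‖(Matrix.fromBlocks X D D Y).det‖ := by
    intro X Y
    have : Matrix.fromBlocks (S * X * S) 1 1 (S * Y * S) =
        Matrix.fromBlocks S 0 0 S * Matrix.fromBlocks X D D Y * Matrix.fromBlocks S 0 0 S := by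
      rw [Matrix.fromBlocks_multiply, Matrix.fromBlocks_multiply]
      simp [hSDS]
    rw [this, Matrix.det_mul, Matrix.det_mul, Matrix.det_fromBlocks_zero₂₁]
    simp only [norm_mul]; ring
  have h := reflection_det_one (S * X * S) (S * Y * S)
  have hc : ∀ X : Matrix n n ℂ, -(S * X * S)ᴴ = S * (-Xᴴ) * S := by
    intro X
    simp [Matrix.conjTranspose_mul, hSS, mul_assoc]
  rw [hc, hc, key, key, key] at h
  have h4 : 0 < ‖S.det‖ ^ 8 := by positivity
  refine le_of_mul_le_mul_left ?_ h4
  calc _ = _ := by ring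
    _ ≤ _ := h
    _ = _ := by ring

/-- Reflection positivity of determinants. -/
theorem reflection_det (X Y : Matrix n n ℂ) {d : n → ℝ} (hd : ∀ i, 0 ≤ d i) :
    ‖(Matrix.fromBlocks X (Matrix.diagonal fun i => (d i : ℂ)) (Matrix.diagonal fun i => (d i : ℂ))
      Y).det‖ ^ 2 ≤
    ‖(Matrix.fromBlocks X (Matrix.diagonal fun i => (d i : ℂ)) (Matrix.diagonal fun i => (d i : ℂ))
      (-Xᴴ)).det‖ *
    ‖(Matrix.fromBlocks Y (Matrix.diagonal fun i => (d i : ℂ)) (Matrix.diagonal fun i => (d i : ℂ))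
      (-Yᴴ)).det‖ := by
  -- In the application `d` vanishes away from the cut bonds, so it is not invertible; the
  -- inequality holds for `d + ε` and survives `ε → 0`.
  have hcont : ∀ X Y : Matrix n n ℂ, Continuous fun ε : ℝ =>
      ‖(Matrix.fromBlocks X (Matrix.diagonal fun i => ((d i + ε : ℝ) : ℂ))
        (Matrix.diagonal fun i => ((d i + ε : ℝ) : ℂ)) Y).det‖ := by
    intro X Y
    refine (Continuous.matrix_det ?_).norm
    have : Continuous fun ε : ℝ => Matrix.diagonal fun i => ((d i + ε : ℝ) : ℂ) :=
      Continuous.matrix_diagonal (by fun_prop)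
    exact Continuous.matrix_fromBlocks continuous_const this this continuous_const
  have hl := ((hcont X Y).pow 2).tendsto 0 |>.mono_left (nhdsWithin_le_nhds (s := Set.Ioi 0))
  have hr := (((hcont X (-Xᴴ)).mul (hcont Y (-Yᴴ))).tendsto 0).mono_left
    (nhdsWithin_le_nhds (s := Set.Ioi 0))
  have := le_of_tendsto_of_tendsto hl hr (by
    filter_upwards [self_mem_nhdsWithin] with ε hε
    exact reflection_det_pos X Y fun i => add_pos_of_nonneg_of_pos (hd i) hε)
  simpa using this

end DetInequality

/-! ### Matsubara products for the single-mode weights -/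

section ProductFormulas
open scoped Topology
open Filter

/-- Euler's sine product at the imaginary point `i x / π`. -/
theorem tendsto_sinh_prod (x : ℝ) :
    Tendsto (fun n : ℕ => x * ∏ j ∈ Finset.range n, (1 + x ^ 2 / (Real.pi * (j + 1)) ^ 2)) atTop
      (𝓝 (Real.sinh x)) := by
  have hpi : (Real.pi : ℂ) ≠ 0 := Complex.ofReal_ne_zero.mpr Real.pi_ne_zero
  have h := Complex.tendsto_euler_sin_prod ((x : ℂ) * Complex.I / Real.pi)
  have h1 : (Real.pi : ℂ) * ((x : ℂ) * Complex.I / Real.pi) = x * Complex.I := by field_simp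
  rw [h1, Complex.sin_mul_I] at h
  have h2 := (Complex.continuous_im.tendsto _).comp h
  have h3 : (Complex.sinh x * Complex.I).im = Real.sinh x := by
    rw [Complex.mul_I_im, Complex.sinh_ofReal_re]
  rw [h3] at h2
  refine h2.congr fun n => ?_
  have h4 : ∏ j ∈ Finset.range n, ((1 : ℂ) - (x * Complex.I / Real.pi) ^ 2 / ((j : ℂ) + 1) ^ 2) =
      ((∏ j ∈ Finset.range n, (1 + x ^ 2 / (Real.pi * (j + 1)) ^ 2) : ℝ) : ℂ) := by
    push_cast
    refine Finset.prod_congr rfl fun j _ => ?_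
    rw [div_pow, mul_pow, Complex.I_sq, mul_pow, div_div]
    ring
  simp only [Function.comp_apply]
  rw [h4, mul_right_comm, ← Complex.ofReal_mul, Complex.mul_I_im, Complex.ofReal_re]

theorem prod_range_two_mul (f : ℕ → ℝ) (n : ℕ) :
    ∏ j ∈ Finset.range (2 * n), f j =
      (∏ j ∈ Finset.range n, f (2 * j)) * ∏ j ∈ Finset.range n, f (2 * j + 1) := by
  induction n with
  | zero => simp
  | succ n ih =>
    rw [show 2 * (n + 1) = 2 * n + 1 + 1 by ring, Finset.prod_range_succ, Finset.prod_range_succ, ih,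
      Finset.prod_range_succ, Finset.prod_range_succ]
    ring

/-- From `cosh x = sinh (2 x) / (2 sinh x)`: the factors of `sinh (2 x)` with even multiples of `π`
are those of `sinh x` and cancel. -/
theorem tendsto_cosh_prod (x : ℝ) :
    Tendsto (fun n : ℕ => ∏ j ∈ Finset.range n, (1 + (2 * x) ^ 2 / (Real.pi * (2 * j + 1)) ^ 2))
      atTop (𝓝 (Real.cosh x)) := by
  rcases eq_or_ne x 0 with rfl | hx
  · simp
  have hs : Real.sinh x ≠ 0 := by rwa [Ne, Real.sinh_eq_zero]
  have h1 := (tendsto_sinh_prod (2 * x)).comp (tendsto_id.const_mul_atTop' (two_pos (α := ℕ)))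
  have h2 := (h1.div (tendsto_sinh_prod x) hs).div_const 2
  have h3 : Real.sinh (2 * x) / Real.sinh x / 2 = Real.cosh x := by
    rw [Real.sinh_two_mul]; field_simp
  rw [h3] at h2
  refine h2.congr fun n => ?_
  simp only [Function.comp_apply, id, Pi.div_apply]
  rw [prod_range_two_mul]
  have h4 : ∏ j ∈ Finset.range n, (1 + (2 * x) ^ 2 / (Real.pi * (((2 * j + 1 : ℕ) : ℝ) + 1)) ^ 2) =
      ∏ j ∈ Finset.range n, (1 + x ^ 2 / (Real.pi * (j + 1)) ^ 2) := by
    refine Finset.prod_congr rfl fun j _ => ?_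
    have : (Real.pi * (((2 * j + 1 : ℕ) : ℝ) + 1)) ^ 2 = 2 ^ 2 * (Real.pi * (j + 1)) ^ 2 := by
      push_cast; ring
    rw [this, mul_pow, mul_div_mul_left _ _ (by norm_num)]
  have h5 : 0 < ∏ j ∈ Finset.range n, (1 + x ^ 2 / (Real.pi * (j + 1)) ^ 2) :=
    Finset.prod_pos fun j _ => by positivity
  rw [h4]
  push_cast
  field_simp

/-- The single-mode weight `e^{βλ/2} + s e^{-βλ/2}`. -/
noncomputable def modeWeight (s : ℤˣ) (β l : ℝ) : ℝ :=
  Real.exp (β * l / 2) + (((s : ℤˣ) : ℤ) : ℝ) * Real.exp (-(β * l / 2))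

/-- The squared single-mode weight as a limit of products over Matsubara frequencies. -/
theorem exists_tendsto_modeWeight (s : ℤˣ) {β : ℝ} (hβ : 0 < β) :
    ∃ (C : ℕ → ℝ) (ω : ℕ → ℝ) (k : ℕ), (∀ n, 0 ≤ C n) ∧ ∀ l : ℝ,
      Tendsto (fun n => C n * (l ^ 2 + 0 ^ 2) ^ k *
        (∏ j ∈ Finset.range n, (l ^ 2 + ω j ^ 2)) ^ 2) atTop (𝓝 (modeWeight s β l ^ 2)) := by
  have key : ∀ (w : ℕ → ℝ) (hw : ∀ j, 0 < w j) (y : ℝ) (n : ℕ), ∏ j ∈ Finset.range n,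
      (1 + (β * y) ^ 2 / w j ^ 2) = (∏ j ∈ Finset.range n, (β / w j) ^ 2) *
        ∏ j ∈ Finset.range n, (y ^ 2 + (w j / β) ^ 2) := by
    intro w hw y n
    rw [← Finset.prod_mul_distrib]
    refine Finset.prod_congr rfl fun j _ => ?_
    have := hw j
    field_simp
    ring
  rcases Int.units_eq_one_or s with rfl | rfl
  · have hw : ∀ j : ℕ, 0 < Real.pi * (2 * j + 1) := fun j => mul_pos Real.pi_pos (by positivity)
    refine ⟨fun n => (2 * ∏ j ∈ Finset.range n, (β / (Real.pi * (2 * j + 1))) ^ 2) ^ 2,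
      fun j => Real.pi * (2 * j + 1) / β, 0, fun n => sq_nonneg _, fun l => ?_⟩
    have h := ((tendsto_cosh_prod (β * l / 2)).const_mul 2).pow 2
    have h1 : 2 * Real.cosh (β * l / 2) = modeWeight 1 β l := by
      rw [modeWeight, Real.cosh_eq]; simp; ring
    rw [h1] at h
    refine h.congr fun n => ?_
    rw [show 2 * (β * l / 2) = β * l by ring, key _ hw]
    ring
  · have hw : ∀ j : ℕ, 0 < 2 * Real.pi * (j + 1) := fun j => by have := Real.pi_pos; positivity
    -- The simple zero of `sinh` gives a prefactor `β l`. Its square supplies the frequency-zero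
    -- factor `l ^ 2 + 0 ^ 2`, hence `k = 1`, in a form to which a bound at `w = 0` applies.
    refine ⟨fun n => (β * ∏ j ∈ Finset.range n, (β / (2 * Real.pi * (j + 1))) ^ 2) ^ 2,
      fun j => 2 * Real.pi * (j + 1) / β, 1, fun n => sq_nonneg _, fun l => ?_⟩
    have h := ((tendsto_sinh_prod (β * l / 2)).const_mul 2).pow 2
    have h1 : 2 * Real.sinh (β * l / 2) = modeWeight (-1) β l := by
      rw [modeWeight, Real.sinh_eq]; simp; ring
    rw [h1] at h
    refine h.congr fun n => ?_
    have h2 : ∏ j ∈ Finset.range n, (1 + (β * l / 2) ^ 2 / (Real.pi * (j + 1)) ^ 2) =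
        ∏ j ∈ Finset.range n, (1 + (β * l) ^ 2 / (2 * Real.pi * (j + 1)) ^ 2) := by
      refine Finset.prod_congr rfl fun j _ => ?_
      rw [div_pow, div_div]
      congr 2
      ring
    rw [h2, key _ hw]
    ring

/-- A bound for all Matsubara frequencies yields a bound for the product of the mode weights. -/
theorem sq_prod_modeWeight_le {ι : Type*} [Fintype ι] (s : ℤˣ) {β : ℝ} (hβ : 0 < β)
    {l l₁ l₂ : ι → ℝ}
    (h : ∀ w : ℝ, (∏ i, (l i ^ 2 + w ^ 2)) ^ 2 ≤ (∏ i, (l₁ i ^ 2 + w ^ 2)) * ∏ i, (l₂ i ^ 2 + w ^ 2)) :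
    (∏ i, modeWeight s β (l i)) ^ 2 ≤
      |∏ i, modeWeight s β (l₁ i)| * |∏ i, modeWeight s β (l₂ i)| := by
  obtain ⟨C, ω, k, hC, hlim⟩ := exists_tendsto_modeWeight s hβ
  have hprod : ∀ l : ι → ℝ, Tendsto (fun n => C n ^ Fintype.card ι * (∏ i, (l i ^ 2 + 0 ^ 2)) ^ k *
      (∏ j ∈ Finset.range n, ∏ i, (l i ^ 2 + ω j ^ 2)) ^ 2) atTop
      (𝓝 ((∏ i, modeWeight s β (l i)) ^ 2)) := by
    intro l
    have := tendsto_finsetProd (Finset.univ : Finset ι) fun i _ => hlim (l i)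
    rw [Finset.prod_pow] at this
    refine this.congr fun n => ?_
    rw [Finset.prod_mul_distrib, Finset.prod_mul_distrib, Finset.prod_const, Finset.card_univ,
      Finset.prod_pow, Finset.prod_pow, Finset.prod_comm]
  have hfin := le_of_tendsto_of_tendsto' ((hprod l).pow 2) ((hprod l₁).mul (hprod l₂)) fun n => by
    have h0 : ∀ (l : ι → ℝ) (w : ℝ), 0 ≤ ∏ i, (l i ^ 2 + w ^ 2) := fun l w =>
      Finset.prod_nonneg fun i _ => by positivity
    have h1 : (∏ j ∈ Finset.range n, ∏ i, (l i ^ 2 + ω j ^ 2)) ^ 2 ≤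
        (∏ j ∈ Finset.range n, ∏ i, (l₁ i ^ 2 + ω j ^ 2)) *
          ∏ j ∈ Finset.range n, ∏ i, (l₂ i ^ 2 + ω j ^ 2) := by
      rw [← Finset.prod_pow, ← Finset.prod_mul_distrib]
      exact Finset.prod_le_prod (fun j _ => sq_nonneg _) fun j _ => h (ω j)
    have h2 := pow_le_pow_left₀ (sq_nonneg _) (h 0) k
    have h3 := pow_le_pow_left₀ (sq_nonneg _) h1 2
    have h4 := mul_le_mul h2 h3 (by positivity) (pow_nonneg (mul_nonneg (h0 _ _) (h0 _ _)) _)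
    have h5 := mul_le_mul_of_nonneg_left h4 (pow_nonneg (pow_nonneg (hC n) (Fintype.card ι)) 2)
    calc _ = _ := by ring
      _ ≤ _ := h5
      _ = _ := by ring
  -- The limits only see squares of the products, so the signs of the right-hand factors are lost;
  -- they are settled later by nonnegativity of the partition functions.
  refine abs_le_of_sq_le_sq' ?_ (by positivity) |>.2
  rw [mul_pow, sq_abs, sq_abs]
  exact hfin

end ProductFormulas

/-! ### Spectral form, sign and comparison of the partition functions -/

section PartitionFunction
set_option linter.unusedSectionVars false
variable {L : ℕ} [NeZero L]

theorem hopping_apply (t : ℝ) (σ : GaugeField L) (x y : Site L) :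
    hopping t σ x y = -t * ∑ μ : Fin 2, ((if x + e μ = y then (((σ x μ : ℤˣ) : ℤ) : ℝ) else 0) +
      if y + e μ = x then (((σ y μ : ℤˣ) : ℤ) : ℝ) else 0) := by
  rw [hopping, Matrix.smul_apply, smul_eq_mul, Matrix.sum_apply]
  congr 1
  simp only [Matrix.sum_apply, Matrix.smul_apply, Matrix.add_apply, Matrix.single_apply, smul_eq_mul,
    mul_add, mul_ite, mul_one, mul_zero]
  rw [Finset.sum_comm]
  refine Finset.sum_congr rfl fun μ _ => ?_
  rw [Finset.sum_add_distrib]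
  congr 1
  · rw [Finset.sum_eq_single x (by intro b _ hb; simp [hb]) (by simp)]
    simp
  · rw [Finset.sum_eq_single y (by intro b _ hb; simp [hb]) (by simp)]
    simp

theorem e_ne_zero (hL : 1 < L) (μ : Fin 2) : (e μ : Site L) ≠ 0 := by
  have : Fact (1 < L) := ⟨hL⟩
  unfold e
  split_ifs <;> simp [Prod.ext_iff]

theorem hopping_trace (hL : 1 < L) (t : ℝ) (σ : GaugeField L) : (hopping t σ).trace = 0 := by
  rw [Matrix.trace]
  refine Finset.sum_eq_zero fun x _ => ?_
  rw [Matrix.diag_apply, hopping_apply]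
  simp [e_ne_zero hL]

/-- The one-particle eigenvalues. -/
noncomputable def energy (t : ℝ) (σ : GaugeField L) : Site L → ℝ :=
  (hopping_isHermitian t σ).eigenvalues

/-- The hopping matrix has trace zero, so `∏ e^{-βλ/2} = 1` and the factors `1 + s e^{-βλ}` can be
symmetrised for free. -/
theorem gaugeZ_eq_prod_modeWeight (hL : 1 < L) (s : ℤˣ) (β t : ℝ) (σ : GaugeField L) :
    gaugeZ s β t σ = ∏ j, modeWeight s β (energy t σ j) := by
  have h : ∏ j, Real.exp (-(β * energy t σ j / 2)) = 1 := by
    have h1 := (hopping_isHermitian t σ).trace_eq_sum_eigenvalues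
    rw [hopping_trace hL] at h1
    rw [← Real.exp_sum, Real.exp_eq_one_iff, Finset.sum_neg_distrib, ← Finset.sum_div,
      ← Finset.mul_sum]
    simp only [RCLike.ofReal_real_eq_id, id] at h1
    rw [energy, ← h1]; simp
  rw [← one_mul (∏ j, modeWeight s β (energy t σ j)), ← h, ← Finset.prod_mul_distrib,
    gaugeZ_eq_prod]
  refine Finset.prod_congr rfl fun j _ => ?_
  rw [modeWeight, mul_add, mul_left_comm, ← Real.exp_add, ← Real.exp_add]
  change 1 + _ * Real.exp (-β * energy t σ j) = _
  congr 2
  · rw [neg_add_cancel, Real.exp_zero]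
  · congr 1; ring

/-- The modulus of the determinant of the resolvent at the Matsubara frequency `w`. -/
noncomputable def resolventDet (t : ℝ) (σ : GaugeField L) (w : ℝ) : ℝ :=
  ‖((hopping t σ).map (algebraMap ℝ ℂ) + (w * Complex.I) • (1 : Matrix (Site L) (Site L) ℂ)).det‖

theorem det_map_add_smul_one {n : Type*} [Fintype n] [DecidableEq n] {A : Matrix n n ℝ}
    (hA : A.IsHermitian) (z : ℂ) :
    (A.map (algebraMap ℝ ℂ) + z • (1 : Matrix n n ℂ)).det = ∏ i, ((hA.eigenvalues i : ℂ) + z) := by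
  have h := congrArg (Polynomial.eval (-z)) (congrArg (Polynomial.map (algebraMap ℝ ℂ))
    hA.charpoly_eq)
  rw [← Matrix.charpoly_map, Matrix.eval_charpoly, Polynomial.map_prod, Polynomial.eval_prod] at h
  have h1 : Matrix.scalar n (-z) - A.map (algebraMap ℝ ℂ) =
      -(A.map (algebraMap ℝ ℂ) + z • (1 : Matrix n n ℂ)) := by
    rw [neg_add, Matrix.scalar_apply, ← Matrix.smul_one_eq_diagonal, neg_smul]; abel
  have h3 : (algebraMap ℝ ℂ).mapMatrix A = A.map (algebraMap ℝ ℂ) := rfl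
  rw [h1, Matrix.det_neg] at h
  have h2 : ∏ i, Polynomial.eval (-z) (Polynomial.map (algebraMap ℝ ℂ)
      (Polynomial.X - Polynomial.C ((hA.eigenvalues i : ℝ)))) =
      (-1) ^ Fintype.card n * ∏ i, ((hA.eigenvalues i : ℂ) + z) := by
    rw [← Finset.card_univ, ← Finset.prod_const, ← Finset.prod_mul_distrib]
    refine Finset.prod_congr rfl fun i _ => ?_
    simp; ring
  exact mul_left_cancel₀ (pow_ne_zero _ (neg_ne_zero.mpr one_ne_zero)) (h.trans h2)

theorem resolventDet_sq (t : ℝ) (σ : GaugeField L) (w : ℝ) :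
    resolventDet t σ w ^ 2 = ∏ j, (energy t σ j ^ 2 + w ^ 2) := by
  rw [resolventDet, det_map_add_smul_one (hopping_isHermitian t σ), norm_prod, ← Finset.prod_pow]
  refine Finset.prod_congr rfl fun j _ => ?_
  rw [← Complex.normSq_eq_norm_sq]
  change Complex.normSq ((energy t σ j : ℂ) + w * Complex.I) = _
  rw [Complex.normSq_add_mul_I]

theorem abs_gaugeZ_sq_le (hL : 1 < L) (s : ℤˣ) {β : ℝ} (hβ : 0 < β) (t : ℝ) {σ σ₁ σ₂ : GaugeField L}
    (h : ∀ w, resolventDet t σ w ^ 2 ≤ resolventDet t σ₁ w * resolventDet t σ₂ w) :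
    gaugeZ s β t σ ^ 2 ≤ |gaugeZ s β t σ₁| * |gaugeZ s β t σ₂| := by
  simp only [gaugeZ_eq_prod_modeWeight hL]
  refine sq_prod_modeWeight_le s hβ fun w => ?_
  rw [← resolventDet_sq, ← resolventDet_sq, ← resolventDet_sq, ← mul_pow]
  exact pow_le_pow_left₀ (sq_nonneg _) (h w) 2

theorem prod_energy (t : ℝ) (σ : GaugeField L) : ∏ j, energy t σ j = (hopping t σ).det := by
  have := (hopping_isHermitian t σ).det_eq_prod_eigenvalues
  exact this.symm

/-- The even partition function is positive, and the odd one has the sign of `det h`. -/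
theorem exists_gaugeZ_eq (hL : 1 < L) (s : ℤˣ) {β : ℝ} (hβ : 0 < β) (t : ℝ) (σ : GaugeField L) :
    ∃ c : ℝ, 0 < c ∧ (gaugeZ s β t σ = c ∨ gaugeZ s β t σ = c * (hopping t σ).det) := by
  rw [gaugeZ_eq_prod_modeWeight hL]
  rcases Int.units_eq_one_or s with rfl | rfl
  · refine ⟨_, Finset.prod_pos fun j _ => ?_, Or.inl rfl⟩
    simp only [modeWeight, Units.val_one, Int.cast_one, one_mul]
    positivity
  · refine ⟨∏ j, if energy t σ j = 0 then 1 else modeWeight (-1) β (energy t σ j) / energy t σ j,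
      Finset.prod_pos fun j _ => ?_, Or.inr ?_⟩
    · split_ifs with h
      · exact one_pos
      · simp only [modeWeight, Units.val_neg, Units.val_one, Int.reduceNeg, Int.cast_neg,
          Int.cast_one, neg_one_mul, ← sub_eq_add_neg]
        rcases lt_or_gt_of_ne h with h | h
        · refine div_pos_of_neg_of_neg (sub_neg.mpr (Real.exp_lt_exp.mpr ?_)) h
          nlinarith
        · refine div_pos (sub_pos.mpr (Real.exp_lt_exp.mpr ?_)) h
          nlinarith
    · rw [← prod_energy, ← Finset.prod_mul_distrib]
      refine Finset.prod_congr rfl fun j _ => ?_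
      split_ifs with h
      · simp [h, modeWeight]
      · field_simp

/-- A splitting of a type into two copies of the set where `p` holds. -/
def splitEquiv {α : Type*} (p : α → Prop) [DecidablePred p] (f : α ≃ α) (hf : ∀ x, p x ↔ ¬p (f x)) :
    {x // p x} ⊕ {x // p x} ≃ α :=
  (Equiv.sumCongr (Equiv.refl _) (f.subtypeEquiv hf)).trans (Equiv.sumCompl p)

theorem splitEquiv_inl {α : Type*} (p : α → Prop) [DecidablePred p] (f : α ≃ α)
    (hf : ∀ x, p x ↔ ¬p (f x)) (x : {x // p x}) : splitEquiv p f hf (Sum.inl x) = x := by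
  simp [splitEquiv]

theorem splitEquiv_inr {α : Type*} (p : α → Prop) [DecidablePred p] (f : α ≃ α)
    (hf : ∀ x, p x ↔ ¬p (f x)) (x : {x // p x}) : splitEquiv p f hf (Sum.inr x) = f x := by
  simp [splitEquiv]

/-- Exchanging the two blocks has determinant `(-1) ^ card n = 1`, after which the determinant is
`(det M) ^ 2`. -/
theorem det_fromBlocks_offDiag_nonneg {n : Type*} [Fintype n] [DecidableEq n]
    (hn : Even (Fintype.card n)) (M : Matrix n n ℝ) :
    0 ≤ (Matrix.fromBlocks 0 M Mᵀ 0).det := by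
  have h0 : (Matrix.fromBlocks 0 1 1 0 : Matrix (n ⊕ n) (n ⊕ n) ℝ).det = 1 := by
    have h1 : (Matrix.fromBlocks 1 1 0 1 : Matrix (n ⊕ n) (n ⊕ n) ℝ) * Matrix.fromBlocks 0 1 1 0 =
        Matrix.fromBlocks 1 1 1 0 := by
      rw [Matrix.fromBlocks_multiply]; simp
    have h2 := congrArg Matrix.det h1
    rw [Matrix.det_mul, Matrix.det_fromBlocks_zero₂₁, Matrix.det_fromBlocks_one₁₁] at h2
    simpa [Matrix.det_neg, hn.neg_one_pow] using h2
  have h1 : Matrix.fromBlocks 0 M Mᵀ 0 * Matrix.fromBlocks 0 1 1 0 =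
      Matrix.fromBlocks M 0 0 Mᵀ := by
    rw [Matrix.fromBlocks_multiply]; simp
  have h2 := congrArg Matrix.det h1
  rw [Matrix.det_mul, h0, mul_one, Matrix.det_fromBlocks_zero₂₁, Matrix.det_transpose] at h2
  rw [h2]
  exact mul_self_nonneg _

theorem even_val_add_one (hL : Even L) (i : ZMod L) : Even (i + 1).val ↔ ¬Even i.val := by
  rcases val_succ i with ⟨h0, h⟩ | ⟨-, h⟩
  · rw [h0, ZMod.val_zero]
    rw [← h] at hL
    simpa using (Nat.even_add_one.mp hL)
  · rw [h]; exact Nat.even_add_one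

theorem even_val_add_e (hL : Even L) (x : Site L) (μ : Fin 2) :
    Even ((x + e μ).1.val + (x + e μ).2.val) ↔ ¬Even (x.1.val + x.2.val) := by
  unfold e
  split_ifs <;> simp only [Prod.fst_add, Prod.snd_add, add_zero, Nat.even_add,
    even_val_add_one hL] <;> tauto

theorem hopping_eq_zero_of_even (hL : Even L) (t : ℝ) (σ : GaugeField L) {x y : Site L}
    (h : Even (x.1.val + x.2.val) ↔ Even (y.1.val + y.2.val)) : hopping t σ x y = 0 := by
  rw [hopping_apply, Finset.sum_eq_zero, mul_zero]
  intro μ _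
  rw [if_neg, if_neg, add_zero]
  · rintro rfl
    rw [even_val_add_e hL] at h
    tauto
  · rintro rfl
    rw [even_val_add_e hL] at h
    tauto

/-- Hopping connects only sites of opposite parity, which makes the matrix block off-diagonal; for
`L = 4 m` each sublattice has `8 m ^ 2` sites, an even number. -/
theorem hopping_det_nonneg (hL : 4 ∣ L) (t : ℝ) (σ : GaugeField L) : 0 ≤ (hopping t σ).det := by
  have hL2 : Even L := even_iff_two_dvd.mpr (dvd_trans (by norm_num) hL)
  let p : Site L → Prop := fun x => Even (x.1.val + x.2.val)
  have hf : ∀ x : Site L, p x ↔ ¬p (Equiv.addRight (e 0) x) := fun x => by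
    simp only [p, Equiv.coe_addRight, even_val_add_e hL2, not_not]
  let E := splitEquiv p (Equiv.addRight (e 0)) hf
  have hcard : Even (Fintype.card {x // p x}) := by
    have h1 := Fintype.card_congr E
    rw [Fintype.card_sum, Fintype.card_prod, ZMod.card] at h1
    obtain ⟨m, rfl⟩ := hL
    refine ⟨4 * m * m, ?_⟩
    nlinarith
  rw [← Matrix.det_submatrix_equiv_self E]
  have : (hopping t σ).submatrix E E = Matrix.fromBlocks 0
      (Matrix.of fun x y : {x // p x} => hopping t σ x (y.1 + e 0))
      (Matrix.of fun x y : {x // p x} => hopping t σ x (y.1 + e 0))ᵀ 0 := by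
    have hsymm : ∀ x y, hopping t σ x y = hopping t σ y x := fun x y => by
      have := (hopping_isHermitian t σ).apply x y
      simpa using this.symm
    ext (x | x) (y | y)
    · simp only [Matrix.submatrix_apply, E, splitEquiv_inl, Matrix.fromBlocks_apply₁₁,
        Matrix.zero_apply]
      exact hopping_eq_zero_of_even hL2 t σ (iff_of_true x.2 y.2)
    · simp [E, splitEquiv_inl, splitEquiv_inr]
    · simp [E, splitEquiv_inl, splitEquiv_inr, hsymm]
    · simp only [Matrix.submatrix_apply, E, splitEquiv_inr, Matrix.fromBlocks_apply₂₂,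
        Matrix.zero_apply]
      exact hopping_eq_zero_of_even hL2 t σ (iff_of_false ((hf _).mp x.2) ((hf _).mp y.2))
  rw [this]
  exact det_fromBlocks_offDiag_nonneg hcard _

theorem gaugeZ_nonneg (hL : 4 ∣ L) (s : ℤˣ) {β : ℝ} (hβ : 0 < β) (t : ℝ) (σ : GaugeField L) :
    0 ≤ gaugeZ s β t σ := by
  have h1 : 1 < L := by have := Nat.le_of_dvd (NeZero.pos L) hL; omega
  obtain ⟨c, hc, h | h⟩ := exists_gaugeZ_eq h1 s hβ t σ
  · rw [h]; exact hc.le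
  · rw [h]; exact mul_nonneg hc.le (hopping_det_nonneg hL t σ)

theorem gaugeZ_pos (hL : 4 ∣ L) (s : ℤˣ) {β : ℝ} (hβ : 0 < β) (t : ℝ) {σ : GaugeField L}
    (hdet : (hopping t σ).det ≠ 0) : 0 < gaugeZ s β t σ := by
  have h1 : 1 < L := by have := Nat.le_of_dvd (NeZero.pos L) hL; omega
  obtain ⟨c, hc, h | h⟩ := exists_gaugeZ_eq h1 s hβ t σ
  · rw [h]; exact hc
  · rw [h]; exact mul_pos hc (lt_of_le_of_ne (hopping_det_nonneg hL t σ) hdet.symm)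

theorem gaugeZ_sq_le (hL : 4 ∣ L) (s : ℤˣ) {β : ℝ} (hβ : 0 < β) (t : ℝ) {σ σ₁ σ₂ : GaugeField L}
    (h : ∀ w, resolventDet t σ w ^ 2 ≤ resolventDet t σ₁ w * resolventDet t σ₂ w) :
    gaugeZ s β t σ ^ 2 ≤ gaugeZ s β t σ₁ * gaugeZ s β t σ₂ := by
  have h1 : 1 < L := by have := Nat.le_of_dvd (NeZero.pos L) hL; omega
  have := abs_gaugeZ_sq_le h1 s hβ t h
  rwa [abs_of_nonneg (gaugeZ_nonneg hL s hβ t σ₁), abs_of_nonneg (gaugeZ_nonneg hL s hβ t σ₂)] at this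

/-- The comparison inequality is applied in both directions. Lattice symmetries thereby need to be
checked only for the one-particle matrix, not implemented on Fock space. -/
theorem gaugeZ_congr (hL : 4 ∣ L) (s : ℤˣ) {β : ℝ} (hβ : 0 < β) (t : ℝ) {σ σ' : GaugeField L}
    (h : ∀ w, resolventDet t σ w = resolventDet t σ' w) : gaugeZ s β t σ = gaugeZ s β t σ' := by
  have h1 := gaugeZ_sq_le hL s hβ t (σ := σ) (σ₁ := σ') (σ₂ := σ') fun w => by rw [h w, sq]
  have h2 := gaugeZ_sq_le hL s hβ t (σ := σ') (σ₁ := σ) (σ₂ := σ) fun w => by rw [h w, sq]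
  rw [← sq] at h1 h2
  exact le_antisymm (le_of_sq_le_sq h1 (gaugeZ_nonneg hL s hβ t σ'))
    (le_of_sq_le_sq h2 (gaugeZ_nonneg hL s hβ t σ))

theorem resolventDet_congr (t : ℝ) {σ σ' : GaugeField L} (f : Site L ≃ Site L)
    (h : ∀ x y, hopping t σ' x y = hopping t σ (f x) (f y)) (w : ℝ) :
    resolventDet t σ' w = resolventDet t σ w := by
  rw [resolventDet, resolventDet,
    ← Matrix.det_submatrix_equiv_self f ((hopping t σ).map _ + _)]
  congr 2
  ext x y
  simp [h, Matrix.one_apply]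

end PartitionFunction

/-! ### Gauge transformations, translations, exchange of axes and reflection -/

section Symmetries
set_option linter.unusedSectionVars false
variable {L : ℕ} [NeZero L]

/-- The gauge transformation of a gauge field. -/
def gaugeTransform (g : Site L → ℤˣ) (σ : GaugeField L) : GaugeField L :=
  fun x μ => g x * σ x μ * g (x + e μ)

theorem plaquetteFlux_gaugeTransform (g : Site L → ℤˣ) (σ : GaugeField L) (x : Site L) :
    plaquetteFlux (gaugeTransform g σ) x = plaquetteFlux σ x := by
  have h1 : x - e 0 - e 1 + e 0 = x - e 1 := by abel
  have h2 : x - e 0 - e 1 + e 1 = x - e 0 := by abel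
  simp only [plaquetteFlux, gaugeTransform, h1, h2, sub_add_cancel]
  generalize g (x - e 0 - e 1) = a
  generalize g (x - e 1) = b
  generalize g (x - e 0) = c
  generalize g x = d
  generalize σ (x - e 0 - e 1) 0 = s1
  generalize σ (x - e 1) 1 = s2
  generalize σ (x - e 0) 0 = s3
  generalize σ (x - e 0 - e 1) 1 = s4
  calc a * s1 * b * (b * s2 * d) * (c * s3 * d) * (a * s4 * c)
      = (a * a) * (b * b) * (c * c) * (d * d) * (s1 * s2 * s3 * s4) := by ac_rfl
    _ = _ := by simp only [sq_unit, one_mul]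

theorem horizontalFlux_gaugeTransform (g : Site L → ℤˣ) (σ : GaugeField L) :
    horizontalFlux (gaugeTransform g σ) = horizontalFlux σ := by
  have h : ∏ i : ZMod L, g ((i, 0) + e 0) = ∏ i : ZMod L, g (i, 0) := by
    simpa [e] using Equiv.prod_comp (Equiv.addRight (1 : ZMod L)) fun i => g (i, 0)
  simp only [horizontalFlux, gaugeTransform, Finset.prod_mul_distrib, h]
  rw [mul_right_comm, sq_unit, one_mul]

theorem verticalFlux_gaugeTransform (g : Site L → ℤˣ) (σ : GaugeField L) :
    verticalFlux (gaugeTransform g σ) = verticalFlux σ := by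
  have h : ∏ i : ZMod L, g ((0, i) + e 1) = ∏ i : ZMod L, g (0, i) := by
    simpa [e] using Equiv.prod_comp (Equiv.addRight (1 : ZMod L)) fun i => g (0, i)
  simp only [verticalFlux, gaugeTransform, Finset.prod_mul_distrib, h]
  rw [mul_right_comm, sq_unit, one_mul]

theorem gaugeZ_gaugeTransform (s : ℤˣ) (β t : ℝ) (g : Site L → ℤˣ) (σ : GaugeField L) :
    gaugeZ s β t (gaugeTransform g σ) = gaugeZ s β t σ :=
  gaugeZ_eq_of_hasFluxes s β t ⟨plaquetteFlux_gaugeTransform g σ,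
    horizontalFlux_gaugeTransform g σ, verticalFlux_gaugeTransform g σ⟩ ⟨fun _ => rfl, rfl, rfl⟩

/-- The translate of a gauge field. -/
def translate (v : Site L) (σ : GaugeField L) : GaugeField L := fun x μ => σ (x + v) μ

theorem plaquetteFlux_translate (v : Site L) (σ : GaugeField L) (x : Site L) :
    plaquetteFlux (translate v σ) x = plaquetteFlux σ (x + v) := by
  have h (w : Site L) : x - w + v = x + v - w := by abel
  simp only [plaquetteFlux, translate, sub_sub, h]

theorem hopping_translate (t : ℝ) (v : Site L) (σ : GaugeField L) (x y : Site L) :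
    hopping t (translate v σ) x y = hopping t σ (x + v) (y + v) := by
  have h (x y : Site L) (μ : Fin 2) : x + v + e μ = y + v ↔ x + e μ = y := by
    rw [add_right_comm, add_left_inj]
  simp only [hopping_apply, h, translate]

theorem gaugeZ_translate (hL : 4 ∣ L) (s : ℤˣ) {β : ℝ} (hβ : 0 < β) (t : ℝ) (v : Site L)
    (σ : GaugeField L) : gaugeZ s β t (translate v σ) = gaugeZ s β t σ :=
  gaugeZ_congr hL s hβ t (resolventDet_congr t (Equiv.addRight v) (hopping_translate t v σ))

/-- The gauge field with the two coordinate directions exchanged. -/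
def exchange (σ : GaugeField L) : GaugeField L := fun x μ => σ x.swap (1 - μ)

theorem swap_e (μ : Fin 2) : (e (1 - μ) : Site L) = (e μ).swap := by
  fin_cases μ <;> simp [e]

theorem plaquetteFlux_exchange (σ : GaugeField L) (x : Site L) :
    plaquetteFlux (exchange σ) x = plaquetteFlux σ x.swap := by
  obtain ⟨i, j⟩ := x
  simp only [plaquetteFlux, exchange, e]
  simp
  ac_rfl

theorem hopping_exchange (t : ℝ) (σ : GaugeField L) (x y : Site L) :
    hopping t (exchange σ) x y = hopping t σ x.swap y.swap := by
  have h (x y : Site L) (μ : Fin 2) : x.swap + e (1 - μ) = y.swap ↔ x + e μ = y := by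
    rw [swap_e, ← Prod.swap_add, Prod.swap_inj]
  rw [hopping_apply, hopping_apply, ← Equiv.sum_comp (Equiv.subLeft (1 : Fin 2))]
  congr 1
  conv_rhs => rw [← Equiv.sum_comp (Equiv.subLeft (1 : Fin 2))]
  rw [← Equiv.sum_comp (Equiv.subLeft (1 : Fin 2))]
  simp only [Equiv.subLeft_apply, h, exchange, sub_sub_cancel]

theorem gaugeZ_exchange (hL : 4 ∣ L) (s : ℤˣ) {β : ℝ} (hβ : 0 < β) (t : ℝ)
    (σ : GaugeField L) : gaugeZ s β t (exchange σ) = gaugeZ s β t σ :=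
  gaugeZ_congr hL s hβ t (resolventDet_congr t (Equiv.prodComm _ _) (hopping_exchange t σ))

theorem verticalFlux_exchange (σ : GaugeField L) :
    verticalFlux (exchange σ) = horizontalFlux σ := by
  simp [verticalFlux, horizontalFlux, exchange]

/-- The reflection of the sites through the line between the columns `-1` and `0`. -/
def siteReflection : Site L ≃ Site L :=
  Equiv.prodCongr (Equiv.subLeft (-1)) (Equiv.refl _)

theorem siteReflection_apply (x : Site L) : siteReflection x = (-1 - x.1, x.2) := rfl

/-- The reflected gauge field. -/
def reflect (σ : GaugeField L) : GaugeField L :=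
  fun x μ => if μ = 0 then σ (-2 - x.1, x.2) 0 else σ (siteReflection x) 1

theorem plaquetteFlux_reflect (σ : GaugeField L) (x : Site L) :
    plaquetteFlux (reflect σ) x = plaquetteFlux σ (-x.1, x.2) := by
  obtain ⟨i, j⟩ := x
  have h1 : (-2 - (i - 1) : ZMod L) = -i - 1 := by ring
  have h2 : (-1 - i : ZMod L) = -i - 1 := by ring
  have h3 : (-1 - (i - 1) : ZMod L) = -i := by ring
  simp only [plaquetteFlux, reflect, siteReflection_apply, e]
  simp [h1, h2, h3]
  ac_rfl

theorem hopping_reflect (t : ℝ) (σ : GaugeField L) (x y : Site L) :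
    hopping t (reflect σ) x y = hopping t σ (siteReflection x) (siteReflection y) := by
  have h0 (x y : Site L) : siteReflection y + e 0 = siteReflection x ↔ x + e 0 = y := by
    simp only [siteReflection_apply, e, Prod.ext_iff]
    simp only [if_true, Prod.fst_add, Prod.snd_add, add_zero]
    constructor
    · rintro ⟨h1, h2⟩
      exact ⟨by linear_combination h1, h2.symm⟩
    · rintro ⟨h1, h2⟩
      exact ⟨by linear_combination h1, h2.symm⟩
  have h1 (x y : Site L) : siteReflection x + e 1 = siteReflection y ↔ x + e 1 = y := by
    simp [siteReflection_apply, e, Prod.ext_iff]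
  have h2 (x y : Site L) (h : x + e 0 = y) : reflect σ x 0 = σ (siteReflection y) 0 := by
    subst h
    simp only [reflect, siteReflection_apply, e]
    simp only [if_true, Prod.fst_add, Prod.snd_add, add_zero]
    congr 2
    ring
  simp only [hopping_apply, Fin.sum_univ_two, h0, h1]
  rw [add_comm (ite (y + e 0 = x) ((σ (siteReflection x) 0 : ℤ) : ℝ) 0)]
  congr 3
  · by_cases h : x + e 0 = y
    · rw [if_pos h, if_pos h, h2 x y h]
    · rw [if_neg h, if_neg h]
  · by_cases h : y + e 0 = x
    · rw [if_pos h, if_pos h, h2 y x h]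
    · rw [if_neg h, if_neg h]

theorem hopping_eq_mul (t : ℝ) {σ τ : GaugeField L} (u : ℤˣ) {x y : Site L}
    (hxy : ∀ μ, x + e μ = y → τ x μ = u * σ x μ) (hyx : ∀ μ, y + e μ = x → τ y μ = u * σ y μ) :
    hopping t τ x y = (((u : ℤˣ) : ℤ) : ℝ) * hopping t σ x y := by
  rw [hopping_apply, hopping_apply, mul_left_comm]
  refine congrArg (-t * ·) ?_
  rw [Finset.mul_sum]
  refine Finset.sum_congr rfl fun μ _ => ?_
  rw [mul_add]
  congr 1
  · split_ifs with h
    · rw [hxy μ h]; push_cast; ring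
    · simp
  · split_ifs with h
    · rw [hyx μ h]; push_cast; ring
    · simp

end Symmetries

section Val
variable {L : ℕ} [NeZero L]

theorem val_neg_one_sub (i : ZMod L) : (-1 - i).val = L - 1 - i.val := by
  have hi := ZMod.val_lt i
  have h : (-1 - i : ZMod L) = ((L - 1 - i.val : ℕ) : ZMod L) := by
    rw [Nat.cast_sub (by omega), Nat.cast_sub (by omega)]
    simp
  rw [h, ZMod.val_cast_of_lt (by omega)]

end Val

/-! ### Folding along the reflection lines and reflection positivity -/

section Fold
set_option linter.unusedSectionVars false
variable {L : ℕ} [NeZero L] {ℓ : ℕ}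

/-- The spins on the bonds cut by the reflection lines are `-1`. -/
def IsCut (ℓ : ℕ) (σ : GaugeField L) : Prop :=
  ∀ x : Site L, x.1.val + 1 = 2 * ℓ ∨ x.1.val + 1 = L → σ x 0 = -1

/-- The left half of `σ` together with the negative of its mirror image. -/
def fold (ℓ : ℕ) (σ : GaugeField L) : GaugeField L := fun x μ =>
  if μ = 0 then
    if x.1.val + 1 = 2 * ℓ ∨ x.1.val + 1 = L then -1
    else if x.1.val < 2 * ℓ then σ x 0 else -reflect σ x 0
  else if x.1.val < 2 * ℓ then σ x 1 else -reflect σ x 1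

theorem isCut_fold (σ : GaugeField L) : IsCut ℓ (fold ℓ σ) := fun x hx => by
  simp [fold, hx]

theorem val_neg_two_sub {i : ZMod L} (hi : i.val + 1 ≠ L) : (-2 - i).val = L - 2 - i.val := by
  rcases val_succ i with ⟨-, h⟩ | ⟨-, h⟩
  · exact absurd h hi
  · rw [show (-2 - i : ZMod L) = -1 - (i + 1) by ring, val_neg_one_sub, h]
    omega

/-- The equivalence of the lattice with two copies of its left half. -/
def halfEquiv (hL : L = 4 * ℓ) :
    {x : Site L // x.1.val < 2 * ℓ} ⊕ {x : Site L // x.1.val < 2 * ℓ} ≃ Site L :=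
  splitEquiv (fun x : Site L => x.1.val < 2 * ℓ) siteReflection fun x => by
    have := ZMod.val_lt x.1
    rw [siteReflection_apply, val_neg_one_sub]
    omega

theorem reflect_reflect (σ : GaugeField L) : reflect (reflect σ) = σ := by
  funext x μ
  fin_cases μ <;> simp [reflect, siteReflection_apply]

theorem val_eq_of_add_e {x y : Site L} (h : x + e 0 = y) :
    (y.1.val = 0 ∧ x.1.val + 1 = L) ∨ y.1.val = x.1.val + 1 := by
  subst h
  have : (x + e 0).1 = x.1 + 1 := by simp [e]
  rw [this]
  rcases val_succ x.1 with ⟨h0, h⟩ | ⟨-, h⟩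
  · left; rw [h0]; exact ⟨ZMod.val_zero, h⟩
  · right; exact h

theorem fst_add_e_one (x : Site L) : (x + e 1).1 = x.1 := by simp [e]

theorem hopping_fold_left (t : ℝ) (σ : GaugeField L) {x y : Site L}
    (hx : x.1.val < 2 * ℓ) (hy : y.1.val < 2 * ℓ) (hL : L = 4 * ℓ) :
    hopping t (fold ℓ σ) x y = hopping t σ x y := by
  have key : ∀ {x y : Site L}, x.1.val < 2 * ℓ → y.1.val < 2 * ℓ → ∀ μ, x + e μ = y →
      fold ℓ σ x μ = 1 * σ x μ := by
    intro x y hx hy μ h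
    rw [one_mul, fold]
    fin_cases μ
    · have := val_eq_of_add_e h
      simp only [Fin.zero_eta, if_true]
      rw [if_neg (by omega), if_pos hx]
    · simp [hx]
  rw [hopping_eq_mul t 1 (key hx hy) (key hy hx)]
  simp

/-- This is why `fold` negates the mirror image: for the left block `X = h + iω` one has `-Xᴴ = -h +
iω`, which is then the right block of the folded field at the same frequency. -/
theorem hopping_fold_right (t : ℝ) (σ : GaugeField L) {x y : Site L}
    (hx : x.1.val < 2 * ℓ) (hy : y.1.val < 2 * ℓ) (hL : L = 4 * ℓ) :
    hopping t (fold ℓ σ) (siteReflection x) (siteReflection y) = -hopping t σ x y := by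
  rw [← hopping_reflect]
  have key : ∀ {x y : Site L}, x.1.val < 2 * ℓ → y.1.val < 2 * ℓ → ∀ μ, x + e μ = y →
      reflect (fold ℓ σ) x μ = -1 * σ x μ := by
    intro x y hx hy μ h
    have hσ := congrFun (congrFun (reflect_reflect σ) x) μ
    fin_cases μ
    · have h1 := val_eq_of_add_e h
      have h2 : (-2 - x.1).val = L - 2 - x.1.val := val_neg_two_sub (by omega)
      simp only [Fin.zero_eta] at hσ ⊢
      rw [← hσ, neg_one_mul]
      simp only [reflect, if_true, fold, h2]
      rw [if_neg (by omega), if_neg (by omega)]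
    · have h2 : (-1 - x.1).val = L - 1 - x.1.val := val_neg_one_sub _
      simp only [Fin.mk_one] at hσ ⊢
      rw [← hσ, neg_one_mul]
      simp only [reflect, one_ne_zero, if_false, fold, siteReflection_apply, h2]
      rw [if_neg (by omega)]
  rw [hopping_eq_mul t (-1) (key hx hy) (key hy hx)]
  simp

/-- A cut bond joins a site to its own mirror image, and the spin `-1` turns its amplitude `-t` into
`t`. The coupling of the halves is therefore diagonal and, for `t > 0`, nonnegative. -/
theorem hopping_cut (t : ℝ) {σ : GaugeField L} (hσ : IsCut ℓ σ) {x y : Site L}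
    (hx : x.1.val < 2 * ℓ) (hy : y.1.val < 2 * ℓ) (hL : L = 4 * ℓ) :
    hopping t σ x (siteReflection y) =
      if x = y then (if x.1.val + 1 = 2 * ℓ then t else 0) + (if x.1.val = 0 then t else 0)
      else 0 := by
  have hv : (siteReflection y).1.val = L - 1 - y.1.val := val_neg_one_sub y.1
  have hne : x + e 1 ≠ siteReflection y := fun h => by
    have := congrArg (fun z : Site L => z.1.val) h
    simp only [fst_add_e_one] at this
    omega
  have hne' : siteReflection y + e 1 ≠ x := fun h => by
    have := congrArg (fun z : Site L => z.1.val) h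
    simp only [fst_add_e_one] at this
    omega
  have h1 : x + e 0 = siteReflection y ↔ x = y ∧ x.1.val + 1 = 2 * ℓ := by
    constructor
    · intro h
      have h1 := val_eq_of_add_e h
      have h2 : x.2 = y.2 := by simpa [e, siteReflection_apply] using congrArg Prod.snd h
      exact ⟨Prod.ext (ZMod.val_injective L (by omega)) h2, by omega⟩
    · rintro ⟨rfl, h⟩
      refine Prod.ext (ZMod.val_injective L ?_) (by simp [e, siteReflection_apply])
      rw [hv]
      have := val_eq_of_add_e (rfl : x + e 0 = x + e 0)
      omega
  have h2 : siteReflection y + e 0 = x ↔ x = y ∧ x.1.val = 0 := by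
    constructor
    · intro h
      have h1 := val_eq_of_add_e h
      have h2 : y.2 = x.2 := by simpa [e, siteReflection_apply] using congrArg Prod.snd h
      exact ⟨Prod.ext (ZMod.val_injective L (by omega)) h2.symm, by omega⟩
    · rintro ⟨rfl, h⟩
      refine Prod.ext (ZMod.val_injective L ?_) (by simp [e, siteReflection_apply])
      have := val_eq_of_add_e (rfl : siteReflection x + e 0 = _)
      have := ZMod.val_lt (siteReflection x + e 0).1
      omega
  rw [hopping_apply, Fin.sum_univ_two, if_neg hne, if_neg hne']
  by_cases hxy : x = y
  · subst hxy
    simp only [h1, h2, true_and, if_true]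
    have e1 : (if x.1.val + 1 = 2 * ℓ then (((σ x 0 : ℤˣ) : ℤ) : ℝ) else 0) =
        if x.1.val + 1 = 2 * ℓ then -1 else 0 := by
      split_ifs with h
      · rw [hσ x (Or.inl h)]; simp
      · rfl
    have e2 : (if x.1.val = 0 then (((σ (siteReflection x) 0 : ℤˣ) : ℤ) : ℝ) else 0) =
        if x.1.val = 0 then -1 else 0 := by
      split_ifs with h
      · rw [hσ (siteReflection x) (Or.inr (by omega))]; simp
      · rfl
    rw [e1, e2]
    split_ifs <;> ring
  · simp [h1, h2, hxy]

theorem hopping_symm (t : ℝ) (σ : GaugeField L) (x y : Site L) :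
    hopping t σ x y = hopping t σ y x := by
  have := (hopping_isHermitian t σ).apply x y
  simpa using this.symm

/-- The block form of the resolvent determinant with respect to the reflection. -/
theorem resolventDet_eq_fromBlocks (t : ℝ) {σ : GaugeField L} (hσ : IsCut ℓ σ) (hL : L = 4 * ℓ)
    (w : ℝ) :
    resolventDet t σ w = ‖(Matrix.fromBlocks
      (Matrix.of fun x y : {x : Site L // x.1.val < 2 * ℓ} =>
        (hopping t σ x y : ℂ) + if x = y then w * Complex.I else 0)
      (Matrix.diagonal fun x : {x : Site L // x.1.val < 2 * ℓ} =>
        (((if x.1.1.val + 1 = 2 * ℓ then t else 0) + (if x.1.1.val = 0 then t else 0) : ℝ) : ℂ))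
      (Matrix.diagonal fun x : {x : Site L // x.1.val < 2 * ℓ} =>
        (((if x.1.1.val + 1 = 2 * ℓ then t else 0) + (if x.1.1.val = 0 then t else 0) : ℝ) : ℂ))
      (Matrix.of fun x y : {x : Site L // x.1.val < 2 * ℓ} =>
        (hopping t σ (siteReflection x) (siteReflection y) : ℂ) +
          if x = y then w * Complex.I else 0)).det‖ := by
  have hne : ∀ x y : {x : Site L // x.1.val < 2 * ℓ}, (x : Site L) ≠ siteReflection y := by
    intro x y h
    have h1 := congrArg (fun z : Site L => z.1.val) h
    have hv : (siteReflection y.1).1.val = L - 1 - y.1.1.val := val_neg_one_sub y.1.1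
    have := x.2
    have := y.2
    omega
  have hdiag : ∀ x y : {x : Site L // x.1.val < 2 * ℓ}, (hopping t σ x (siteReflection y) : ℂ) =
      Matrix.diagonal (fun x : {x : Site L // x.1.val < 2 * ℓ} =>
        (((if x.1.1.val + 1 = 2 * ℓ then t else 0) + (if x.1.1.val = 0 then t else 0) : ℝ) : ℂ))
        x y := by
    intro x y
    rw [hopping_cut t hσ x.2 y.2 hL, Matrix.diagonal_apply]
    by_cases h : x = y
    · subst h; simp
    · rw [if_neg (fun h' => h (Subtype.ext h')), if_neg h, Complex.ofReal_zero]
  rw [resolventDet, ← Matrix.det_submatrix_equiv_self (halfEquiv hL)]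
  congr 2
  ext (x | x) (y | y)
  · simp [halfEquiv, splitEquiv_inl, Matrix.one_apply, Subtype.ext_iff]
  · simp only [halfEquiv, Matrix.submatrix_apply, splitEquiv_inl, splitEquiv_inr,
      Matrix.fromBlocks_apply₁₂, ← hdiag, Matrix.add_apply, Matrix.smul_apply,
      Matrix.one_apply_ne (hne x y), smul_zero, add_zero]
    rfl
  · rw [Matrix.fromBlocks_apply₂₁, ← Matrix.diagonal_transpose, Matrix.transpose_apply, ← hdiag]
    simp only [halfEquiv, Matrix.submatrix_apply, splitEquiv_inl, splitEquiv_inr,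
      Matrix.add_apply, Matrix.smul_apply, Matrix.one_apply_ne (hne y x).symm, smul_zero, add_zero]
    rw [hopping_symm]
    rfl
  · simp [halfEquiv, splitEquiv_inr, Matrix.one_apply, Subtype.ext_iff]

/-- Apply `reflection_det` to the left block of `σ` and to its right block pulled back by the
reflection, which is the left block of `reflect σ`. Each mirrored determinant is then that of a
folded field. -/
theorem resolventDet_fold (hL : L = 4 * ℓ) {t : ℝ} (ht : 0 < t) {σ : GaugeField L}
    (hσ : IsCut ℓ σ) (w : ℝ) :
    resolventDet t σ w ^ 2 ≤
      resolventDet t (fold ℓ σ) w * resolventDet t (fold ℓ (reflect σ)) w := by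
  have hblock : ∀ (τ : GaugeField L) (x y : {x : Site L // x.1.val < 2 * ℓ}),
      (-(Matrix.of fun x y : {x : Site L // x.1.val < 2 * ℓ} =>
        (hopping t τ x y : ℂ) + if x = y then w * Complex.I else 0)ᴴ) x y =
      (hopping t (fold ℓ τ) (siteReflection x) (siteReflection y) : ℂ) +
          if x = y then w * Complex.I else 0 := by
    intro τ x y
    rw [hopping_fold_right t τ x.2 y.2 hL, hopping_symm]
    by_cases h : x = y
    · subst h; simp [add_comm]
    · simp [h, Ne.symm h]
  have hblock' : ∀ τ : GaugeField L, (-(Matrix.of fun x y : {x : Site L // x.1.val < 2 * ℓ} =>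
        (hopping t τ x y : ℂ) + if x = y then w * Complex.I else 0)ᴴ) =
      Matrix.of fun x y : {x : Site L // x.1.val < 2 * ℓ} =>
        (hopping t (fold ℓ τ) (siteReflection x) (siteReflection y) : ℂ) +
          if x = y then w * Complex.I else 0 := fun τ => by
    ext x y
    exact hblock τ x y
  have h := reflection_det
    (Matrix.of fun x y : {x : Site L // x.1.val < 2 * ℓ} =>
        (hopping t σ x y : ℂ) + if x = y then w * Complex.I else 0)
    (Matrix.of fun x y : {x : Site L // x.1.val < 2 * ℓ} =>
        (hopping t (reflect σ) x y : ℂ) + if x = y then w * Complex.I else 0)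
    (d := fun x => (if x.1.1.val + 1 = 2 * ℓ then t else 0) + (if x.1.1.val = 0 then t else 0))
    (fun x => by split_ifs <;> linarith)
  rw [hblock', hblock'] at h
  rw [resolventDet_eq_fromBlocks t hσ hL, resolventDet_eq_fromBlocks t (isCut_fold σ) hL,
    resolventDet_eq_fromBlocks t (isCut_fold (reflect σ)) hL]
  have e1 : ∀ (τ : GaugeField L) (x y : {x : Site L // x.1.val < 2 * ℓ}),
      hopping t (fold ℓ τ) x y = hopping t τ x y := fun τ x y =>
    hopping_fold_left t τ x.2 y.2 hL
  simp only [e1, ← hopping_reflect t σ]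
  exact h

/-- The flux configuration of the folded gauge field. -/
def foldFlux (ℓ : ℕ) (Φ : Site L → ℤˣ) : Site L → ℤˣ := fun x =>
  if x.1.val = 0 ∨ x.1.val = 2 * ℓ then -1 else if x.1.val < 2 * ℓ then Φ x else Φ (-x.1, x.2)

/-- In a bisected plaquette the two cut spins cancel and the vertical spins are opposite, which
forces flux π. In a mirrored plaquette the four sign changes cancel. -/
theorem plaquetteFlux_fold (hL : L = 4 * ℓ) (σ : GaugeField L) :
    plaquetteFlux (fold ℓ σ) = foldFlux ℓ (plaquetteFlux σ) := by
  funext ⟨i', j'⟩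
  obtain ⟨i, rfl⟩ : ∃ i, i' = i + 1 := ⟨i' - 1, by simp⟩
  obtain ⟨j, rfl⟩ : ∃ j, j' = j + 1 := ⟨j' - 1, by simp⟩
  have hi := ZMod.val_lt i
  have hℓ : 0 < ℓ := by have := NeZero.pos L; omega
  have h4 : ∀ a b : ℤˣ, -1 * a * -1 * (-b) = -(a * b) := by decide
  have h5 : ∀ a b : ℤˣ, -1 * (-a) * -1 * b = -(a * b) := by decide
  rw [plaquetteFlux_shift]
  rcases val_succ i with ⟨h0, h⟩ | ⟨h0, h⟩
  · simp only [fold, foldFlux, h, h0, if_true, or_true, ZMod.val_zero, one_ne_zero, if_false,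
      true_or]
    rw [if_pos (by omega), if_neg (by omega)]
    have h1 : (-1 - i : ZMod L) = 0 := by linear_combination -h0
    simp only [reflect, one_ne_zero, if_false, siteReflection_apply, h1, h4, sq_unit]
  · by_cases h1 : i.val + 1 = 2 * ℓ
    · simp only [fold, foldFlux, h, h1, if_true, true_or, or_true, one_ne_zero, if_false, lt_irrefl]
      rw [if_pos (by omega)]
      have h2 : (-1 - (i + 1) : ZMod L) = i := ZMod.val_injective L (by
        rw [val_neg_one_sub, h]; omega)
      simp only [reflect, one_ne_zero, if_false, siteReflection_apply, h2, h5, sq_unit]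
    · have hiL : i.val + 1 ≠ L := by have := ZMod.val_lt (i + 1); omega
      simp only [fold, foldFlux, h, h1, hiL, if_true, or_self, one_ne_zero, if_false,
        Nat.add_eq_zero_iff, and_false]
      by_cases h2 : i.val < 2 * ℓ
      · rw [if_pos h2, if_pos (by omega), if_pos h2, if_pos h2, if_pos (by omega),
          plaquetteFlux_shift]
      · rw [if_neg h2, if_neg (by omega), if_neg h2, if_neg h2, if_neg (by omega)]
        rw [← plaquetteFlux_reflect σ (i + 1, j + 1), plaquetteFlux_shift]
        generalize reflect σ (i, j) 0 = a
        generalize reflect σ (i + 1, j) 1 = b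
        generalize reflect σ (i, j + 1) 0 = c
        generalize reflect σ (i, j) 1 = d
        revert a b c d
        decide

theorem verticalFlux_fold (hL : L = 4 * ℓ) (σ : GaugeField L) :
    verticalFlux (fold ℓ σ) = verticalFlux σ := by
  have hℓ : 0 < ℓ := by have := NeZero.pos L; omega
  unfold verticalFlux
  refine Finset.prod_congr rfl fun j _ => ?_
  simp [fold, hℓ]

/-- The row has `2ℓ - 1` uncut bonds in each half, an odd number. Negating the mirrored ones leaves
a single minus sign, and the two cut spins cancel. -/
theorem horizontalFlux_fold (hL : L = 4 * ℓ) (σ : GaugeField L) :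
    horizontalFlux (fold ℓ σ) = -1 := by
  obtain ⟨m, rfl⟩ : ∃ m, ℓ = m + 1 := ⟨ℓ - 1, by have := NeZero.pos L; omega⟩
  set g : ℕ → ℤˣ := fun k => fold (m + 1) σ ((k : ZMod L), 0) 0 with hg
  have hval : ∀ k, k < L → ((k : ZMod L)).val = k := fun k hk => ZMod.val_cast_of_lt hk
  have h1 : g (2 * m + 1) = -1 := by
    simp only [hg, fold, if_true]
    rw [hval _ (by omega), if_pos (by omega)]
  have h2 : g (2 * m + 2 + (2 * m + 1)) = -1 := by
    simp only [hg, fold, if_true]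
    rw [hval _ (by omega), if_pos (by omega)]
  have h3 : ∀ k ∈ Finset.range (2 * m + 1), g (2 * m + 2 + (2 * m + 1 - 1 - k)) = -g k := by
    intro k hk
    have hk : k < 2 * m + 1 := by simpa using hk
    simp only [hg, fold, if_true]
    rw [hval _ (by omega), hval _ (by omega), if_neg (by omega), if_neg (by omega),
      if_neg (by omega), if_pos (by omega), reflect, if_pos rfl]
    have : (-2 - ((2 * m + 2 + (2 * m + 1 - 1 - k) : ℕ) : ZMod L) : ZMod L) = k := by
      have e1 : (((2 * m + 2 + (2 * m + 1 - 1 - k)) + k + 2 : ℕ) : ZMod L) = 0 := by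
        rw [show (2 * m + 2 + (2 * m + 1 - 1 - k)) + k + 2 = L by omega]; simp
      push_cast at e1 ⊢
      linear_combination -e1
    simp only [this]
  rw [horizontalFlux, prod_univ_eq]
  change ∏ k ∈ Finset.range L, g k = -1
  rw [show L = (2 * m + 2) + (2 * m + 1 + 1) by omega, Finset.prod_range_add,
    Finset.prod_range_succ g (2 * m + 1),
    Finset.prod_range_succ (fun k => g (2 * m + 2 + k)) (2 * m + 1), h1, h2,
    ← Finset.prod_range_reflect (fun k => g (2 * m + 2 + k)), Finset.prod_congr rfl h3,
    Finset.prod_neg]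
  generalize ∏ x ∈ Finset.range (2 * m + 1), g x = p
  rw [Finset.card_range, pow_succ, pow_mul, neg_one_sq, one_pow]
  revert p
  decide

/-- Every gauge field can be brought into the gauge in which the cut bonds carry `-1`. -/
theorem exists_isCut (hL : L = 4 * ℓ) (σ : GaugeField L) :
    ∃ g, IsCut ℓ (gaugeTransform g σ) := by
  have hℓ : 0 < ℓ := by have := NeZero.pos L; omega
  -- Each cut bond has exactly one end in the columns `2ℓ` and `L - 1`, so it is corrected there
  -- without affecting the other cut.
  refine ⟨fun x => if x.1.val = 2 * ℓ then -σ (x - e 0) 0 else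
    if x.1.val + 1 = L then -σ x 0 else 1, fun x hx => ?_⟩
  have h := val_eq_of_add_e (rfl : x + e 0 = x + e 0)
  have hlt := ZMod.val_lt (x + e 0).1
  simp only [gaugeTransform, add_sub_cancel_right]
  rcases hx with hx | hx
  · rw [if_neg (by omega), if_neg (by omega), if_pos (by omega), one_mul, mul_neg, sq_unit]
  · rw [if_neg (by omega), if_pos (by omega), if_neg (by omega), if_neg (by omega), mul_one,
      neg_mul, sq_unit]

/-- Reflection positivity of the partition functions. -/
theorem exists_reflections (hL : L = 4 * ℓ) (s : ℤˣ) {t β : ℝ} (ht : 0 < t) (hβ : 0 < β)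
    (σ : GaugeField L) :
    ∃ σ₁ σ₂ : GaugeField L, gaugeZ s β t σ ^ 2 ≤ gaugeZ s β t σ₁ * gaugeZ s β t σ₂ ∧
      plaquetteFlux σ₁ = foldFlux ℓ (plaquetteFlux σ) ∧
      plaquetteFlux σ₂ = foldFlux ℓ (fun x => plaquetteFlux σ (-x.1, x.2)) ∧
      horizontalFlux σ₁ = -1 ∧ verticalFlux σ₁ = verticalFlux σ := by
  obtain ⟨g, hg⟩ := exists_isCut hL σ
  have hflux : plaquetteFlux (gaugeTransform g σ) = plaquetteFlux σ :=
    funext fun x => plaquetteFlux_gaugeTransform g σ x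
  refine ⟨fold ℓ (gaugeTransform g σ), fold ℓ (reflect (gaugeTransform g σ)), ?_, ?_, ?_, ?_, ?_⟩
  · rw [← gaugeZ_gaugeTransform s β t g σ]
    exact gaugeZ_sq_le ⟨ℓ, hL⟩ s hβ t (resolventDet_fold hL ht hg)
  · rw [plaquetteFlux_fold hL, hflux]
  · rw [plaquetteFlux_fold hL]
    congr 1
    funext x
    rw [plaquetteFlux_reflect, hflux]
  · exact horizontalFlux_fold hL _
  · rw [verticalFlux_fold hL, verticalFlux_gaugeTransform]

end Fold

/-! ### Combinatorics of folded flux configurations -/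

section Counts
set_option linter.unusedSectionVars false
variable {L : ℕ} [NeZero L] {ℓ : ℕ}

theorem val_add_mod_two (hL : Even L) (i c : ZMod L) : (i + c).val % 2 = (i.val + c.val) % 2 := by
  rw [ZMod.val_add, Nat.mod_mod_of_dvd _ hL.two_dvd]

theorem even_val_neg (hL : Even L) (i : ZMod L) : Even (-i).val ↔ Even i.val := by
  have := val_add_mod_two hL i (-i)
  rw [add_neg_cancel, ZMod.val_zero] at this
  rw [Nat.even_iff, Nat.even_iff]
  omega

theorem even_val_sub_one (hL : Even L) (i : ZMod L) : Even (i - 1).val ↔ ¬Even i.val := by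
  have := even_val_add_one hL (i - 1)
  rw [sub_add_cancel] at this
  tauto

/-- The plaquettes both of whose coordinates are odd. -/
def IsOddOdd (x : Site L) : Prop := Odd x.1.val ∧ Odd x.2.val

instance : DecidablePred (IsOddOdd (L := L)) := fun x => by unfold IsOddOdd; infer_instance

/-- The number of plaquettes with flux `0` and odd coordinates. -/
def oddOddCount (Φ : Site L → ℤˣ) : ℕ := ∑ x, if IsOddOdd x ∧ Φ x = 1 then 1 else 0

/-- The coordinate `μ` of a site. -/
def coord (μ : Fin 2) (x : Site L) : ZMod L := if μ = 0 then x.1 else x.2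

/-- The plaquette `x` looks like a plaquette bisected by a reflection line normal to `e μ`. -/
def IsGood (μ : Fin 2) (Φ : Site L → ℤˣ) (x : Site L) : Prop :=
  Even (coord μ x).val ∧ Φ x = -1 ∧ Φ (x - e μ) = Φ (x + e μ)

instance (μ : Fin 2) (Φ : Site L → ℤˣ) : DecidablePred (IsGood μ Φ) := fun x => by
  unfold IsGood; infer_instance

/-- The number of good plaquettes, in both directions. -/
def goodCount (Φ : Site L → ℤˣ) : ℕ := ∑ μ : Fin 2, ∑ x, if IsGood μ Φ x then 1 else 0

/-- The mirror image of a plaquette. -/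
def mirror : Site L ≃ Site L := Equiv.prodCongr (Equiv.neg _) (Equiv.refl _)

theorem mirror_apply (x : Site L) : mirror x = (-x.1, x.2) := rfl

theorem mirror_mirror (x : Site L) : mirror (mirror x) = x := by simp [mirror_apply]

theorem foldFlux_line (Φ : Site L → ℤˣ) {x : Site L} (hx : x.1.val = 0 ∨ x.1.val = 2 * ℓ) :
    foldFlux ℓ Φ x = -1 := by rw [foldFlux, if_pos hx]

theorem foldFlux_left (Φ : Site L → ℤˣ) {x : Site L} (h0 : 0 < x.1.val) (hx : x.1.val < 2 * ℓ) :
    foldFlux ℓ Φ x = Φ x := by rw [foldFlux, if_neg (by omega), if_pos hx]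

theorem foldFlux_right (Φ : Site L → ℤˣ) {x : Site L} (hx : 2 * ℓ < x.1.val) :
    foldFlux ℓ Φ x = Φ (mirror x) := by
  rw [foldFlux, if_neg (by omega), if_neg (by omega), mirror_apply]

theorem isOddOdd_mirror (hL : Even L) (x : Site L) : IsOddOdd (mirror x) ↔ IsOddOdd x := by
  simp only [IsOddOdd, mirror_apply, ← Nat.not_even_iff_odd, even_val_neg hL]

/-- The reflection lines run through even columns, so folding never overwrites a plaquette in an odd
column; each half is kept by one folding and reproduced in its mirror image. -/
theorem oddOddCount_fold (hL : L = 4 * ℓ) (Φ : Site L → ℤˣ) :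
    oddOddCount (foldFlux ℓ Φ) + oddOddCount (foldFlux ℓ (Φ ∘ mirror)) = 2 * oddOddCount Φ := by
  have hE : Even L := ⟨2 * ℓ, by omega⟩
  have h1 : oddOddCount Φ = ∑ x : Site L, if IsOddOdd x ∧ Φ (mirror x) = 1 then 1 else 0 := by
    rw [oddOddCount, ← Equiv.sum_comp mirror]
    simp only [isOddOdd_mirror hE]
  rw [two_mul]
  conv_rhs => rw [h1]; arg 1; rw [← h1]
  rw [oddOddCount, oddOddCount, oddOddCount, ← Finset.sum_add_distrib, ← Finset.sum_add_distrib]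
  refine Finset.sum_congr rfl fun x _ => ?_
  by_cases hx : IsOddOdd x
  · have hx1 := Nat.odd_iff.mp hx.1
    rcases lt_or_ge x.1.val (2 * ℓ) with h | h
    · rw [foldFlux_left _ (by omega) h, foldFlux_left _ (by omega) h]; rfl
    · rw [foldFlux_right _ (by omega), foldFlux_right _ (by omega), add_comm,
        Function.comp_apply, mirror_mirror]
  · simp [hx]

theorem val_sub_e {x : Site L} : (x.1.val = 0 ∧ (x - e 0).1.val + 1 = L) ∨
    x.1.val = (x - e 0).1.val + 1 := val_eq_of_add_e (sub_add_cancel x (e 0))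

theorem val_add_e {x : Site L} : ((x + e 0).1.val = 0 ∧ x.1.val + 1 = L) ∨
    (x + e 0).1.val = x.1.val + 1 := val_eq_of_add_e rfl

theorem fst_sub_e_one (x : Site L) : (x - e 1).1 = x.1 := by simp [e]

theorem even_coord_mirror (hL : Even L) (μ : Fin 2) (x : Site L) :
    Even (coord μ (mirror x)).val ↔ Even (coord μ x).val := by
  unfold coord
  split_ifs
  · exact even_val_neg hL _
  · rfl

theorem isGood_mirror (hL : Even L) (μ : Fin 2) (Φ : Site L → ℤˣ) (x : Site L) :
    IsGood μ (Φ ∘ mirror) x ↔ IsGood μ Φ (mirror x) := by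
  unfold IsGood
  rw [even_coord_mirror hL]
  simp only [Function.comp_apply]
  fin_cases μ
  · have h1 : mirror (x - e 0) = mirror x + e 0 := by
      simp [mirror_apply, e, Prod.ext_iff]; ring
    have h2 : mirror (x + e 0) = mirror x - e 0 := by
      simp [mirror_apply, e, Prod.ext_iff]; ring
    simp only [Fin.zero_eta, h1, h2, eq_comm]
  · have h1 : mirror (x - e 1) = mirror x - e 1 := by simp [mirror_apply, e]
    have h2 : mirror (x + e 1) = mirror x + e 1 := by simp [mirror_apply, e]
    simp only [Fin.mk_one, h1, h2]

/-- On a line, the neighbours along `e 0` are mirror images of each other, and the neighbours along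
`e 1` lie on the same line and both carry flux π. -/
theorem isGood_foldFlux_line (hL : L = 4 * ℓ) (μ : Fin 2) (Φ : Site L → ℤˣ) {x : Site L}
    (hx : x.1.val = 0 ∨ x.1.val = 2 * ℓ) (hμ : Even (coord μ x).val) :
    IsGood μ (foldFlux ℓ Φ) x := by
  have hℓ : 0 < ℓ := by have := NeZero.pos L; omega
  refine ⟨hμ, foldFlux_line Φ hx, ?_⟩
  fin_cases μ
  · simp only [Fin.zero_eta]
    have h1 := val_sub_e (x := x)
    have h2 := val_add_e (x := x)
    have h2x : x.1 + x.1 = 0 := by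
      rw [← ZMod.natCast_zmod_val x.1, ← Nat.cast_add]
      rcases hx with hx | hx
      · rw [hx]; simp
      · rw [hx, show 2 * ℓ + 2 * ℓ = L by omega]; simp
    rcases hx with hx | hx
    · rw [foldFlux_right _ (x := x - e 0) (by omega), foldFlux_left _ (x := x + e 0) (by omega)
        (by omega)]
      congr 1
      simp [mirror_apply, e, Prod.ext_iff]
      linear_combination -h2x
    · rw [foldFlux_left _ (x := x - e 0) (by omega) (by omega),
        foldFlux_right _ (x := x + e 0) (by omega)]
      congr 1
      simp [mirror_apply, e, Prod.ext_iff]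
      linear_combination h2x
  · simp only [Fin.mk_one]
    rw [foldFlux_line _ (x := x - e 1) (by rwa [fst_sub_e_one]),
      foldFlux_line _ (x := x + e 1) (by rwa [fst_add_e_one])]

/-- For an even column strictly between the lines, both adjacent columns are still strictly between
them. The parity condition in `IsGood` thus keeps the comparison of neighbours away from the
overwritten plaquettes. -/
theorem isGood_foldFlux_left (hL : L = 4 * ℓ) (μ : Fin 2) (Φ : Site L → ℤˣ) {x : Site L}
    (h0 : 0 < x.1.val) (hx : x.1.val < 2 * ℓ) : IsGood μ (foldFlux ℓ Φ) x ↔ IsGood μ Φ x := by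
  refine and_congr_right fun hμ => ?_
  rw [foldFlux_left Φ h0 hx]
  fin_cases μ
  · have hμ' := Nat.even_iff.mp hμ
    simp only [coord, Fin.zero_eta, if_true] at hμ' ⊢
    have h1 := val_sub_e (x := x)
    have h2 := val_add_e (x := x)
    rw [foldFlux_left _ (x := x - e 0) (by omega) (by omega),
      foldFlux_left _ (x := x + e 0) (by omega) (by omega)]
  · simp only [Fin.mk_one]
    rw [foldFlux_left _ (x := x - e 1) (by rwa [fst_sub_e_one]) (by rwa [fst_sub_e_one]),
      foldFlux_left _ (x := x + e 1) (by rwa [fst_add_e_one]) (by rwa [fst_add_e_one])]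

theorem isGood_foldFlux_right (hL : L = 4 * ℓ) (μ : Fin 2) (Φ : Site L → ℤˣ) {x : Site L}
    (hx : 2 * ℓ < x.1.val) : IsGood μ (foldFlux ℓ Φ) x ↔ IsGood μ Φ (mirror x) := by
  rw [← isGood_mirror ⟨2 * ℓ, by omega⟩]
  refine and_congr_right fun hμ => ?_
  rw [foldFlux_right Φ hx]
  fin_cases μ
  · have hμ' := Nat.even_iff.mp hμ
    have hlt := ZMod.val_lt x.1
    simp only [coord, Fin.zero_eta, if_true] at hμ' ⊢
    have h1 := val_sub_e (x := x)
    have h2 := val_add_e (x := x)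
    rw [foldFlux_right _ (x := x - e 0) (by omega), foldFlux_right _ (x := x + e 0) (by omega)]
    rfl
  · simp only [Fin.mk_one]
    rw [foldFlux_right _ (x := x - e 1) (by rwa [fst_sub_e_one]),
      foldFlux_right _ (x := x + e 1) (by rwa [fst_add_e_one])]
    rfl

/-- Off the lines the two foldings at `x` reproduce the plaquettes `x` and `mirror x`; on the lines
every candidate becomes good, so nothing is lost. -/
theorem isGood_foldFlux_add (hL : L = 4 * ℓ) (μ : Fin 2) (Φ : Site L → ℤˣ) (x : Site L) :
    ((if IsGood μ Φ x then 1 else 0) + (if IsGood μ Φ (mirror x) then 1 else 0) : ℕ) ≤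
      (if IsGood μ (foldFlux ℓ Φ) x then 1 else 0) +
        if IsGood μ (foldFlux ℓ (Φ ∘ mirror)) x then 1 else 0 := by
  have hE : Even L := ⟨2 * ℓ, by omega⟩
  by_cases hx : x.1.val = 0 ∨ x.1.val = 2 * ℓ
  · by_cases hμ : Even (coord μ x).val
    · rw [if_pos (isGood_foldFlux_line hL μ Φ hx hμ), if_pos (isGood_foldFlux_line hL μ _ hx hμ)]
      split_ifs <;> simp
    · rw [if_neg (fun h => hμ h.1), if_neg (fun h => hμ ((even_coord_mirror hE μ x).mp h.1))]
      simp
  · rcases lt_or_ge x.1.val (2 * ℓ) with h | h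
    · simp only [isGood_foldFlux_left hL μ _ (by omega : 0 < x.1.val) h, isGood_mirror hE]
      exact le_rfl
    · simp only [isGood_foldFlux_right hL μ _ (by omega : 2 * ℓ < x.1.val), isGood_mirror hE,
        mirror_mirror]
      rw [add_comm]

theorem sum_isGood_mirror (μ : Fin 2) (Φ : Site L → ℤˣ) :
    2 * ∑ x, (if IsGood μ Φ x then 1 else 0) =
      ∑ x, ((if IsGood μ Φ x then 1 else 0) + (if IsGood μ Φ (mirror x) then 1 else 0)) := by
  rw [two_mul, Finset.sum_add_distrib]
  congr 1
  exact (Equiv.sum_comp mirror fun x => if IsGood μ Φ x then 1 else 0).symm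

/-- Folding increases the number of good plaquettes on average, strictly unless the plaquettes on
the reflection line are good. -/
theorem goodCount_fold_lt (hL : L = 4 * ℓ) (Φ : Site L → ℤˣ) {j : ZMod L}
    (hj : ¬IsGood 0 Φ (0, j)) :
    2 * goodCount Φ < goodCount (foldFlux ℓ Φ) + goodCount (foldFlux ℓ (Φ ∘ mirror)) := by
  rw [goodCount, goodCount, goodCount, Finset.mul_sum, ← Finset.sum_add_distrib]
  refine Finset.sum_lt_sum (fun μ _ => ?_) ⟨0, Finset.mem_univ _, ?_⟩
  · rw [sum_isGood_mirror, ← Finset.sum_add_distrib]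
    exact Finset.sum_le_sum fun x _ => isGood_foldFlux_add hL μ Φ x
  · rw [sum_isGood_mirror, ← Finset.sum_add_distrib]
    -- The plaquette `(0, j)` is its own mirror image: it contributes nothing before folding and `2`
    -- afterwards.
    refine Finset.sum_lt_sum (fun x _ => isGood_foldFlux_add hL 0 Φ x) ⟨(0, j), Finset.mem_univ _, ?_⟩
    have h0 : mirror ((0, j) : Site L) = (0, j) := by simp [mirror_apply]
    have hv : (((0, j) : Site L).1).val = 0 := ZMod.val_zero
    have he : Even (coord 0 ((0, j) : Site L)).val := by simp [coord]
    rw [h0, if_neg hj, if_pos (isGood_foldFlux_line hL 0 Φ (Or.inl hv) he),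
      if_pos (isGood_foldFlux_line hL 0 _ (Or.inl hv) he)]
    simp

theorem oddOddCount_translate (hL : Even L) (Φ : Site L → ℤˣ) {v : Site L} (h1 : Even v.1.val)
    (h2 : Even v.2.val) : oddOddCount (fun x => Φ (x + v)) = oddOddCount Φ := by
  rw [oddOddCount, oddOddCount]
  conv_rhs => rw [← Equiv.sum_comp (Equiv.addRight v)]
  refine Finset.sum_congr rfl fun x _ => ?_
  have : IsOddOdd (x + v) ↔ IsOddOdd x := by
    have e1 := val_add_mod_two hL x.1 v.1
    have e2 := val_add_mod_two hL x.2 v.2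
    rw [Nat.even_iff] at h1 h2
    simp only [IsOddOdd, Nat.odd_iff, Prod.fst_add, Prod.snd_add]
    omega
  simp only [Equiv.coe_addRight, this]

theorem isGood_translate (hL : Even L) (μ : Fin 2) (Φ : Site L → ℤˣ) {v : Site L}
    (h1 : Even v.1.val) (h2 : Even v.2.val) (x : Site L) :
    IsGood μ (fun x => Φ (x + v)) x ↔ IsGood μ Φ (x + v) := by
  have : Even (coord μ (x + v)).val ↔ Even (coord μ x).val := by
    have e1 := val_add_mod_two hL x.1 v.1
    have e2 := val_add_mod_two hL x.2 v.2
    rw [Nat.even_iff] at h1 h2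
    unfold coord
    simp only [Nat.even_iff, Prod.fst_add, Prod.snd_add]
    split_ifs <;> omega
  unfold IsGood
  simp only [this, sub_add_eq_add_sub, add_right_comm x (e μ) v]

theorem goodCount_translate (hL : Even L) (Φ : Site L → ℤˣ) {v : Site L} (h1 : Even v.1.val)
    (h2 : Even v.2.val) : goodCount (fun x => Φ (x + v)) = goodCount Φ := by
  rw [goodCount, goodCount]
  refine Finset.sum_congr rfl fun μ _ => ?_
  conv_rhs => rw [← Equiv.sum_comp (Equiv.addRight v)]
  exact Finset.sum_congr rfl fun x _ => if_congr (isGood_translate hL μ Φ h1 h2 x) rfl rfl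

theorem oddOddCount_swap (Φ : Site L → ℤˣ) :
    oddOddCount (fun x => Φ x.swap) = oddOddCount Φ := by
  rw [oddOddCount, oddOddCount, ← Equiv.sum_comp (Equiv.prodComm _ _)]
  simp only [IsOddOdd, Equiv.prodComm_apply, Prod.fst_swap, Prod.snd_swap, and_comm, Prod.swap_swap]

theorem isGood_swap (μ : Fin 2) (Φ : Site L → ℤˣ) (x : Site L) :
    IsGood μ (fun x => Φ x.swap) x ↔ IsGood (1 - μ) Φ x.swap := by
  have hc : coord (1 - μ) x.swap = coord μ x := by
    fin_cases μ <;> simp [coord]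
  unfold IsGood
  rw [hc, swap_e, ← Prod.swap_sub, ← Prod.swap_add]

theorem goodCount_swap (Φ : Site L → ℤˣ) :
    goodCount (fun x => Φ x.swap) = goodCount Φ := by
  rw [goodCount, goodCount, ← Equiv.sum_comp (Equiv.subLeft (1 : Fin 2))]
  refine Finset.sum_congr rfl fun μ _ => ?_
  rw [← Equiv.sum_comp (Equiv.prodComm _ _)]
  simp only [isGood_swap, Equiv.prodComm_apply, Prod.swap_swap, Equiv.subLeft_apply, sub_sub_cancel]

/-- A configuration all of whose candidate plaquettes are good is the `π`-flux configuration or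
the chessboard. -/
theorem eq_of_isGood (hL : Even L) {Φ : Site L → ℤˣ}
    (h0 : ∀ x : Site L, Even x.1.val → IsGood 0 Φ x) (h1 : ∀ x : Site L, Even x.2.val → IsGood 1 Φ x) :
    (Φ = fun _ => -1) ∨ Φ = chessboard L := by
  have hconst : ∀ x y : Site L, IsOddOdd x → IsOddOdd y → Φ x = Φ y := by
    have step1 : ∀ (i j : ZMod L), Odd i.val → Φ (i + 1 + 1, j) = Φ (i, j) := by
      intro i j hi
      have := (h0 (i + 1, j) ((even_val_add_one hL i).mpr (Nat.not_even_iff_odd.mpr hi))).2.2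
      simpa [e] using this.symm
    have step2 : ∀ (i j : ZMod L), Odd j.val → Φ (i, j + 1 + 1) = Φ (i, j) := by
      intro i j hj
      have := (h1 (i, j + 1) ((even_val_add_one hL j).mpr (Nat.not_even_iff_odd.mpr hj))).2.2
      simpa [e] using this.symm
    have walk : ∀ f : ZMod L → ℤˣ, (∀ i, Odd i.val → f (i + 1 + 1) = f i) →
        ∀ i, Odd i.val → f i = f 1 := by
      intro f hf i hi
      have : ∀ n : ℕ, f (1 + (2 * n : ℕ)) = f 1 ∧ Odd (1 + ((2 * n : ℕ) : ZMod L)).val := by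
        intro n
        induction n with
        | zero =>
          refine ⟨by simp, ?_⟩
          have := even_val_add_one hL 0
          rw [zero_add, ZMod.val_zero] at this
          simp only [Nat.mul_zero, Nat.cast_zero, add_zero, ← Nat.not_even_iff_odd]
          exact fun h => (this.mp h) Even.zero
        | succ n ih =>
          have e1 : (1 + ((2 * (n + 1) : ℕ) : ZMod L)) = 1 + ((2 * n : ℕ) : ZMod L) + 1 + 1 := by
            push_cast; ring
          rw [e1]
          refine ⟨(hf _ ih.2).trans ih.1, ?_⟩
          rw [← Nat.not_even_iff_odd, even_val_add_one hL, even_val_add_one hL, not_not,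
            Nat.not_even_iff_odd]
          exact ih.2
      obtain ⟨k, hk⟩ := hi
      have h := (this k).1
      rw [show (1 + ((2 * k : ℕ) : ZMod L)) = i by
        rw [← ZMod.natCast_zmod_val i, hk]; push_cast; ring] at h
      exact h
    have h11 : ∀ x : Site L, IsOddOdd x → Φ x = Φ (1, 1) := by
      rintro ⟨i, j⟩ ⟨hi, hj⟩
      rw [walk (fun i => Φ (i, j)) (fun i hi => step1 i j hi) i hi]
      exact walk (fun j => Φ (1, j)) (fun j hj => step2 1 j hj) j hj
    intro x y hx hy
    rw [h11 x hx, h11 y hy]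
  have heven : ∀ x, ¬IsOddOdd x → Φ x = -1 := by
    intro x hx
    rw [IsOddOdd, not_and_or, Nat.not_odd_iff_even, Nat.not_odd_iff_even] at hx
    rcases hx with hx | hx
    · exact (h0 x hx).2.1
    · exact (h1 x hx).2.1
  by_cases h : ∃ x, IsOddOdd x ∧ Φ x = 1
  · obtain ⟨x, hx, hx1⟩ := h
    right
    funext y
    by_cases hy : IsOddOdd y
    · rw [hconst y x hy hx, hx1]
      exact (if_pos hy).symm
    · rw [heven y hy]
      exact (if_neg hy).symm
  · left
    push Not at h
    funext y
    by_cases hy : IsOddOdd y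
    · exact (Int.units_eq_one_or _).resolve_left (h y hy)
    · exact heven y hy

/-- Each plaquette is odd-odd for exactly one of the four shifts of the sublattice. -/
theorem sum_oddOddCount (hL : Even L) (Φ : Site L → ℤˣ) :
    oddOddCount Φ + oddOddCount (fun x => Φ (x + e 0)) + oddOddCount (fun x => Φ (x + e 1)) +
      oddOddCount (fun x => Φ (x + (e 0 + e 1))) = zeroFluxCount Φ := by
  have hshift : ∀ v : Site L, oddOddCount (fun x => Φ (x + v)) =
      ∑ y, if IsOddOdd (y - v) ∧ Φ y = 1 then 1 else 0 := by
    intro v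
    rw [oddOddCount]
    conv_rhs => rw [← Equiv.sum_comp (Equiv.addRight v)]
    simp
  rw [hshift, hshift, hshift, oddOddCount, zeroFluxCount, Finset.card_filter,
    ← Finset.sum_add_distrib, ← Finset.sum_add_distrib, ← Finset.sum_add_distrib]
  refine Finset.sum_congr rfl fun y _ => ?_
  by_cases hΦ : Φ y = 1
  · simp only [hΦ, and_true, if_true, IsOddOdd, e, ← Nat.not_even_iff_odd]
    by_cases h1 : Even y.1.val <;> by_cases h2 : Even y.2.val <;>
      simp [h1, h2, even_val_sub_one hL]
  · simp [hΦ]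

theorem zeroFluxCount_eq_oddOddCount_chessboard :
    oddOddCount (chessboard L) = oddOddCount (fun _ : Site L => (1 : ℤˣ)) := by
  refine Finset.sum_congr rfl fun x _ => ?_
  by_cases h : IsOddOdd x
  · have : chessboard L x = 1 := if_pos h
    simp only [this]
  · simp [h]

theorem four_mul_oddOddCount_chessboard (hL : Even L) :
    4 * oddOddCount (chessboard L) = L ^ 2 := by
  have h := sum_oddOddCount hL (fun _ : Site L => (1 : ℤˣ))
  rw [zeroFluxCount_eq_oddOddCount_chessboard]
  have h2 : zeroFluxCount (fun _ : Site L => (1 : ℤˣ)) = L ^ 2 := by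
    simp [zeroFluxCount, sq]
  rw [h2] at h
  omega

theorem oddOddCount_pi : oddOddCount (fun _ : Site L => (-1 : ℤˣ)) = 0 := by
  refine Finset.sum_eq_zero fun x _ => ?_
  rw [if_neg]
  rintro ⟨-, h⟩
  have : (-1 : ℤˣ) ≠ 1 := by decide
  exact this h

end Counts

/-! ### The chessboard estimate -/

section Chessboard
set_option linter.unusedSectionVars false
variable {L : ℕ} [NeZero L] {ℓ : ℕ}

/-- The properties of the partition function used in the chessboard estimate. -/
structure IsReflectionPositive (ℓ : ℕ) (f : GaugeField L → ℝ) : Prop where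
  nonneg : ∀ σ, 0 ≤ f σ
  translate : ∀ v σ, f (translate v σ) = f σ
  exchange : ∀ σ, f (exchange σ) = f σ
  reflections : ∀ σ, ∃ σ₁ σ₂ : GaugeField L, f σ ^ 2 ≤ f σ₁ * f σ₂ ∧
    plaquetteFlux σ₁ = foldFlux ℓ (plaquetteFlux σ) ∧
    plaquetteFlux σ₂ = foldFlux ℓ (plaquetteFlux σ ∘ mirror) ∧
    horizontalFlux σ₁ = -1 ∧ verticalFlux σ₁ = verticalFlux σ

/-- Used with `a` a maximum: both reflections of a maximizer are again maximizers. -/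
theorem eq_of_sq_le_mul {a b c : ℝ} (ha : 0 < a) (hb : 0 ≤ b) (hba : b ≤ a) (hca : c ≤ a)
    (h : a ^ 2 ≤ b * c) : b = a ∧ c = a := by
  have hb' : b = a := by nlinarith
  subst hb'
  exact ⟨rfl, le_antisymm hca (le_of_mul_le_mul_left (by rwa [← sq]) ha)⟩

namespace IsReflectionPositive

/-- Among the gauge fields with flux `π` everywhere, the one with boundary fluxes `(-1, -1)` has the
largest partition function. -/
theorem le_of_pi {f : GaugeField L → ℝ} (hf : IsReflectionPositive ℓ f) {P : ℝ} (hP : 0 < P)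
    (hpi : ∀ σ, HasFluxes σ (fun _ => -1) (-1) (-1) → f σ = P) {σ : GaugeField L}
    (hσ : plaquetteFlux σ = fun _ => -1) : f σ ≤ P := by
  have hfold : ∀ Φ : Site L → ℤˣ, (Φ = fun _ => -1) → foldFlux ℓ Φ = fun _ => -1 := by
    rintro Φ rfl
    funext x
    simp [foldFlux]
  -- Folding a maximizer keeps it maximal and sets the horizontal flux to `-1`. After exchanging the
  -- axes that flux is vertical, where a second fold preserves it while fixing the other.
  obtain ⟨σ₀, hσ₀, hmax⟩ := Finset.exists_max_image
    (Finset.univ.filter fun σ : GaugeField L => plaquetteFlux σ = fun _ => -1) f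
    ⟨σ, by simpa using hσ⟩
  simp only [Finset.mem_filter, Finset.mem_univ, true_and] at hσ₀ hmax
  refine (hmax σ hσ).trans ?_
  rcases (hf.nonneg σ₀).eq_or_lt with h0 | h0
  · rw [← h0]; exact hP.le
  have step : ∀ τ : GaugeField L, (plaquetteFlux τ = fun _ => -1) → f τ = f σ₀ →
      ∃ τ₁ : GaugeField L, (plaquetteFlux τ₁ = fun _ => -1) ∧ f τ₁ = f σ₀ ∧
        horizontalFlux τ₁ = -1 ∧ verticalFlux τ₁ = verticalFlux τ := by
    intro τ hτ hfτ
    obtain ⟨τ₁, τ₂, h, h1, h2, h3, h4⟩ := hf.reflections τ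
    have h1' := h1.trans (hfold _ hτ)
    have h2' := h2.trans (hfold _ (by rw [hτ]; rfl))
    rw [hfτ] at h
    exact ⟨τ₁, h1', (eq_of_sq_le_mul h0 (hf.nonneg _) (hmax _ h1') (hmax _ h2') h).1, h3, h4⟩
  obtain ⟨σ₁, h1, h2, h3, -⟩ := step σ₀ hσ₀ rfl
  have h5 : plaquetteFlux (Z2Gauge.exchange σ₁) = fun _ => -1 := by
    funext x
    rw [plaquetteFlux_exchange, h1]
  obtain ⟨σ₂, k1, k2, k3, k4⟩ := step (Z2Gauge.exchange σ₁) h5 ((hf.exchange σ₁).trans h2)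
  rw [verticalFlux_exchange, h3] at k4
  rw [← k2, hpi σ₂ ⟨congrFun k1, k3, k4⟩]

/-- The chessboard estimate for the plaquettes with odd coordinates. -/
theorem le_mul_pow (hL : L = 4 * ℓ) {f : GaugeField L → ℝ} (hf : IsReflectionPositive ℓ f)
    {P r : ℝ} (hr : 0 < r) (hP : 0 < P)
    (hpi : ∀ σ : GaugeField L, (plaquetteFlux σ = fun _ => -1) → f σ ≤ P)
    (hchess : ∀ σ : GaugeField L, plaquetteFlux σ = chessboard L →
      f σ ≤ P * r ^ oddOddCount (chessboard L)) (σ : GaugeField L) :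
    f σ ≤ P * r ^ oddOddCount (plaquetteFlux σ) := by
  have hE : Even L := ⟨2 * ℓ, by omega⟩
  -- The counts of the two foldings add up to twice the original count, so the weighted function
  -- inherits the reflection inequality and its maximum can be studied instead.
  set F : GaugeField L → ℝ := fun σ => f σ / r ^ oddOddCount (plaquetteFlux σ) with hF
  have hF0 : ∀ σ, 0 ≤ F σ := fun σ => div_nonneg (hf.nonneg σ) (pow_nonneg hr.le _)
  suffices h : ∀ σ, F σ ≤ P from (div_le_iff₀ (pow_pos hr _)).mp (h σ)
  obtain ⟨σ₀, hσ₀⟩ := Finite.exists_max F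
  obtain ⟨τ, hτ, hτmax⟩ := Finset.exists_max_image
    (Finset.univ.filter fun σ : GaugeField L => F σ = F σ₀) (fun σ => goodCount (plaquetteFlux σ))
    ⟨σ₀, by simp⟩
  simp only [Finset.mem_filter, Finset.mem_univ, true_and] at hτ hτmax
  intro σ
  refine (hσ₀ σ).trans ?_
  rcases (hF0 σ₀).eq_or_lt with h0 | h0
  · rw [← h0]; exact hP.le
  -- a maximizer with the maximal number of good plaquettes is good on the reflection line
  have good : ∀ τ' : GaugeField L, F τ' = F σ₀ →
      goodCount (plaquetteFlux τ') = goodCount (plaquetteFlux τ) →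
      ∀ j, IsGood 0 (plaquetteFlux τ') (0, j) := by
    intro τ' h1 h2 j
    by_contra hj
    obtain ⟨τ₁, τ₂, h, e1, e2, -, -⟩ := hf.reflections τ'
    have hlt := goodCount_fold_lt hL _ hj
    have hcount := oddOddCount_fold hL (plaquetteFlux τ')
    rw [← e1, ← e2] at hlt hcount
    have hFF : F τ' ^ 2 ≤ F τ₁ * F τ₂ := by
      simp only [hF]
      rw [div_pow, div_mul_div_comm, ← pow_add, hcount, ← pow_mul, mul_comm _ 2]
      exact div_le_div_of_nonneg_right h (pow_nonneg hr.le _)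
    rw [h1] at hFF
    obtain ⟨m1, m2⟩ := eq_of_sq_le_mul h0 (hF0 τ₁) (hσ₀ τ₁) (hσ₀ τ₂) hFF
    have := hτmax τ₁ m1
    have := hτmax τ₂ m2
    omega
  have hgood : ∀ τ' : GaugeField L, F τ' = F σ₀ →
      goodCount (plaquetteFlux τ') = goodCount (plaquetteFlux τ) →
      ∀ x : Site L, Even x.1.val → IsGood 0 (plaquetteFlux τ') x := by
    intro τ' h1 h2 x hx
    -- Translation by an even vector preserves both counts, so the line column `0` can be moved onto
    -- any even column.
    obtain ⟨v, hv⟩ : ∃ v : Site L, v = (x.1, 0) := ⟨_, rfl⟩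
    have hflux : plaquetteFlux (Z2Gauge.translate v τ') = fun y => plaquetteFlux τ' (y + v) :=
      funext fun y => plaquetteFlux_translate _ _ _
    have hx' : Even v.1.val := by rwa [hv]
    have h0' : Even v.2.val := by simp [hv]
    have hg := good (Z2Gauge.translate v τ')
      (by simp only [hF] at h1 ⊢
          rw [hf.translate, hflux, oddOddCount_translate hE _ hx' h0', h1])
      (by rw [hflux, goodCount_translate hE _ hx' h0', h2]) x.2
    rw [hflux, isGood_translate hE 0 _ hx' h0', hv] at hg
    simpa using hg
  have hex : plaquetteFlux (Z2Gauge.exchange τ) = fun y => plaquetteFlux τ y.swap :=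
    funext fun y => plaquetteFlux_exchange _ _
  have hg1 : ∀ x : Site L, Even x.2.val → IsGood 1 (plaquetteFlux τ) x := by
    intro x hx
    have hg := hgood (Z2Gauge.exchange τ)
      (by simp only [hF] at hτ ⊢
          rw [hf.exchange, hex, oddOddCount_swap, hτ])
      (by rw [hex, goodCount_swap]) x.swap hx
    rw [hex, isGood_swap] at hg
    simpa using hg
  rw [← hτ]
  rcases eq_of_isGood hE (hgood τ hτ rfl) hg1 with h | h
  · simp only [hF]
    rw [h, oddOddCount_pi, pow_zero, div_one]
    exact hpi τ h
  · simp only [hF]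
    rw [h, div_le_iff₀ (pow_pos hr _)]
    exact hchess τ h

/-- The chessboard estimate. -/
theorem pow_four_le (hL : L = 4 * ℓ) {f : GaugeField L → ℝ} (hf : IsReflectionPositive ℓ f)
    {P r : ℝ} (hr : 0 < r) (hP : 0 < P)
    (hpi : ∀ σ : GaugeField L, (plaquetteFlux σ = fun _ => -1) → f σ ≤ P)
    (hchess : ∀ σ : GaugeField L, plaquetteFlux σ = chessboard L →
      f σ ≤ P * r ^ oddOddCount (chessboard L)) (σ : GaugeField L) :
    f σ ^ 4 ≤ P ^ 4 * r ^ zeroFluxCount (plaquetteFlux σ) := by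
  have hE : Even L := ⟨2 * ℓ, by omega⟩
  -- The shifts `0`, `e 0`, `e 1`, `e 0 + e 1` give the estimate on four sublattices that partition
  -- the plaquettes; their product has the full count as exponent.
  have hv : ∀ v : Site L, f σ ≤ P * r ^ oddOddCount (fun x => plaquetteFlux σ (x + v)) := by
    intro v
    have h := hf.le_mul_pow hL hr hP hpi hchess (Z2Gauge.translate v σ)
    rwa [hf.translate, show plaquetteFlux (Z2Gauge.translate v σ) =
      fun x => plaquetteFlux σ (x + v) from funext fun y => plaquetteFlux_translate _ _ _] at h
  have h0 := hf.le_mul_pow hL hr hP hpi hchess σ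
  rw [← sum_oddOddCount hE (plaquetteFlux σ)]
  have hn := hf.nonneg σ
  have h1 := mul_le_mul (mul_le_mul h0 (hv (e 0)) hn (hn.trans h0))
    (mul_le_mul (hv (e 1)) (hv (e 0 + e 1)) hn (hn.trans (hv (e 1)))) (mul_nonneg hn hn)
    (mul_nonneg (hn.trans h0) (hn.trans (hv (e 0))))
  calc f σ ^ 4 = _ := by ring
    _ ≤ _ := h1
    _ = _ := by rw [pow_add, pow_add, pow_add]; ring

end IsReflectionPositive

/-- The partition functions are reflection positive. -/
theorem isReflectionPositive_gaugeZ (hL : L = 4 * ℓ) (s : ℤˣ) {t β : ℝ} (ht : 0 < t) (hβ : 0 < β) :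
    IsReflectionPositive ℓ (gaugeZ (L := L) s β t) where
  nonneg := gaugeZ_nonneg ⟨ℓ, hL⟩ s hβ t
  translate := gaugeZ_translate ⟨ℓ, hL⟩ s hβ t
  exchange := gaugeZ_exchange ⟨ℓ, hL⟩ s hβ t
  reflections := exists_reflections hL s ht hβ

end Chessboard

/-! ### Algebra of covariant shifts in the chessboard background -/

section Algebra
set_option linter.unusedSimpArgs false

/-- The relations of the signed shifts `U`, `V`, their inverses, and the projections `f`, `g` onto the
sites with even first, respectively second, coordinate in the chessboard flux configuration. -/
structure IsChessboardAlgebra {R : Type*} [Ring R] (U U' V V' f g : R) : Prop where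
  UU' : U * U' = 1
  U'U : U' * U = 1
  VV' : V * V' = 1
  V'V : V' * V = 1
  Uf : U * f = U - f * U
  Ug : U * g = g * U
  Vf : V * f = f * V
  Vg : V * g = V - g * V
  ff : f * f = f
  gg : g * g = g
  gf : g * f = f * g
  UV : U * V = 2 • (f * (g * (V * U))) - V * U

namespace IsChessboardAlgebra
variable {R : Type*} [Ring R] {U U' V V' f g : R}

theorem mul_mul_of_mul_eq {a b c : R} (h : a * b = c) (z : R) : a * (b * z) = c * z := by
  rw [← mul_assoc, h]

theorem conj_commute {a a' b : R} (h1 : a * a' = 1) (h2 : a' * a = 1) (h : a * b = b * a) :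
    a' * b = b * a' := by
  have := congrArg (fun z => a' * z * a') h
  simp only [← mul_assoc, h2, one_mul] at this
  rw [mul_assoc, mul_assoc, h1, mul_one] at this
  exact this.symm

theorem conj_sub {a a' b : R} (h1 : a * a' = 1) (h2 : a' * a = 1) (h : a * b = a - b * a) :
    a' * b = a' - b * a' := by
  have := congrArg (fun z => a' * z * a') h
  simp only [mul_sub, sub_mul, ← mul_assoc, h2, one_mul] at this
  rw [mul_assoc (a' * b), h1, mul_one] at this
  rw [this]; abel

variable (h : IsChessboardAlgebra U U' V V' f g)
include h

theorem U'f : U' * f = U' - f * U' := conj_sub h.UU' h.U'U h.Uf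
theorem U'g : U' * g = g * U' := conj_commute h.UU' h.U'U h.Ug
theorem V'f : V' * f = f * V' := conj_commute h.VV' h.V'V h.Vf
theorem V'g : V' * g = V' - g * V' := conj_sub h.VV' h.V'V h.Vg

end IsChessboardAlgebra

/-- The operator exchanging the diagonally opposite corners of the plaquettes with flux `0`. -/
def diag {R : Type*} [Ring R] (U U' V V' f g : R) : R :=
  f * g * (V * U) + f * (1 - g) * (V' * U) + (1 - f) * g * (V * U') + (1 - f) * (1 - g) * (V' * U')

/-- For idempotent `P`, the element `2 P - 1` is an involution. -/
theorem swap_of_idempotent {R : Type*} [Ring R] {P Y Z : R} (hP : P * P = P)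
    (h : Y = 2 • (P * Z) - Z) : Z = 2 • (P * Y) - Y := by
  have h1 : P * Y = P * Z := by
    rw [h, mul_sub, mul_smul_comm, ← mul_assoc, hP, two_smul]; abel
  rw [h1, h]; abel

namespace IsChessboardAlgebra
variable {R : Type*} [Ring R] {U U' V V' f g : R} (h : IsChessboardAlgebra U U' V V' f g)
include h

theorem fg_idem : (f * g) * (f * g) = f * g := by
  rw [mul_assoc, ← mul_assoc g, h.gf, mul_assoc f, h.gg, ← mul_assoc, h.ff]

/-- The chessboard is symmetric under reversing the second axis, which trades `V` for `V'` and even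
rows for odd ones. Together with `exchange` this yields the four commutation rules of shifts and
inverses from the single relation `UV`. -/
theorem swap_g : IsChessboardAlgebra U U' V' V f (1 - g) where
  UU' := h.UU'
  U'U := h.U'U
  VV' := h.V'V
  V'V := h.VV'
  Uf := h.Uf
  Ug := by rw [mul_sub, sub_mul, h.Ug]; simp
  Vf := h.V'f
  Vg := by rw [mul_sub, sub_mul, h.V'g]; simp
  ff := h.ff
  gg := by simp [mul_sub, sub_mul, h.gg]
  gf := by rw [mul_sub, sub_mul, h.gf]; simp
  UV := by
    have hP : (f * (1 - g)) * (f * (1 - g)) = f * (1 - g) := by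
      have e1 : (1 - g) * f = f * (1 - g) := by rw [mul_sub, sub_mul, h.gf]; simp
      have e2 : (1 - g) * (1 - g) = 1 - g := by simp [mul_sub, sub_mul, h.gg]
      rw [mul_assoc, ← mul_assoc (1 - g), e1, mul_assoc f, e2, ← mul_assoc, h.ff]
    have h1 : V' * (U * V) * V' = V' * U := by
      rw [mul_assoc, mul_assoc, h.VV', mul_one]
    have h2 : V' * (2 • (f * (g * (V * U))) - V * U) * V' =
        2 • ((f * (1 - g)) * (U * V')) - U * V' := by
      have e1 : V' * (f * (g * (V * U))) = f * (1 - g) * U := by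
        rw [mul_mul_of_mul_eq h.V'f, mul_assoc f V', mul_mul_of_mul_eq h.V'g, sub_mul,
          mul_assoc g, mul_mul_of_mul_eq h.V'V, one_mul, mul_assoc f, sub_mul, one_mul]
      rw [mul_sub, mul_smul_comm, e1, mul_mul_of_mul_eq h.V'V, one_mul, sub_mul, smul_mul_assoc,
        mul_assoc _ U V']
    have h3 := swap_of_idempotent hP (h1.symm.trans (by rw [h.UV, h2]))
    rw [h3]
    simp only [mul_assoc]

theorem exchange : IsChessboardAlgebra V V' U U' g f where
  UU' := h.VV'
  U'U := h.V'V
  VV' := h.UU'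
  V'V := h.U'U
  Uf := h.Vg
  Ug := h.Vf
  Vf := h.Ug
  Vg := h.Uf
  ff := h.gg
  gg := h.ff
  gf := h.gf.symm
  UV := by
    have := swap_of_idempotent h.fg_idem (Y := U * V) (Z := V * U) (by rw [h.UV, mul_assoc f])
    rw [this, ← h.gf, mul_assoc]

theorem swap_f : IsChessboardAlgebra U' U V V' (1 - f) g := h.exchange.swap_g.exchange

theorem UV' : U * V' = 2 • (f * (V' * U)) - 2 • (f * (g * (V' * U))) - V' * U := by
  rw [h.swap_g.UV, sub_mul, mul_sub, smul_sub, one_mul]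

theorem U'V : U' * V = 2 • (g * (V * U')) - 2 • (f * (g * (V * U'))) - V * U' := by
  rw [h.swap_f.UV, sub_mul, smul_sub, one_mul]

theorem U'V' : U' * V' = V' * U' - 2 • (f * (V' * U')) - 2 • (g * (V' * U')) +
    2 • (f * (g * (V' * U'))) := by
  rw [h.swap_f.swap_g.UV]
  simp only [sub_mul, mul_sub, one_mul, smul_sub]
  abel

/-- Crossing a flux-0 plaquette to the opposite corner and back gives sign `+1`. The relations serve
as rewriting rules towards a normal form with projections first, then powers of `V`, then powers of
`U`. -/
theorem diag_mul_self : diag U U' V V' f g * diag U U' V V' f g = 1 := by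
  unfold diag
  simp only [mul_add, add_mul, mul_sub, sub_mul, mul_one, one_mul, mul_assoc, mul_smul_comm,
    smul_mul_assoc, h.UU', h.U'U, h.VV', h.V'V, h.Uf, h.Ug, h.U'f, h.U'g, h.Vf, h.Vg, h.V'f, h.V'g,
    h.ff, h.gg, h.gf, h.UV, h.UV', h.U'V, h.U'V',
    mul_mul_of_mul_eq h.UU', mul_mul_of_mul_eq h.U'U, mul_mul_of_mul_eq h.VV',
    mul_mul_of_mul_eq h.V'V, mul_mul_of_mul_eq h.Uf, mul_mul_of_mul_eq h.Ug,
    mul_mul_of_mul_eq h.U'f, mul_mul_of_mul_eq h.U'g, mul_mul_of_mul_eq h.Vf,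
    mul_mul_of_mul_eq h.Vg, mul_mul_of_mul_eq h.V'f, mul_mul_of_mul_eq h.V'g,
    mul_mul_of_mul_eq h.ff, mul_mul_of_mul_eq h.gg, mul_mul_of_mul_eq h.gf,
    mul_mul_of_mul_eq h.UV, mul_mul_of_mul_eq h.UV', mul_mul_of_mul_eq h.U'V,
    mul_mul_of_mul_eq h.U'V']
  abel

/-- Diagonal hops stay within rows and columns where flux 0 and π alternate. Commuting one past a
straight double hop encloses one plaquette of each kind, whence the sign `-1`. -/
theorem diag_anticomm : (U * U + U' * U' + (V * V + V' * V')) * diag U U' V V' f g +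
    diag U U' V V' f g * (U * U + U' * U' + (V * V + V' * V')) = 0 := by
  unfold diag
  simp only [mul_add, add_mul, mul_sub, sub_mul, mul_one, one_mul, mul_assoc, mul_smul_comm,
    smul_mul_assoc, h.UU', h.U'U, h.VV', h.V'V, h.Uf, h.Ug, h.U'f, h.U'g, h.Vf, h.Vg, h.V'f, h.V'g,
    h.ff, h.gg, h.gf, h.UV, h.UV', h.U'V, h.U'V',
    mul_mul_of_mul_eq h.UU', mul_mul_of_mul_eq h.U'U, mul_mul_of_mul_eq h.VV',
    mul_mul_of_mul_eq h.V'V, mul_mul_of_mul_eq h.Uf, mul_mul_of_mul_eq h.Ug,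
    mul_mul_of_mul_eq h.U'f, mul_mul_of_mul_eq h.U'g, mul_mul_of_mul_eq h.Vf,
    mul_mul_of_mul_eq h.Vg, mul_mul_of_mul_eq h.V'f, mul_mul_of_mul_eq h.V'g,
    mul_mul_of_mul_eq h.ff, mul_mul_of_mul_eq h.gg, mul_mul_of_mul_eq h.gf,
    mul_mul_of_mul_eq h.UV, mul_mul_of_mul_eq h.UV', mul_mul_of_mul_eq h.U'V,
    mul_mul_of_mul_eq h.U'V']
  abel

/-- Perpendicular double hops enclose a 2×2 block with exactly one flux-0 plaquette, of total flux
`-1`; they anticommute and the mixed terms drop out. -/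
theorem straight_mul_self : (U * U + U' * U' + (V * V + V' * V')) *
    (U * U + U' * U' + (V * V + V' * V')) = 4 + (U * (U * (U * U)) + U' * (U' * (U' * U')) +
      (V * (V * (V * V)) + V' * (V' * (V' * V')))) := by
  rw [show (4 : R) = 1 + 1 + 1 + 1 by norm_num]
  simp only [mul_add, add_mul, mul_sub, sub_mul, mul_one, one_mul, mul_assoc, mul_smul_comm,
    smul_mul_assoc, h.UU', h.U'U, h.VV', h.V'V, h.Uf, h.Ug, h.U'f, h.U'g, h.Vf, h.Vg, h.V'f, h.V'g,
    h.ff, h.gg, h.gf, h.UV, h.UV', h.U'V, h.U'V',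
    mul_mul_of_mul_eq h.UU', mul_mul_of_mul_eq h.U'U, mul_mul_of_mul_eq h.VV',
    mul_mul_of_mul_eq h.V'V, mul_mul_of_mul_eq h.Uf, mul_mul_of_mul_eq h.Ug,
    mul_mul_of_mul_eq h.U'f, mul_mul_of_mul_eq h.U'g, mul_mul_of_mul_eq h.Vf,
    mul_mul_of_mul_eq h.Vg, mul_mul_of_mul_eq h.V'f, mul_mul_of_mul_eq h.V'g,
    mul_mul_of_mul_eq h.ff, mul_mul_of_mul_eq h.gg, mul_mul_of_mul_eq h.gf,
    mul_mul_of_mul_eq h.UV, mul_mul_of_mul_eq h.UV', mul_mul_of_mul_eq h.U'V,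
    mul_mul_of_mul_eq h.U'V']
  abel

/-- The two paths to a diagonal neighbour enclose one plaquette: they cancel for flux π and add for
flux 0. The `4` counts the back-and-forth hops. -/
theorem sum_mul_self : (U + U' + V + V') * (U + U' + V + V') =
    (U * U + U' * U' + (V * V + V' * V')) + 4 + 2 • diag U U' V V' f g := by
  rw [show (4 : R) = 1 + 1 + 1 + 1 by norm_num, diag]
  simp only [mul_add, add_mul, mul_sub, sub_mul, mul_one, one_mul, mul_assoc, mul_smul_comm,
    smul_mul_assoc, h.UU', h.U'U, h.VV', h.V'V, h.Uf, h.Ug, h.U'f, h.U'g, h.Vf, h.Vg, h.V'f, h.V'g,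
    h.ff, h.gg, h.gf, h.UV, h.UV', h.U'V, h.U'V',
    mul_mul_of_mul_eq h.UU', mul_mul_of_mul_eq h.U'U, mul_mul_of_mul_eq h.VV',
    mul_mul_of_mul_eq h.V'V, mul_mul_of_mul_eq h.Uf, mul_mul_of_mul_eq h.Ug,
    mul_mul_of_mul_eq h.U'f, mul_mul_of_mul_eq h.U'g, mul_mul_of_mul_eq h.Vf,
    mul_mul_of_mul_eq h.Vg, mul_mul_of_mul_eq h.V'f, mul_mul_of_mul_eq h.V'g,
    mul_mul_of_mul_eq h.ff, mul_mul_of_mul_eq h.gg, mul_mul_of_mul_eq h.gf,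
    mul_mul_of_mul_eq h.UV, mul_mul_of_mul_eq h.UV', mul_mul_of_mul_eq h.U'V,
    mul_mul_of_mul_eq h.U'V']
  abel

/-- Since the straight part anticommutes with the involution `diag`, the cross terms vanish. On a
null vector of the sum the left side acts as `16`, which `8` plus four isometries cannot reach. -/
theorem sum_pow_four : ((U + U' + V + V') * (U + U' + V + V') - 4) *
    ((U + U' + V + V') * (U + U' + V + V') - 4) = 8 + (U * (U * (U * U)) + U' * (U' * (U' * U')) +
      (V * (V * (V * V)) + V' * (V' * (V' * V')))) := by
  have h1 := h.diag_mul_self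
  have h2 := h.diag_anticomm
  have h3 := h.straight_mul_self
  rw [h.sum_mul_self]
  generalize diag U U' V V' f g = E at h1 h2 ⊢
  generalize U * U + U' * U' + (V * V + V' * V') = K at h2 h3 ⊢
  have h4 : (K + 4 + 2 • E - 4) * (K + 4 + 2 • E - 4) =
      K * K + 4 • (E * E) + 2 • (K * E + E * K) := by noncomm_ring
  rw [h4, h1, h2, h3]
  norm_num
  abel_nf
  norm_num
  abel

end IsChessboardAlgebra
end Algebra

/-! ### Invertibility of the hopping matrix for the chessboard and π configurations -/

section Invertibility
set_option linter.unusedSectionVars false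
variable {L : ℕ} [NeZero L]

/-- The covariant shift by `-e μ`. -/
def shift (σ : GaugeField L) (μ : Fin 2) : Module.End ℝ (Site L → ℝ) where
  toFun ψ x := (((σ x μ : ℤˣ) : ℤ) : ℝ) * ψ (x + e μ)
  map_add' ψ φ := by ext x; simp [mul_add]
  map_smul' c ψ := by ext x; simp [mul_left_comm]

/-- The covariant shift by `e μ`. -/
def unshift (σ : GaugeField L) (μ : Fin 2) : Module.End ℝ (Site L → ℝ) where
  toFun ψ x := (((σ (x - e μ) μ : ℤˣ) : ℤ) : ℝ) * ψ (x - e μ)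
  map_add' ψ φ := by ext x; simp [mul_add]
  map_smul' c ψ := by ext x; simp [mul_left_comm]

theorem shift_apply (σ : GaugeField L) (μ : Fin 2) (ψ : Site L → ℝ) (x : Site L) :
    shift σ μ ψ x = (((σ x μ : ℤˣ) : ℤ) : ℝ) * ψ (x + e μ) := rfl

theorem unshift_apply (σ : GaugeField L) (μ : Fin 2) (ψ : Site L → ℝ) (x : Site L) :
    unshift σ μ ψ x = (((σ (x - e μ) μ : ℤˣ) : ℤ) : ℝ) * ψ (x - e μ) := rfl

theorem real_cast_sq (u : ℤˣ) : (((u : ℤˣ) : ℤ) : ℝ) * (((u : ℤˣ) : ℤ) : ℝ) = 1 := by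
  rcases Int.units_eq_one_or u with h | h <;> simp [h]

theorem abs_real_cast (u : ℤˣ) : |(((u : ℤˣ) : ℤ) : ℝ)| = 1 := by
  rcases Int.units_eq_one_or u with h | h <;> simp [h]

theorem shift_mul_unshift (σ : GaugeField L) (μ : Fin 2) : shift σ μ * unshift σ μ = 1 := by
  refine LinearMap.ext fun ψ => ?_
  funext x
  rw [Module.End.mul_apply, shift_apply, unshift_apply, add_sub_cancel_right, ← mul_assoc,
    real_cast_sq, one_mul, Module.End.one_apply]

theorem unshift_mul_shift (σ : GaugeField L) (μ : Fin 2) : unshift σ μ * shift σ μ = 1 := by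
  refine LinearMap.ext fun ψ => ?_
  funext x
  rw [Module.End.mul_apply, unshift_apply, shift_apply, sub_add_cancel, ← mul_assoc,
    real_cast_sq, one_mul, Module.End.one_apply]

theorem hopping_mulVec (t : ℝ) (σ : GaugeField L) (ψ : Site L → ℝ) :
    (hopping t σ).mulVec ψ =
      -t • (shift σ 0 + unshift σ 0 + shift σ 1 + unshift σ 1) ψ := by
  funext x
  have h : ∀ μ : Fin 2, ∑ y, ((if x + e μ = y then (((σ x μ : ℤˣ) : ℤ) : ℝ) else 0) +
      if y + e μ = x then (((σ y μ : ℤˣ) : ℤ) : ℝ) else 0) * ψ y =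
      shift σ μ ψ x + unshift σ μ ψ x := by
    intro μ
    have h1 : ∀ y, y + e μ = x ↔ x - e μ = y := fun y => by rw [sub_eq_iff_eq_add, eq_comm]
    simp only [h1, add_mul, Finset.sum_add_distrib, ite_mul, zero_mul, Finset.sum_ite_eq,
      Finset.mem_univ, if_true]
    rfl
  simp only [Matrix.mulVec, dotProduct, hopping_apply, mul_assoc, ← Finset.mul_sum]
  simp only [Finset.sum_mul]
  rw [Finset.sum_comm]
  simp only [h, Fin.sum_univ_two, Pi.smul_apply, LinearMap.add_apply, Pi.add_apply, smul_eq_mul]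
  ring

theorem hopping_det_ne_zero {t : ℝ} (ht : 0 < t) {σ : GaugeField L}
    (h : ∀ ψ, (shift σ 0 + unshift σ 0 + shift σ 1 + unshift σ 1) ψ = 0 → ψ = 0) :
    (hopping t σ).det ≠ 0 := by
  intro h0
  obtain ⟨ψ, hψ, h1⟩ := Matrix.exists_mulVec_eq_zero_iff.mpr h0
  rw [hopping_mulVec, smul_eq_zero] at h1
  exact hψ (h ψ (h1.resolve_left (by linarith)))

theorem shift_mul_shift (σ : GaugeField L) (ψ : Site L → ℝ) (x : Site L) :
    (shift σ 0 * shift σ 1) ψ x =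
      (((plaquetteFlux σ (x + e 0 + e 1) : ℤˣ) : ℤ) : ℝ) * (shift σ 1 * shift σ 0) ψ x := by
  have h2 : x + e 0 + e 1 - e 1 = x + e 0 := by abel
  have h3 : x + e 0 + e 1 - e 0 = x + e 1 := by abel
  have h4 : x + e 1 + e 0 = x + e 0 + e 1 := by abel
  simp only [Module.End.mul_apply, shift_apply, plaquetteFlux, h2, h3, h4, add_sub_cancel_right]
  push_cast
  have hA := real_cast_sq (σ x 1)
  have hB := real_cast_sq (σ (x + e 1) 0)
  generalize (((σ x 1 : ℤˣ) : ℤ) : ℝ) = a at hA ⊢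
  generalize (((σ (x + e 1) 0 : ℤˣ) : ℤ) : ℝ) = b at hB ⊢
  generalize (((σ x 0 : ℤˣ) : ℤ) : ℝ) = p
  generalize (((σ (x + e 0) 1 : ℤˣ) : ℤ) : ℝ) = q
  generalize ψ (x + e 0 + e 1) = c
  linear_combination (-(p * q * c * (b * b))) * hA - p * q * c * hB

theorem norm_shift_le (σ : GaugeField L) (μ : Fin 2) (ψ : Site L → ℝ) : ‖shift σ μ ψ‖ ≤ ‖ψ‖ := by
  refine (pi_norm_le_iff_of_nonneg (norm_nonneg _)).mpr fun x => ?_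
  rw [shift_apply, norm_mul, Real.norm_eq_abs, abs_real_cast, one_mul]
  exact norm_le_pi_norm ψ _

theorem norm_unshift_le (σ : GaugeField L) (μ : Fin 2) (ψ : Site L → ℝ) :
    ‖unshift σ μ ψ‖ ≤ ‖ψ‖ := by
  refine (pi_norm_le_iff_of_nonneg (norm_nonneg _)).mpr fun x => ?_
  rw [unshift_apply, norm_mul, Real.norm_eq_abs, abs_real_cast, one_mul]
  exact norm_le_pi_norm ψ _

/-- The projection onto the functions supported on the sites with even coordinate `μ`. -/
def evenProj (L : ℕ) [NeZero L] (μ : Fin 2) : Module.End ℝ (Site L → ℝ) where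
  toFun ψ x := if Even (coord μ x).val then ψ x else 0
  map_add' ψ φ := by ext x; simp only [Pi.add_apply]; split_ifs <;> simp
  map_smul' c ψ := by ext x; simp

theorem evenProj_apply (μ : Fin 2) (ψ : Site L → ℝ) (x : Site L) :
    evenProj L μ ψ x = if Even (coord μ x).val then ψ x else 0 := rfl

theorem even_coord_add_e_self (hL : Even L) (μ : Fin 2) (x : Site L) :
    Even (coord μ (x + e μ)).val ↔ ¬Even (coord μ x).val := by
  fin_cases μ <;> simp [coord, e, even_val_add_one hL]

theorem coord_add_e_of_ne {μ ν : Fin 2} (h : μ ≠ ν) (x : Site L) :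
    coord ν (x + e μ) = coord ν x := by
  fin_cases μ <;> fin_cases ν <;> simp [coord, e] at h ⊢

theorem shift_mul_evenProj_self (hL : Even L) (σ : GaugeField L) (μ : Fin 2) :
    shift σ μ * evenProj L μ = shift σ μ - evenProj L μ * shift σ μ := by
  refine LinearMap.ext fun ψ => ?_
  funext x
  simp only [Module.End.mul_apply, LinearMap.sub_apply, Pi.sub_apply, shift_apply, evenProj_apply,
    even_coord_add_e_self hL]
  split_ifs <;> simp_all

theorem shift_mul_evenProj_of_ne (σ : GaugeField L) {μ ν : Fin 2} (h : μ ≠ ν) :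
    shift σ μ * evenProj L ν = evenProj L ν * shift σ μ := by
  refine LinearMap.ext fun ψ => ?_
  funext x
  simp only [Module.End.mul_apply, shift_apply, evenProj_apply, coord_add_e_of_ne h]
  split_ifs <;> simp

/-- Plaquettes are labelled by the upper-right corner, so flux 0 occurs exactly when the lower-left
corner has both coordinates even; this is the product of the two projections in `UV`. -/
theorem isChessboardAlgebra (hL : Even L) {σ : GaugeField L} (hσ : plaquetteFlux σ = chessboard L) :
    IsChessboardAlgebra (shift σ 0) (unshift σ 0) (shift σ 1) (unshift σ 1) (evenProj L 0)
      (evenProj L 1) where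
  UU' := shift_mul_unshift σ 0
  U'U := unshift_mul_shift σ 0
  VV' := shift_mul_unshift σ 1
  V'V := unshift_mul_shift σ 1
  Uf := shift_mul_evenProj_self hL σ 0
  Ug := shift_mul_evenProj_of_ne σ (by decide)
  Vf := shift_mul_evenProj_of_ne σ (by decide)
  Vg := shift_mul_evenProj_self hL σ 1
  ff := by
    refine LinearMap.ext fun ψ => ?_; funext x
    simp only [Module.End.mul_apply, evenProj_apply]
    split_ifs <;> rfl
  gg := by
    refine LinearMap.ext fun ψ => ?_; funext x
    simp only [Module.End.mul_apply, evenProj_apply]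
    split_ifs <;> rfl
  gf := by
    refine LinearMap.ext fun ψ => ?_; funext x
    simp only [Module.End.mul_apply, evenProj_apply]
    split_ifs <;> rfl
  UV := by
    refine LinearMap.ext fun ψ => ?_; funext x
    rw [shift_mul_shift, hσ, LinearMap.sub_apply, Pi.sub_apply, LinearMap.smul_apply, Pi.smul_apply]
    generalize shift σ 1 * shift σ 0 = W
    simp only [Module.End.mul_apply, evenProj_apply, chessboard]
    have h0 : Odd (x + e 0 + e 1).1.val ↔ Even (coord 0 x).val := by
      rw [fst_add_e_one, ← Nat.not_even_iff_odd]
      have := even_coord_add_e_self hL 0 x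
      simp only [coord, if_true] at this ⊢
      tauto
    have h1 : Odd (x + e 0 + e 1).2.val ↔ Even (coord 1 x).val := by
      rw [← Nat.not_even_iff_odd]
      have := even_coord_add_e_self hL 1 x
      simp only [coord, one_ne_zero, if_false] at this ⊢
      have h2 : (x + e 0 + e 1).2 = (x + e 1).2 := by simp [e]
      rw [h2]
      tauto
    simp only [h0, h1]
    by_cases h2 : Even (coord 0 x).val <;> by_cases h3 : Even (coord 1 x).val <;>
      simp [h2, h3]
    ring

/-- In the chessboard flux configuration the one-particle Hamiltonian is invertible. -/
theorem hopping_det_ne_zero_of_chessboard (hL : Even L) {t : ℝ} (ht : 0 < t) {σ : GaugeField L}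
    (hσ : plaquetteFlux σ = chessboard L) : (hopping t σ).det ≠ 0 := by
  refine hopping_det_ne_zero ht fun ψ hψ => ?_
  have h := (isChessboardAlgebra hL hσ).sum_pow_four
  set H := shift σ 0 + unshift σ 0 + shift σ 1 + unshift σ 1
  have h1 := congrArg (fun A : Module.End ℝ (Site L → ℝ) => A ψ) h
  have h2 : ((H * H - 4) * (H * H - 4)) ψ = (16 : ℝ) • ψ := by
    have e1 : (H * H - 4) ψ = -(4 : ℝ) • ψ := by
      rw [LinearMap.sub_apply, Module.End.mul_apply, hψ, map_zero, zero_sub,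
        Module.End.ofNat_apply, neg_smul, ofNat_smul_eq_nsmul ℝ]
    rw [Module.End.mul_apply, e1, map_smul, e1, smul_smul]
    norm_num
  simp only [h2, LinearMap.add_apply, Module.End.mul_apply, Module.End.ofNat_apply] at h1
  have h3 : (8 : ℝ) • ψ = shift σ 0 (shift σ 0 (shift σ 0 (shift σ 0 ψ))) +
      unshift σ 0 (unshift σ 0 (unshift σ 0 (unshift σ 0 ψ))) +
      (shift σ 1 (shift σ 1 (shift σ 1 (shift σ 1 ψ))) +
      unshift σ 1 (unshift σ 1 (unshift σ 1 (unshift σ 1 ψ)))) := by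
    have e2 : (16 : ℝ) • ψ = (8 : ℝ) • ψ + (8 : ℝ) • ψ := by rw [← add_smul]; norm_num
    have e3 : (8 : ℕ) • ψ = (8 : ℝ) • ψ := by rw [← Nat.cast_smul_eq_nsmul ℝ]; norm_num
    rw [e2] at h1
    refine add_left_cancel (h1.trans ?_)
    congr 1
  have hs : ∀ μ, ‖shift σ μ (shift σ μ (shift σ μ (shift σ μ ψ)))‖ ≤ ‖ψ‖ := fun μ =>
    (norm_shift_le σ μ _).trans ((norm_shift_le σ μ _).trans ((norm_shift_le σ μ _).trans
      (norm_shift_le σ μ _)))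
  have hu : ∀ μ, ‖unshift σ μ (unshift σ μ (unshift σ μ (unshift σ μ ψ)))‖ ≤ ‖ψ‖ := fun μ =>
    (norm_unshift_le σ μ _).trans ((norm_unshift_le σ μ _).trans ((norm_unshift_le σ μ _).trans
      (norm_unshift_le σ μ _)))
  -- In the sup norm each fourth power of a signed shift is a contraction, so `8 ‖ψ‖ ≤ 4 ‖ψ‖`.
  have h4 := congrArg norm h3
  rw [norm_smul, Real.norm_of_nonneg (by norm_num)] at h4
  have h5 := (norm_add_le _ _).trans (add_le_add ((norm_add_le _ _).trans (add_le_add (hs 0) (hu 0)))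
    ((norm_add_le _ _).trans (add_le_add (hs 1) (hu 1))))
  rw [← h4] at h5
  have h6 : ‖ψ‖ = 0 := le_antisymm (by linarith) (norm_nonneg _)
  exact norm_eq_zero.mp h6

theorem shift_pow_apply (σ : GaugeField L) (n : ℕ) (ψ : Site L → ℝ) (i j : ZMod L) :
    (shift σ 0 ^ n) ψ (i, j) =
      (((∏ k ∈ Finset.range n, σ (i + k, j) 0 : ℤˣ) : ℤ) : ℝ) * ψ (i + n, j) := by
  induction n generalizing ψ with
  | zero => simp
  | succ n ih =>
    rw [pow_succ, Module.End.mul_apply, ih, shift_apply, Finset.prod_range_succ]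
    have : ((i + n, j) : Site L) + e 0 = (i + (n + 1 : ℕ), j) := by
      simp [e, add_assoc]
    rw [this]
    push_cast
    ring

/-- In the `π`-flux configuration all rows carry the same flux. -/
theorem prod_row_of_pi (hL : Even L) {σ : GaugeField L} (hσ : plaquetteFlux σ = fun _ => -1)
    (j : ZMod L) : ∏ i, σ (i, j) 0 = horizontalFlux σ := by
  revert j
  refine forall_of_succ rfl fun j hj => ?_
  rw [← hj]
  have h1 : ∏ i : ZMod L, plaquetteFlux σ (i + 1, j + 1) = 1 := by
    simp [hσ, hL.neg_one_pow]
  simp only [plaquetteFlux_shift, Finset.prod_mul_distrib] at h1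
  have h2 : ∏ i : ZMod L, σ (i + 1, j) 1 = ∏ i : ZMod L, σ (i, j) 1 :=
    Equiv.prod_comp (Equiv.addRight (1 : ZMod L)) fun i => σ (i, j) 1
  rw [h2] at h1
  generalize ∏ i, σ (i, j) 0 = a at h1 ⊢
  generalize ∏ i, σ (i, j) 1 = b at h1
  generalize ∏ i, σ (i, j + 1) 0 = c at h1 ⊢
  revert a b c
  decide

theorem sum_shift_mul (σ : GaugeField L) (μ : Fin 2) (ψ φ : Site L → ℝ) :
    ∑ x, shift σ μ ψ x * φ x = ∑ x, ψ x * unshift σ μ φ x := by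
  rw [← Equiv.sum_comp (Equiv.addRight (e μ)) fun x => ψ x * unshift σ μ φ x]
  refine Finset.sum_congr rfl fun x _ => ?_
  simp only [Equiv.coe_addRight, unshift_apply, shift_apply, add_sub_cancel_right]
  ring

theorem inv_mul_eq_neg {R : Type*} [Ring R] {a a' b : R} (h1 : a * a' = 1) (h2 : a' * a = 1)
    (h : a * b = -(b * a)) : a' * b = -(b * a') := by
  have e1 : a' * (a * b) * a' = b * a' := by rw [← mul_assoc a', h2, one_mul]
  have e2 : a' * -(b * a) * a' = -(a' * b) := by
    rw [mul_neg, neg_mul, mul_assoc, mul_assoc b, h1, mul_one]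
  rw [h, e2] at e1
  rw [← e1, neg_neg]

theorem add_mul_add_eq_neg {R : Type*} [Ring R] {u u' v v' : R} (huu' : u * u' = 1)
    (hu'u : u' * u = 1) (hvv' : v * v' = 1) (hv'v : v' * v = 1) (huv : u * v = -(v * u)) :
    (v + v') * (u + u') = -((u + u') * (v + v')) := by
  have hu'v := inv_mul_eq_neg huu' hu'u huv
  have hvu' : v * u' = -(u' * v) := by rw [hu'v, neg_neg]
  have hvu : v * u = -(u * v) := by rw [huv, neg_neg]
  simp only [mul_add, add_mul, hvu, hvu', inv_mul_eq_neg hvv' hv'v hvu,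
    inv_mul_eq_neg hvv' hv'v hvu']
  abel

theorem add_mul_add_self_of_eq_neg {R : Type*} [Ring R] {a b : R} (h : b * a = -(a * b)) :
    (a + b) * (a + b) = a * a + b * b := by
  rw [mul_add, add_mul, add_mul, h]
  abel

/-- In the `π`-flux configuration with antiperiodic rows the one-particle Hamiltonian is
invertible. -/
theorem hopping_det_ne_zero_of_pi (hL : 4 ∣ L) {t : ℝ} (ht : 0 < t) {σ : GaugeField L}
    (hσ : plaquetteFlux σ = fun _ => -1) (ha : horizontalFlux σ = -1) : (hopping t σ).det ≠ 0 := by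
  have hE : Even L := even_iff_two_dvd.mpr (dvd_trans (by norm_num) hL)
  refine hopping_det_ne_zero ht fun ψ hψ => ?_
  have hUV : shift σ 0 * shift σ 1 = -(shift σ 1 * shift σ 0) := by
    refine LinearMap.ext fun φ => ?_; funext x
    rw [shift_mul_shift, hσ]
    simp
  have hUU' := shift_mul_unshift σ 0
  have hU'U := unshift_mul_shift σ 0
  have hVV' := shift_mul_unshift σ 1
  have hV'V := unshift_mul_shift σ 1
  have hsym : ∀ (μ : Fin 2) (φ χ : Site L → ℝ), ∑ x, (shift σ μ + unshift σ μ) φ x * χ x =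
      ∑ x, φ x * (shift σ μ + unshift σ μ) χ x := by
    intro μ φ χ
    have h1 := sum_shift_mul σ μ φ χ
    have h2 := sum_shift_mul σ μ χ φ
    simp only [LinearMap.add_apply, Pi.add_apply, add_mul, mul_add, Finset.sum_add_distrib]
    rw [h1, add_comm]
    congr 1
    simpa only [mul_comm] using h2.symm
  -- The two directional parts anticommute, so the square of their sum is the sum of their squares.
  -- Both are symmetric, hence a null vector of the sum is annihilated by each.
  have hab := add_mul_add_eq_neg hUU' hU'U hVV' hV'V hUV
  set a := shift σ 0 + unshift σ 0 with hadef
  set b := shift σ 1 + unshift σ 1 with hbdef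
  have hψ' : (a + b) ψ = 0 := by
    rw [← hψ, hadef, hbdef, add_assoc, add_assoc, add_assoc]
  have hsq : a (a ψ) + b (b ψ) = 0 := by
    have h1 := add_mul_add_self_of_eq_neg hab
    have h2 := congrArg (fun A : Module.End ℝ (Site L → ℝ) => A ψ) h1
    simp only [Module.End.mul_apply, hψ', map_zero, LinearMap.add_apply] at h2
    exact h2.symm
  have haψ : a ψ = 0 := by
    have h1 : ∑ x, (a ψ x * a ψ x) + ∑ x, (b ψ x * b ψ x) = 0 := by
      rw [hsym 0, hsym 1, ← Finset.sum_add_distrib]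
      refine Finset.sum_eq_zero fun x _ => ?_
      have := congrFun hsq x
      rw [Pi.add_apply, Pi.zero_apply] at this
      rw [← mul_add, this, mul_zero]
    have h2 : 0 ≤ ∑ x, (b ψ x * b ψ x) := Finset.sum_nonneg fun x _ => mul_self_nonneg _
    have h3 : ∑ x, (a ψ x * a ψ x) = 0 :=
      le_antisymm (by linarith) (Finset.sum_nonneg fun x _ => mul_self_nonneg _)
    funext x
    exact mul_self_eq_zero.mp
      ((Finset.sum_eq_zero_iff_of_nonneg fun x _ => mul_self_nonneg _).mp h3 x (Finset.mem_univ x))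
  have hUU : (shift σ 0 ^ 2) ψ = -ψ := by
    have h1 : unshift σ 0 ψ = -shift σ 0 ψ := by
      rw [hadef, LinearMap.add_apply, add_comm] at haψ
      exact eq_neg_of_add_eq_zero_left haψ
    have h2 := congrArg (shift σ 0) h1
    rw [← Module.End.mul_apply, hUU', Module.End.one_apply, map_neg] at h2
    rw [sq, Module.End.mul_apply]
    exact neg_eq_iff_eq_neg.mp h2.symm
  obtain ⟨m, hm⟩ := hL
  -- The square of the shift is `-1` on `ψ`, so its `L`-th power is `1` because `4 ∣ L`. Transport
  -- once around a row, however, multiplies by the row flux `-1`.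
  have hpow : (shift σ 0 ^ L) ψ = ψ := by
    have h4 : (shift σ 0 ^ 4) ψ = ψ := by
      rw [show 4 = 2 + 2 by norm_num, pow_add, Module.End.mul_apply, hUU, map_neg, hUU, neg_neg]
    have h5 : ∀ n : ℕ, (shift σ 0 ^ (4 * n)) ψ = ψ := by
      intro n
      induction n with
      | zero => simp
      | succ n ih => rw [mul_add, mul_one, pow_add, Module.End.mul_apply, h4, ih]
    exact (congrArg (fun n => (shift σ 0 ^ n) ψ) hm).trans (h5 m)
  funext ⟨i, j⟩
  have h1 := congrFun hpow (i, j)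
  rw [shift_pow_apply] at h1
  have h2 : ∏ k ∈ Finset.range L, σ (i + k, j) 0 = -1 := by
    rw [← prod_univ_eq fun k => σ (i + k, j) 0]
    rw [← ha, ← prod_row_of_pi hE hσ j]
    exact Equiv.prod_comp (Equiv.addLeft i) fun k => σ (k, j) 0
  rw [h2] at h1
  simp at h1 ⊢
  linarith

end Invertibility

/-! ### Normalisation and the logarithmic form of the estimate -/

section Assembly
set_option linter.unusedSectionVars false
variable {L : ℕ} [NeZero L] {ℓ : ℕ}

theorem card_site : Fintype.card (Site L) = L ^ 2 := by
  rw [Fintype.card_prod, ZMod.card, sq]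

/-- Three quarters of the `16 ℓ ^ 2` plaquettes carry flux π, an even number. -/
theorem prod_chessboard (hL : L = 4 * ℓ) : ∏ x, chessboard L x = 1 := by
  have hE : Even L := ⟨2 * ℓ, by omega⟩
  have h1 := four_mul_oddOddCount_chessboard (L := L) hE
  have h2 : L ^ 2 = 16 * ℓ ^ 2 := by rw [hL]; ring
  have h3 : oddOddCount (chessboard L) =
      (Finset.univ.filter fun x : Site L => Odd x.1.val ∧ Odd x.2.val).card := by
    rw [oddOddCount, Finset.sum_boole, Nat.cast_id]
    congr 1
    ext x
    simp only [Finset.mem_filter, IsOddOdd, chessboard]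
    by_cases h : Odd x.1.val ∧ Odd x.2.val <;> simp [h]
  have h4 := Finset.card_filter_add_card_filter_not (s := (Finset.univ : Finset (Site L)))
    fun x : Site L => Odd x.1.val ∧ Odd x.2.val
  rw [← h3, Finset.card_univ, card_site] at h4
  simp only [chessboard, Finset.prod_ite, Finset.prod_const_one, one_mul, Finset.prod_const]
  exact Even.neg_one_pow ⟨6 * ℓ ^ 2, by omega⟩

theorem prod_neg_one (hL : L = 4 * ℓ) : ∏ _x : Site L, (-1 : ℤˣ) = 1 := by
  rw [Finset.prod_const, Finset.card_univ, card_site]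
  exact Even.neg_one_pow ⟨8 * ℓ ^ 2, by rw [hL]; ring⟩

/-- At `z = 0` the logarithm is `⊥` and the negative coefficient turns it into `⊤`, so only positive
`z` carries content. -/
theorem coe_le_mul_logE {β c z : ℝ} (hβ : 0 < β) (hz : 0 ≤ z)
    (h : 0 < z → c ≤ -(1 / β) * Real.log z) : (c : EReal) ≤ ((-(1 / β) : ℝ) : EReal) * logE z := by
  rcases hz.eq_or_lt with h0 | h0
  · rw [← h0, logE, ENNReal.ofReal_zero, ENNReal.log_zero, EReal.coe_mul_bot_of_neg]
    · exact le_top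
    · have : 0 < 1 / β := by positivity
      linarith
  · have : logE z = (Real.log z : ℝ) := by
      rw [logE, ENNReal.log_ofReal_of_pos h0]
    rw [this, ← EReal.coe_mul]
    exact EReal.coe_le_coe_iff.mpr (h h0)

theorem piZ_pos (hL : L = 4 * ℓ) (s : ℤˣ) {t β : ℝ} (ht : 0 < t) (hβ : 0 < β) :
    0 < piZ L s β t := by
  obtain ⟨σ, hσ⟩ := (exists_hasFluxes (L := L) (fun _ => -1) (-1) (-1)).mpr (prod_neg_one hL)
  rw [piZ, fluxZ_eq s β t hσ]
  exact gaugeZ_pos ⟨ℓ, hL⟩ s hβ t (hopping_det_ne_zero_of_pi ⟨ℓ, hL⟩ ht (funext hσ.1) hσ.2.1)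

theorem fluxZ_chessboard_pos (hL : L = 4 * ℓ) (s : ℤˣ) {t β : ℝ} (ht : 0 < t) (hβ : 0 < β)
    (a b : ℤˣ) : 0 < fluxZ s β t (chessboard L) a b := by
  obtain ⟨σ, hσ⟩ := (exists_hasFluxes (chessboard L) a b).mpr (prod_chessboard hL)
  rw [fluxZ_eq s β t hσ]
  exact gaugeZ_pos ⟨ℓ, hL⟩ s hβ t
    (hopping_det_ne_zero_of_chessboard ⟨2 * ℓ, by omega⟩ ht (funext hσ.1))

/-- The chessboard estimate in logarithmic form. -/
theorem log_gaugeZ_le (hL : L = 4 * ℓ) (s : ℤˣ) {t β : ℝ} (ht : 0 < t) (hβ : 0 < β)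
    {σ : GaugeField L} (hpos : 0 < gaugeZ s β t σ) :
    (zeroFluxCount (plaquetteFlux σ) : ℝ) * monopoleGap L s β t -
      (1 / β) * Real.log (piZ L s β t) ≤ -(1 / β) * Real.log (gaugeZ s β t σ) := by
  have hL0 : (0 : ℝ) < L := Nat.cast_pos.mpr (NeZero.pos L)
  have hP := piZ_pos hL s ht hβ
  unfold monopoleGap
  set M := (Finset.univ : Finset (ℤˣ × ℤˣ)).sup' Finset.univ_nonempty
    (fun p => Real.log (fluxZ s β t (chessboard L) p.1 p.2)) with hM
  set P := piZ L s β t with hPdef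
  have hf := isReflectionPositive_gaugeZ hL s ht hβ
  have hcount : (4 : ℝ) * oddOddCount (chessboard L) = (L : ℝ) ^ 2 := by
    exact_mod_cast four_mul_oddOddCount_chessboard (L := L) ⟨2 * ℓ, by omega⟩
  -- The chessboard has `L ^ 2 / 4` flux-0 plaquettes, so this `r` satisfies `P * r ^ (L ^ 2 / 4) =
  -- exp M`. Its factor `4` cancels against the fourth power in the estimate.
  have h := hf.pow_four_le hL (Real.exp_pos (4 * (M - Real.log P) / (L : ℝ) ^ 2)) hP
    (fun σ hσ => hf.le_of_pi hP (fun σ hσ => (fluxZ_eq s β t hσ).symm) hσ) (fun σ hσ => ?_) σ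
  · have h1 := Real.log_le_log (pow_pos hpos 4) h
    rw [Real.log_mul (pow_pos hP 4).ne' (pow_pos (Real.exp_pos _) _).ne', Real.log_pow,
      Real.log_pow, Real.log_pow, Real.log_exp] at h1
    generalize (zeroFluxCount (plaquetteFlux σ) : ℝ) = k at h1 ⊢
    push_cast at h1
    have h2 : Real.log (gaugeZ s β t σ) ≤ Real.log P + k * ((M - Real.log P) / (L : ℝ) ^ 2) := by
      have : k * (4 * (M - Real.log P) / (L : ℝ) ^ 2) =
        4 * (k * ((M - Real.log P) / (L : ℝ) ^ 2)) := by ring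
      linarith
    have h3 := mul_le_mul_of_nonneg_left h2 (one_div_pos.mpr hβ).le
    have h4 : k * (-(1 / (β * (L : ℝ) ^ 2)) * (M - Real.log P)) =
        -(1 / β * (k * ((M - Real.log P) / (L : ℝ) ^ 2))) := by field_simp
    rw [h4]
    linarith
  · have h1 : HasFluxes σ (chessboard L) (horizontalFlux σ) (verticalFlux σ) :=
      ⟨congrFun hσ, rfl, rfl⟩
    have h2 : Real.log (gaugeZ s β t σ) ≤ M := by
      rw [← fluxZ_eq s β t h1]
      exact Finset.le_sup' (fun p : ℤˣ × ℤˣ => Real.log (fluxZ s β t (chessboard L) p.1 p.2))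
        (Finset.mem_univ (horizontalFlux σ, verticalFlux σ))
    have h3 : 0 < gaugeZ s β t σ := by
      rw [← fluxZ_eq s β t h1]
      exact fluxZ_chessboard_pos hL s ht hβ _ _
    have h4 : (oddOddCount (chessboard L) : ℝ) * (4 * (M - Real.log P) / (L : ℝ) ^ 2) =
        M - Real.log P := by
      rw [← hcount]
      have : (oddOddCount (chessboard L) : ℝ) ≠ 0 := by
        intro h0
        rw [h0, mul_zero] at hcount
        exact (pow_pos hL0 2).ne hcount
      field_simp
    rw [← Real.exp_nat_mul, h4, Real.exp_sub, Real.exp_log hP, mul_div_cancel₀ _ hP.ne']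
    exact (Real.log_le_iff_le_exp h3).mp h2

end Assembly
end Z2Gauge

theorem proposition3p2 (ℓ L : ℕ) [NeZero L] (hL : L = 4 * ℓ) (t β : ℝ) (ht : 0 < t) (hβ : 0 < β)
    (s : ℤˣ) :
    0 < piZ L s β t ∧
    (∀ a b : ℤˣ, 0 < fluxZ s β t (chessboard L) a b) ∧
    ∀ Φ : Site L → ℤˣ, ∏ x, Φ x = 1 → ∀ a b : ℤˣ,
      0 ≤ fluxZ s β t Φ a b ∧
      ((((zeroFluxCount Φ : ℝ) * monopoleGap L s β t - (1 / β) * Real.log (piZ L s β t) : ℝ)) :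
          EReal) ≤ ((-(1 / β) : ℝ) : EReal) * logE (fluxZ s β t Φ a b) := by
  refine ⟨piZ_pos hL s ht hβ, fluxZ_chessboard_pos hL s ht hβ, fun Φ hΦ a b => ?_⟩
  obtain ⟨σ, hσ⟩ := (exists_hasFluxes Φ a b).mpr hΦ
  have h0 := gaugeZ_nonneg ⟨ℓ, hL⟩ s hβ t σ
  rw [fluxZ_eq s β t hσ]
  refine ⟨h0, coe_le_mul_logE hβ h0 fun hpos => ?_⟩
  rw [← show plaquetteFlux σ = Φ from funext hσ.1]
  exact log_gaugeZ_le hL s ht hβ hpos
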